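/- **Conventions.** Partitions are identified with Young diagrams (English convention, rows and columns numbered from $0$); the square $(r,c)$ lies on the diagonal of index $c-r$. A skew shape $\chi=\lambda/\mu$ is a pair of partitions $\mu\subseteq\lambda$. Entries of tableaux are natural numbers starting from $0$. The edge sequence of a partition $\nu$ is recorded by $B(\nu)=\{\nu_j-j-1 : j\ge 0\}\subset\mathbb Z$. For $c\in\mathbb Z$ and partitions $U,V$, let $cq_2(\gamma_c,U,V)$ be the partition with $$B(cq_2(\gamma_c,U,V))=\{2(b+c): b\in B(U)\}\cup\{2(b-c)+1 : b\in B(V)\},$$ i.e. with $2$-quotient $(U,V)$ and $2$-core $\gamma_c=cq_2(\gamma_c,\emptyset,\emptyset)$, the staircase with parts $2c-1,\dots,2,1$ if $c>0$ and $-2c,\dots,2,1$ if $c\le 0$. Put $cq_2(\gamma_c,\lambda/\mu,\lambda'/\mu')=cq_2(\gamma_c,\lambda,\lambda')/cq_2(\gamma_c,\mu,\mu')$. **Tableaux.** $SST(\chi)$ is the set of semistandard tableaux of shape $\chi$ (rows weakly, columns strictly increasing). $SST(\chi*\chi')$ is the set of pairs $T_0*T_1=(T_0,T_1)\in SST(\chi)\times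 SST(\chi')$, its weight being the sum of the weights of $T_0$ and $T_1$. $LR(\chi*\chi')$ is the subset for which the word obtained by reading first $T_1$ and then $T_0$, each by rows from top to bottom and from right to left within rows, is a lattice permutation (every prefix has at least as many $k$'s as $(k+1)$'s, for all $k$). A semistandard domino tableau of skew shape $\psi$ is a tiling of $\psi$ by dominoes with entries that increase weakly along rows and strictly down columns (between distinct dominoes); $SSDT(\psi)$ is the set of these. It is a Yamanouchi domino tableau, an element of $Yam_2(\psi)$, if its entries form a lattice permutation when columns are read from right to left and from top to bottom, a horizontal domino being read in the right one of its two columns. The position of a domino is the larger index of the two diagonals it meets. $cq_2(\gamma_c,T_0,T_1)$ is the unique semistandard domino tableau of shape $cq_2(\gamma_c,\chi,\chi')$ such that, for every $k$, the inner shape together with the dominoes with entries $<k$ forms $cq_2(\gamma_c,T_0^{<k},T_1^{<k})$, where $T^{<k}$ denotes the partition formed by the inner shape of $T$ and the squares with entry $<k$. **Moving open chains.** For $i\in\{0,1\}$ the generator $s_i$ of $\tilde S_2$ acts on partitions by removing all removable squares and adding all addable squares on the diagonals of index $\equiv i\pmod 2$. Let $D$ be a semistandard domino tableau of shape $\lambda/\mu$.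 Adding its dominoes to $\mu$ by increasing entry, and for equal entries by increasing position, gives a chain of partitions; applying $s_i$ to all of these gives again such a chain in which consecutive partitions differ by a domino, so to each domino $d$ of $D$ corresponds a moved domino $m_i(d)$. The chains of $D$ for $s_i$ are the classes of the equivalence relation on dominoes generated by $d\cap m_i(e)\neq\emptyset$. A chain is open if replacing its dominoes $d$ by $m_i(d)$ changes the set of squares occupied, and closed otherwise. $s_i\circ D$ is the domino tableau of shape $s_i(\lambda)/s_i(\mu)$ obtained by replacing $d$ by $m_i(d)$, with the same entry, for all $d$ in open chains, and leaving the dominoes in closed chains in place. These operations define an action $(\sigma,D)\mapsto\sigma\circ D$ of $\tilde S_2$. **The maps.** For $T_0*T_1\in SST(\chi*\chi')$, $\chi=\lambda/\mu$, $\chi'=\lambda'/\mu'$, let $n$ be the sum of the length of the first row of $\lambda$ and that of the first column of $\lambda'$. The segregated tableaux for $T_0*T_1$ are the domino tableaux $cq_2(\gamma_k,T_0,T_1)$ with $2k\le -n+1$ and $cq_2(\gamma_k,T_1,T_0)$ with $2k\ge n$. Let $\Phi_c(T_0*T_1)$ and $\Phi'_c(T_0*T_1)$ be the elements of shapes $cq_2(\gamma_c,\chi,\chi')$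 and $cq_2(\gamma_c,\chi',\chi)$, respectively, in the orbit of a segregated tableau $S$ for $T_0*T_1$ under the action $(\sigma,D)\mapsto\sigma\circ D$. **Theorem.** Let $\chi,\chi'$ be skew shapes and $c\in\mathbb Z$. Segregated tableaux for $T_0*T_1$ exist, the elements $\Phi_c(T_0*T_1)$ and $\Phi'_c(T_0*T_1)$ exist, are uniquely determined by their shapes, and do not depend on the choice of $S$; thus weight preserving maps $\Phi_c:SST(\chi*\chi')\to SSDT(cq_2(\gamma_c,\chi,\chi'))$ and $\Phi'_c:SST(\chi*\chi')\to SSDT(cq_2(\gamma_c,\chi',\chi))$ are defined. By restriction, they define (weight preserving) bijections $$LR(\chi*\chi')\to Yam_2(cq_2(\gamma_c,\chi,\chi')),\qquad LR(\chi*\chi')\to Yam_2(cq_2(\gamma_c,\chi',\chi)).$$ -/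

import Mathlib

/-! ### Partitions, contents, and the edge sequence

Partitions are Young diagrams in English convention; rows and columns are numbered from `0`, and the
diagonal (content) of the square `(r, c)` is `c - r`. -/

namespace DominoLR

/-- The index of the diagonal that contains a square. -/
def content (s : ℕ × ℕ) : ℤ := (s.2 : ℤ) - (s.1 : ℤ)

/-- The edge sequence of a partition `ν`, recorded by the set `{ν_j - j - 1 : j ≥ 0}` of the positions
of the vertical edges on the boundary of its diagram. -/
def beads (ν : YoungDiagram) : Set ℤ := Set.range fun j : ℕ => (ν.rowLen j : ℤ) - j - 1

/-- The edge sequence of the partition with `2`-quotient `(U, V)` and `2`-core `γ_c`: its even part is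
the edge sequence of `U` shifted by `c`, its odd part the edge sequence of `V` shifted by `-c`.
For empty `U`, `V` it is the edge sequence of the `2`-core `γ_c` itself, the staircase with parts
`2c-1, …, 2, 1` when `c > 0` and with parts `-2c, …, 2, 1` when `c ≤ 0`. -/
def cqBeads (c : ℤ) (U V : YoungDiagram) : Set ℤ :=
  (fun b => 2 * (b + c)) '' beads U ∪ (fun b => 2 * (b - c) + 1) '' beads V

theorem mem_beads_iff (ν : YoungDiagram) (N : ℕ) (h : ν.colLen 0 ≤ N) (x : ℤ) :
    x ∈ beads ν ↔
      x ∈ (Finset.range N).image (fun j : ℕ => (ν.rowLen j : ℤ) - j - 1) ∨ x < -(N : ℤ) := by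
  have hz : ∀ j, N ≤ j → ν.rowLen j = 0 := by
    intro j hj
    by_contra hne
    have h1 : (j, 0) ∈ ν := YoungDiagram.mem_iff_lt_rowLen.2 (Nat.pos_of_ne_zero hne)
    have h2 := YoungDiagram.mem_iff_lt_colLen.1 h1
    omega
  constructor
  · rintro ⟨j, rfl⟩
    by_cases hj : j < N
    · left
      exact Finset.mem_image.2 ⟨j, Finset.mem_range.2 hj, rfl⟩
    · right
      have := hz j (by omega)
      simp only [this]
      omega
  · rintro (hx | hx)
    · obtain ⟨j, -, rfl⟩ := Finset.mem_image.1 hx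
      exact ⟨j, rfl⟩
    · refine ⟨(-x - 1).toNat, ?_⟩
      have := hz (-x - 1).toNat (by omega)
      simp only [this]
      omega

theorem exists_beads_eq (S : Set ℤ) (N : ℕ) (F : Finset ℤ) (hF : ∀ x ∈ F, -(N : ℤ) ≤ x)
    (hc : F.card = N) (hS : ∀ x, x ∈ S ↔ x ∈ F ∨ x < -(N : ℤ)) :
    ∃ ν : YoungDiagram, beads ν = S := by
  let e := F.orderEmbOfFin hc
  have he : ∀ i : Fin N, -(N : ℤ) + (i : ℕ) ≤ e i := by
    rintro ⟨i, hi⟩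
    induction i with
    | zero => simpa using hF _ (F.orderEmbOfFin_mem hc ⟨0, hi⟩)
    | succ k ih =>
      have h1 := ih (by omega)
      have h2 : e ⟨k, by omega⟩ < e ⟨k + 1, hi⟩ := e.strictMono (by simp [Fin.lt_def])
      simp only at h1 ⊢
      push_cast
      omega
  let f : ℕ → ℕ := fun j => if h : j < N then (e ⟨N - 1 - j, by omega⟩ + j + 1).toNat else 0
  have hf : ∀ j (h : j < N), (f j : ℤ) = e ⟨N - 1 - j, by omega⟩ + j + 1 := by
    intro j h
    have h1 := he ⟨N - 1 - j, by omega⟩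
    simp only at h1
    simp only [f, h, dif_pos]
    rw [Int.toNat_of_nonneg]
    omega
  have hf0 : ∀ j, N ≤ j → f j = 0 := by
    intro j h
    simp [f, Nat.not_lt.2 h]
  have hstep : ∀ j, f (j + 1) ≤ f j := by
    intro j
    by_cases h : j + 1 < N
    · have h1 := hf j (by omega)
      have h2 := hf (j + 1) h
      have h3 : e ⟨N - 1 - (j + 1), by omega⟩ < e ⟨N - 1 - j, by omega⟩ :=
        e.strictMono (by simp only [Fin.lt_def]; omega)
      push_cast at h2
      omega
    · rw [hf0 (j + 1) (by omega)]
      exact Nat.zero_le _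
  have hanti : Antitone f := antitone_nat_of_succ_le hstep
  have hmem : ∀ x : ℕ × ℕ,
      x ∈ (Finset.range N ×ˢ Finset.range (f 0)).filter (fun x => x.2 < f x.1) ↔ x.2 < f x.1 := by
    intro x
    simp only [Finset.mem_filter, Finset.mem_product, Finset.mem_range, and_iff_right_iff_imp]
    intro hx
    refine ⟨?_, lt_of_lt_of_le hx (hanti (Nat.zero_le _))⟩
    by_contra hn
    rw [hf0 _ (by omega)] at hx
    omega
  let ν : YoungDiagram :=
    { cells := (Finset.range N ×ˢ Finset.range (f 0)).filter (fun x => x.2 < f x.1)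
      isLowerSet := by
        intro a b hab ha
        have ha' := (hmem a).1 (Finset.mem_coe.1 ha)
        refine Finset.mem_coe.2 ((hmem b).2 ?_)
        exact lt_of_le_of_lt hab.2 (lt_of_lt_of_le ha' (hanti hab.1)) }
  have hrow : ∀ j, ν.rowLen j = f j := by
    intro j
    have key : ∀ k, k < ν.rowLen j ↔ k < f j := by
      intro k
      rw [← YoungDiagram.mem_iff_lt_rowLen]
      exact hmem (j, k)
    have h1 := key (f j)
    have h2 := key (ν.rowLen j)
    omega
  refine ⟨ν, ?_⟩
  ext x
  rw [hS]
  constructor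
  · rintro ⟨j, rfl⟩
    simp only [hrow]
    by_cases h : j < N
    · left
      rw [hf j h]
      have := F.orderEmbOfFin_mem hc ⟨N - 1 - j, by omega⟩
      convert this using 1
      simp only [e]
      ring
    · right
      rw [hf0 j (by omega)]
      omega
  · rintro (hx | hx)
    · have : x ∈ Set.range (F.orderEmbOfFin hc) := by
        rw [Finset.range_orderEmbOfFin]
        exact hx
      obtain ⟨⟨i, hi⟩, rfl⟩ := this
      refine ⟨N - 1 - i, ?_⟩
      simp only [hrow]
      rw [hf (N - 1 - i) (by omega)]
      have : N - 1 - (N - 1 - i) = i := by omega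
      simp only [this, e]
      ring
    · refine ⟨(-x - 1).toNat, ?_⟩
      simp only [hrow]
      rw [hf0 _ (by omega)]
      omega

theorem exists_cq (c : ℤ) (U V : YoungDiagram) : ∃ ν : YoungDiagram, beads ν = cqBeads c U V := by
  obtain ⟨K, hK⟩ : ∃ K : ℕ, K = U.colLen 0 + V.colLen 0 + c.natAbs := ⟨_, rfl⟩
  obtain ⟨A, hA⟩ : ∃ A : ℕ, (A : ℤ) = K + c := ⟨(K + c).toNat, by omega⟩
  obtain ⟨B, hB⟩ : ∃ B : ℕ, (B : ℤ) = K - c := ⟨(K - c).toNat, by omega⟩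
  have hUA : U.colLen 0 ≤ A := by omega
  have hVB : V.colLen 0 ≤ B := by omega
  have inj : ∀ ν : YoungDiagram, Function.Injective fun j : ℕ => (ν.rowLen j : ℤ) - j - 1 := by
    intro ν
    have : StrictAnti fun j : ℕ => (ν.rowLen j : ℤ) - j - 1 := by
      refine strictAnti_nat_of_succ_lt ?_
      intro j
      have := ν.rowLen_anti j (j + 1) (by omega)
      push_cast
      omega
    exact this.injective
  have low : ∀ (ν : YoungDiagram) (N : ℕ),
      ∀ x ∈ (Finset.range N).image (fun j : ℕ => (ν.rowLen j : ℤ) - j - 1), -(N : ℤ) ≤ x := by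
    intro ν N x hx
    obtain ⟨j, hj, rfl⟩ := Finset.mem_image.1 hx
    have := Finset.mem_range.1 hj
    omega
  let FU := (Finset.range A).image (fun j : ℕ => (U.rowLen j : ℤ) - j - 1)
  let FV := (Finset.range B).image (fun j : ℕ => (V.rowLen j : ℤ) - j - 1)
  have cU : FU.card = A := by rw [Finset.card_image_of_injective _ (inj U), Finset.card_range]
  have cV : FV.card = B := by rw [Finset.card_image_of_injective _ (inj V), Finset.card_range]
  refine exists_beads_eq _ (2 * K)
    (FU.image (fun b => 2 * (b + c)) ∪ FV.image (fun b => 2 * (b - c) + 1)) ?_ ?_ ?_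
  · intro x hx
    rcases Finset.mem_union.1 hx with hx | hx
    · obtain ⟨b, hb, rfl⟩ := Finset.mem_image.1 hx
      have := low U A b hb
      push_cast
      omega
    · obtain ⟨b, hb, rfl⟩ := Finset.mem_image.1 hx
      have := low V B b hb
      push_cast
      omega
  · rw [Finset.card_union_of_disjoint, Finset.card_image_of_injective FU,
      Finset.card_image_of_injective FV, cU, cV]
    · omega
    · intro a b h
      simp only at h
      omega
    · intro a b h
      simp only at h
      omega
    · rw [Finset.disjoint_left]
      intro x h1 h2
      obtain ⟨a, -, rfl⟩ := Finset.mem_image.1 h1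
      obtain ⟨b, -, h⟩ := Finset.mem_image.1 h2
      omega
  · intro x
    simp only [cqBeads, Set.mem_union, Set.mem_image, Finset.mem_union, Finset.mem_image]
    constructor
    · rintro (⟨b, hb, rfl⟩ | ⟨b, hb, rfl⟩)
      · rcases (mem_beads_iff U A hUA b).1 hb with h | h
        · exact Or.inl (Or.inl ⟨b, h, rfl⟩)
        · right
          push_cast
          omega
      · rcases (mem_beads_iff V B hVB b).1 hb with h | h
        · exact Or.inl (Or.inr ⟨b, h, rfl⟩)
        · right
          push_cast
          omega
    · rintro ((⟨b, hb, rfl⟩ | ⟨b, hb, rfl⟩) | hx)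
      · exact Or.inl ⟨b, (mem_beads_iff U A hUA b).2 (Or.inl hb), rfl⟩
      · exact Or.inr ⟨b, (mem_beads_iff V B hVB b).2 (Or.inl hb), rfl⟩
      · push_cast at hx
        rcases Int.even_or_odd' x with ⟨k, hk | hk⟩
        · exact Or.inl ⟨k - c, (mem_beads_iff U A hUA _).2 (Or.inr (by omega)), by omega⟩
        · exact Or.inr ⟨k + c, (mem_beads_iff V B hVB _).2 (Or.inr (by omega)), by omega⟩

/-- `cq c U V` is the partition `cq₂(γ_c, U, V)` with `2`-core `γ_c` and `2`-quotient `(U, V)`. -/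
noncomputable def cq (c : ℤ) (U V : YoungDiagram) : YoungDiagram := (exists_cq c U V).choose

theorem beads_cq (c : ℤ) (U V : YoungDiagram) : beads (cq c U V) = cqBeads c U V :=
  (exists_cq c U V).choose_spec

/-- The smallest Young diagram that contains a given finite set of squares (the set itself, when it is
already a diagram). -/
def hull (s : Finset (ℕ × ℕ)) : YoungDiagram where
  cells := s.biUnion fun x => Finset.Iic x
  isLowerSet := by
    intro a b hab ha
    simp only [Finset.coe_biUnion, Set.mem_iUnion, Finset.mem_coe, Finset.mem_Iic] at ha ⊢
    obtain ⟨x, hx, hax⟩ := ha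
    exact ⟨x, hx, hab.trans hax⟩

/-- The action of the generator `s_i` (`i = 0, 1`) of the affine group `S̃₂` on partitions: the squares on
the diagonals of index congruent to `i` modulo `2` that can be removed are removed, and those that can
be added are added (in the edge sequence, the two edges adjacent to such a diagonal are interchanged). -/
def reflect (i : Fin 2) (ν : YoungDiagram) : YoungDiagram where
  cells :=
    (Finset.range (ν.colLen 0 + 1) ×ˢ Finset.range (ν.rowLen 0 + 1)).filter fun x =>
      if content x ≡ (i : ℕ) [ZMOD 2] then
        (x ∈ ν ∧ ((x.1 + 1, x.2) ∈ ν ∨ (x.1, x.2 + 1) ∈ ν)) ∨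
          (x ∉ ν ∧ (x.1 = 0 ∨ (x.1 - 1, x.2) ∈ ν) ∧ (x.2 = 0 ∨ (x.1, x.2 - 1) ∈ ν))
      else x ∈ ν
  isLowerSet := by
    intro a b hab ha
    simp only [Finset.mem_coe, Finset.mem_filter, Finset.mem_product, Finset.mem_range] at ha ⊢
    obtain ⟨⟨ha1, ha2⟩, ha⟩ := ha
    have h1 : b.1 ≤ a.1 := hab.1
    have h2 : b.2 ≤ a.2 := hab.2
    refine ⟨⟨by omega, by omega⟩, ?_⟩
    by_cases hne : b = a
    · rw [hne]
      exact ha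
    have hlt : ∀ y : ℕ × ℕ, y.1 ≤ a.1 → y.2 ≤ a.2 → y ≠ a → y ∈ ν := by
      intro y hy1 hy2 hya
      by_cases haν : a ∈ ν
      · exact ν.up_left_mem hy1 hy2 haν
      · split_ifs at ha with hp
        · obtain ⟨h, -⟩ | ⟨-, hu, hl⟩ := ha
          · exact absurd h haν
          · rcases Nat.lt_or_ge y.1 a.1 with h | h
            · exact ν.up_left_mem (by omega) hy2 (hu.resolve_left (by omega))
            · have : y.2 ≠ a.2 := fun h' => hya (Prod.ext (by omega) h')
              exact ν.up_left_mem hy1 (by omega) (hl.resolve_left (by omega))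
        · exact absurd ha haν
    have hbν : b ∈ ν := hlt b h1 h2 hne
    split_ifs with hp
    · left
      refine ⟨hbν, ?_⟩
      have haν : ∀ y : ℕ × ℕ, content y = content b + 1 ∨ content y = content b - 1 →
          y.1 ≤ a.1 → y.2 ≤ a.2 → y ∈ ν := by
        intro y hy hy1 hy2
        by_cases hya : y = a
        · subst hya
          rw [if_neg] at ha
          · exact ha
          · simp only [Int.ModEq] at hp ⊢
            omega
        · exact hlt y hy1 hy2 hya
      rcases Nat.lt_or_ge b.1 a.1 with h | h
      · left
        exact haν _ (Or.inr (by simp only [content]; push_cast; ring)) (by simpa using h) h2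
      · right
        have : b.2 ≠ a.2 := fun h' => hne (Prod.ext (by omega) h')
        exact haν _ (Or.inl (by simp only [content]; push_cast; ring)) h1
          (by simp only; omega)
    · exact hbν

/-! ### Skew shapes and semistandard skew tableaux -/

/-- A skew shape `outer / inner`, that is a pair of partitions; it is an actual skew shape when
`inner ≤ outer`. -/
structure SkewShape where
  outer : YoungDiagram
  inner : YoungDiagram

/-- The set of squares of a skew shape. -/
def SkewShape.cells (χ : SkewShape) : Finset (ℕ × ℕ) := χ.outer.cells \ χ.inner.cells

/-- The skew shape `cq₂(γ_c, χ, χ')`. -/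
noncomputable def cqShape (c : ℤ) (χ χ' : SkewShape) : SkewShape :=
  ⟨cq c χ.outer χ'.outer, cq c χ.inner χ'.inner⟩

/-- Fillings of squares by natural numbers; the entries of a tableau start from `0`, and squares outside
its shape are given the value `0`. -/
abbrev Filling := ℕ × ℕ → ℕ

/-- The set of semistandard tableaux of skew shape `χ`. -/
def SST (χ : SkewShape) : Set Filling :=
  {T | (∀ i j₁ j₂, j₁ < j₂ → (i, j₁) ∈ χ.cells → (i, j₂) ∈ χ.cells → T (i, j₁) ≤ T (i, j₂)) ∧
    (∀ i₁ i₂ j, i₁ < i₂ → (i₁, j) ∈ χ.cells → (i₂, j) ∈ χ.cells → T (i₁, j) < T (i₂, j)) ∧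
    ∀ x, x ∉ χ.cells → T x = 0}

/-- The number of entries `k` in a tableau of shape `χ`. -/
def fillingWt (χ : SkewShape) (T : Filling) (k : ℕ) : ℕ := (χ.cells.filter fun x => T x = k).card

/-- The partition formed by the inner shape and the squares with entry less than `k`. -/
def fillingBelow (χ : SkewShape) (T : Filling) (k : ℕ) : YoungDiagram :=
  hull (χ.inner.cells ∪ χ.cells.filter fun x => T x < k)

/-- The tableaux `T₀ * T₁` of shape `χ * χ'`: pairs of semistandard tableaux of shapes `χ` and `χ'`. -/
def SSTStar (χ χ' : SkewShape) : Set (Filling × Filling) := SST χ ×ˢ SST χ'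

/-- The weight of `T₀ * T₁`. -/
def starWt (χ χ' : SkewShape) (T : Filling × Filling) (k : ℕ) : ℕ :=
  fillingWt χ T.1 k + fillingWt χ' T.2 k

/-- `readUpTo χ T s k` is the number of entries `k` of `T` among the squares read no later than `s`,
when the rows are read from top to bottom, each row from right to left. -/
def readUpTo (χ : SkewShape) (T : Filling) (s : ℕ × ℕ) (k : ℕ) : ℕ :=
  (χ.cells.filter fun x => (x.1 < s.1 ∨ x.1 = s.1 ∧ s.2 ≤ x.2) ∧ T x = k).card

/-- The set `LR(χ * χ')` of Littlewood-Richardson tableaux: reading first the entries of `T₁` and then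
those of `T₀` gives a lattice permutation, i.e. in every initial part of the reading each `k`
occurs at least as often as `k + 1`. -/
def LR (χ χ' : SkewShape) : Set (Filling × Filling) :=
  {T | T ∈ SSTStar χ χ' ∧
    (∀ s ∈ χ'.cells, ∀ k, readUpTo χ' T.2 s (k + 1) ≤ readUpTo χ' T.2 s k) ∧
    ∀ s ∈ χ.cells, ∀ k, fillingWt χ' T.2 (k + 1) + readUpTo χ T.1 s (k + 1) ≤
      fillingWt χ' T.2 k + readUpTo χ T.1 s k}

/-! ### Domino tableaux -/

/-- A domino: two adjacent squares. -/
def IsDomino (d : Finset (ℕ × ℕ)) : Prop :=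
  ∃ r c, d = {(r, c), (r + 1, c)} ∨ d = {(r, c), (r, c + 1)}

/-- The position of a domino: the larger of the indices of the two diagonals that it meets. -/
def pos (d : Finset (ℕ × ℕ)) : ℤ := (d.image content).max.unbotD 0

/-- The data of a domino tableau: a skew shape and a set of dominoes, each with an entry. -/
structure DominoTableau where
  shape : SkewShape
  dominoes : Finset (Finset (ℕ × ℕ) × ℕ)

instance : Nonempty DominoTableau := ⟨⟨⟨⊥, ⊥⟩, ∅⟩⟩

/-- `D` is a semistandard domino tableau of shape `ψ`: its dominoes tile `ψ`, and their entries
increase weakly along rows and strictly down columns (for distinct dominoes). -/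
structure IsSSDT (ψ : SkewShape) (D : DominoTableau) : Prop where
  shape_eq : D.shape = ψ
  inner_le : ψ.inner ≤ ψ.outer
  isDomino : ∀ d ∈ D.dominoes, IsDomino d.1
  disjoint : ∀ d ∈ D.dominoes, ∀ e ∈ D.dominoes, d ≠ e → Disjoint d.1 e.1
  cover : D.dominoes.biUnion Prod.fst = ψ.cells
  row_weak : ∀ d ∈ D.dominoes, ∀ e ∈ D.dominoes, ∀ i j₁ j₂,
    (i, j₁) ∈ d.1 → (i, j₂) ∈ e.1 → j₁ < j₂ → d.2 ≤ e.2
  col_strict : ∀ d ∈ D.dominoes, ∀ e ∈ D.dominoes, d ≠ e → ∀ i₁ i₂ j,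
    (i₁, j) ∈ d.1 → (i₂, j) ∈ e.1 → i₁ < i₂ → d.2 < e.2

/-- The set of semistandard domino tableaux of shape `ψ`. -/
def SSDT (ψ : SkewShape) : Set DominoTableau := {D | IsSSDT ψ D}

/-- The number of dominoes with entry `k`. -/
def dominoWt (D : DominoTableau) (k : ℕ) : ℕ := (D.dominoes.filter fun d => d.2 = k).card

/-- The partition formed by the inner shape and the dominoes with entry less than `k`. -/
def dominoBelow (D : DominoTableau) (k : ℕ) : YoungDiagram :=
  hull (D.shape.inner.cells ∪ (D.dominoes.filter fun d => d.2 < k).biUnion Prod.fst)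

/-- The (reversed) column reading order: columns are read from right to left, each one from top to
bottom, and a horizontal domino is read in the right one of the two columns that it meets.
`DominoRead d e` says that `d` is read no later than `e`. -/
def DominoRead (d e : Finset (ℕ × ℕ)) : Prop :=
  e.sup Prod.snd < d.sup Prod.snd ∨
    e.sup Prod.snd = d.sup Prod.snd ∧ (d.image Prod.fst).min ≤ (e.image Prod.fst).min

open Classical in
/-- The number of entries `k` of `D` among the dominoes read no later than `e`. -/
noncomputable def dominoReadUpTo (D : DominoTableau) (e : Finset (ℕ × ℕ)) (k : ℕ) : ℕ :=
  (D.dominoes.filter fun d => DominoRead d.1 e ∧ d.2 = k).card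

/-- The set `Yam₂(ψ)` of Yamanouchi domino tableaux of shape `ψ`: the semistandard ones whose reading in
the order above is a lattice permutation. -/
def Yam2 (ψ : SkewShape) : Set DominoTableau :=
  {D | IsSSDT ψ D ∧
    ∀ e ∈ D.dominoes, ∀ k, dominoReadUpTo D e.1 (k + 1) ≤ dominoReadUpTo D e.1 k}

/-- `D` is the semistandard domino tableau `cq₂(γ_c, T₀, T₁)` of shape `cq₂(γ_c, χ, χ')` that
corresponds to `(T₀, T₁)`: for every `k` its part with entries less than `k` has as shape the one
determined by the parts of `T₀` and `T₁` with entries less than `k`. -/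
def IsCqTableau (c : ℤ) (χ χ' : SkewShape) (T₀ T₁ : Filling) (D : DominoTableau) : Prop :=
  IsSSDT (cqShape c χ χ') D ∧
    ∀ k, dominoBelow D k = cq c (fillingBelow χ T₀ k) (fillingBelow χ' T₁ k)

/-! ### Chains -/

/-- The order in which the dominoes of a semistandard tableau are added in its standardisation:
by increasing entry, and for equal entries by increasing position. -/
def StdBefore (d e : Finset (ℕ × ℕ) × ℕ) : Prop := d.2 < e.2 ∨ d.2 = e.2 ∧ pos d.1 < pos e.1

open Classical in
/-- The partition in the standardisation of `D` to which the domino `d` is added. -/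
noncomputable def stdShape (D : DominoTableau) (d : Finset (ℕ × ℕ) × ℕ) : YoungDiagram :=
  hull (D.shape.inner.cells ∪ (D.dominoes.filter fun e => StdBefore e d).biUnion Prod.fst)

open Classical in
/-- The partition in the standardisation of `D` obtained after adding the domino `d`. -/
noncomputable def stdShapeAfter (D : DominoTableau) (d : Finset (ℕ × ℕ) × ℕ) : YoungDiagram :=
  hull ((stdShape D d).cells ∪ d.1)

/-- The squares occupied by the domino `d` of `D` after it has been moved for `s_i`: applying `s_i` to
all partitions in the standardisation of `D` gives a standard domino tableau, of which the domino that
takes the place of `d` is considered. -/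
noncomputable def moved (i : Fin 2) (D : DominoTableau) (d : Finset (ℕ × ℕ) × ℕ) :
    Finset (ℕ × ℕ) :=
  (reflect i (stdShapeAfter D d)).cells \ (reflect i (stdShape D d)).cells

/-- Two dominoes of `D` that must be moved together, because one of them takes a square from the
other one when it is moved for `s_i`. -/
def Linked (i : Fin 2) (D : DominoTableau) (d e : Finset (ℕ × ℕ) × ℕ) : Prop :=
  d ∈ D.dominoes ∧ e ∈ D.dominoes ∧ ¬ Disjoint d.1 (moved i D e)

open Classical in
/-- The chain for `s_i` of the domino `d` of `D`: the smallest set of dominoes that contains `d` and that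
can be moved independently of the other dominoes. -/
noncomputable def chain (i : Fin 2) (D : DominoTableau) (d : Finset (ℕ × ℕ) × ℕ) :
    Finset (Finset (ℕ × ℕ) × ℕ) :=
  D.dominoes.filter fun e => Relation.EqvGen (Linked i D) d e

/-- The chain of `d` for `s_i` is open: moving it changes the set of squares that is occupied, and
hence the shape. Otherwise the chain is closed. -/
def IsOpenChain (i : Fin 2) (D : DominoTableau) (d : Finset (ℕ × ℕ) × ℕ) : Prop :=
  (chain i D d).biUnion (moved i D) ≠ (chain i D d).biUnion Prod.fst

open Classical in
/-- The tableau `s_i ∘ D`, obtained from `D` by moving all its open chains for `s_i`, while the dominoes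
in closed chains stay in place. Its shape is the image under `s_i` of that of `D` (squares that are
added to, or removed from, both the inner and the outer shape are open chains without dominoes). -/
noncomputable def moveOpen (i : Fin 2) (D : DominoTableau) : DominoTableau where
  shape := ⟨reflect i D.shape.outer, reflect i D.shape.inner⟩
  dominoes := D.dominoes.image fun d => if IsOpenChain i D d then (moved i D d, d.2) else d

/-- The orbit of `S` for the action `(σ, D) ↦ σ ∘ D` of `S̃₂`, which is generated by the involutions
`s_0` and `s_1`: all tableaux `s_{i₁} ∘ (s_{i₂} ∘ ⋯ (s_{i_m} ∘ S))`. -/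
def openOrbit (S : DominoTableau) : Set DominoTableau :=
  {D | Relation.ReflTransGen (fun A B => ∃ i : Fin 2, B = moveOpen i A) S D}

/-! ### The maps `Φ_c` and `Φ'_c` -/

/-- The segregated domino tableaux for `T₀ * T₁`, where `χ = λ/μ`, `χ' = λ'/μ'` and `n` is the sum
of the length of the first row of `λ` and that of the first column of `λ'`: the tableaux
`Σ_k(T₀ * T₁) = cq₂(γ_k, T₀, T₁)` with `2k ≤ -n + 1` and
`Σ'_k(T₀ * T₁) = cq₂(γ_k, T₁, T₀)` with `2k ≥ n`. -/
def Segregated (χ χ' : SkewShape) (T : Filling × Filling) : Set DominoTableau :=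
  {S | ∃ k : ℤ,
    (2 * k ≤ -((χ.outer.rowLen 0 : ℤ) + χ'.outer.colLen 0) + 1 ∧
      IsCqTableau k χ χ' T.1 T.2 S) ∨
    ((χ.outer.rowLen 0 : ℤ) + χ'.outer.colLen 0 ≤ 2 * k ∧ IsCqTableau k χ' χ T.2 T.1 S)}

/-- The element of shape `ψ` in the orbit for the action `(σ, D) ↦ σ ∘ D` of a segregated tableau for
`T₀ * T₁`. -/
noncomputable def orbitElement (χ χ' : SkewShape) (ψ : SkewShape) (T : Filling × Filling) :
    DominoTableau :=
  Classical.epsilon fun D => ∃ S ∈ Segregated χ χ' T, D ∈ openOrbit S ∧ D.shape = ψ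

/-- The map `Φ_c` on tableaux of shape `χ * χ'`. -/
noncomputable def Phi (c : ℤ) (χ χ' : SkewShape) : Filling × Filling → DominoTableau :=
  orbitElement χ χ' (cqShape c χ χ')

/-- The map `Φ'_c` on tableaux of shape `χ * χ'`. -/
noncomputable def Phi' (c : ℤ) (χ χ' : SkewShape) : Filling × Filling → DominoTableau :=
  orbitElement χ χ' (cqShape c χ' χ)

end DominoLR

/-!
Partitions are described by their *profiles*: `prof ν c` is the row of the first square on the diagonal
of index `c` that lies outside `ν`. Profiles turn all geometric statements into linear arithmetic: the
edge sequence has an element at `c` where the profile descends by `1`, the generator `s_i` replaces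
`prof ν c` by `prof ν (c - 1) + prof ν (c + 1) - prof ν c` on the diagonals of parity `i`
(`prof_reflect`), and the partition with `2`-quotient `(U, V)` has as profile a sum of values of those of
`U` and `V` (`prof_node`). Indexing `2`-quotients by `m : ℤ` as in `node m U V`, so that
`cq c U V = node (2 * c) U V` and `cq c V U = node (1 - 2 * c) U V`, the generator `s_i` maps `node m U V`
to `node (m + 1) U V` whenever `m + 1` has parity `i` (`reflect_node`). The segregated tableaux are those
for which `m` is sufficiently small.

*Moving open chains.* A domino meets one diagonal on which squares are fixed by `s_i` and one on which
they move. Moving the domino keeps the fixed square and sends the other one to the opposite side; in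
either place its row is half the sum (rounded down) of two profile values on fixed diagonals
(`IsSSDT.mem_iff_inPlace`, `IsSSDT.mem_moved_iff`). Hence the squares occupied by an initial part of the
standardisation are known up to one square on each moving diagonal, regardless of which chains are
moved; this suffices for the result of moving the open chains to be semistandard (`IsSSDT.moveOpen`).
The moved tableau has the same profiles on fixed diagonals, which makes the operation an involution
(`IsSSDT.moveOpen_moveOpen`). To see that dominoes lie in closed chains it is enough to find a set of
dominoes that contains them and occupies the same squares before and after moving
(`IsSSDT.not_isOpenChain_of_closed`).

*Lattice conditions.* The dominoes with entry `k` form a strip that is determined by the set `X k` of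
their positions. A tableau is Yamanouchi if and only if for all `k` and `x` the number of elements
`≥ x` of `X (k + 1)` is at most the number of elements `≥ x + 1` of `X k` (`IsSSDT.mem_yam2_iff`, with
the condition called `Dominates`); ordinary Littlewood-Richardson tableaux have a similar description
(`mem_LR_iff`). For `x` on a fixed diagonal these numbers do not change when dominoes are moved, so that
the condition could only fail at a *crossing* (`IsCrossing`), a place where a domino of each of the two
strips would have to pass the other. In a Yamanouchi tableau the dominoes in crossings always lie in
closed chains (`IsSSDT.not_isOpenChain_of_isCrossing`), so the condition is preserved
(`IsSSDT.moveOpen_mem_yam2`).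

*Segregated tableaux.* In a segregated tableau the dominoes that come from the two factors lie far apart.
Passing from `m` to `m + 1` therefore moves all dominoes (`IsNode.isOpenChain`), which identifies the
result as the segregated tableau for `m + 1`; and the lattice condition becomes the Littlewood-Richardson
condition for the pair of factors (`IsNode.mem_yam2_iff`).

It follows that the orbit of the segregated tableaux for `T` is one sequence `F m`, indexed by `m : ℤ`, in
which neighbours determine each other by moving open chains (`IsFamily`). The shape of `F m` determines
`m`, except that `m` and `1 - m` give the same shapes when `χ = χ'`; but then `F 1 = F 0`, since their
common shape is fixed by `s_1` and all chains for `s_1` are closed, so the sequence is symmetric.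
Conversely, every semistandard domino tableau for some `m` can be moved to small `m`, where it is
segregated and comes from a unique `T`. As the Yamanouchi condition is constant along the sequence, the
bijections follow.
-/

namespace DominoLR

/-! ### Profiles of partitions -/

theorem exists_not_mem_diag (ν : YoungDiagram) (c : ℤ) :
    ∃ j : ℕ, 0 ≤ (j : ℤ) + c ∧ (j, ((j : ℤ) + c).toNat) ∉ ν := by
  refine ⟨ν.colLen 0 + (-c).toNat, by push_cast; omega, fun h => ?_⟩
  have h1 := YoungDiagram.mem_iff_lt_colLen.1 h
  have h2 := ν.colLen_anti 0 ((((ν.colLen 0 + (-c).toNat : ℕ) : ℤ) + c).toNat) (by omega)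
  omega

/-- The profile of a partition: `prof ν c` is the row of the first square outside `ν` on the diagonal
of index `c`. Equivalently it is the number of beads of `ν` at positions `≥ c`, so that its
descents are the beads. -/
def prof (ν : YoungDiagram) (c : ℤ) : ℤ := (Nat.find (exists_not_mem_diag ν c) : ℕ)

theorem prof_nonneg (ν : YoungDiagram) (c : ℤ) : 0 ≤ prof ν c := by
  simp [prof]

theorem neg_le_prof (ν : YoungDiagram) (c : ℤ) : -c ≤ prof ν c := by
  have := (Nat.find_spec (exists_not_mem_diag ν c)).1
  simp only [prof]
  omega

theorem mem_iff_lt_prof (ν : YoungDiagram) (x : ℕ × ℕ) :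
    x ∈ ν ↔ (x.1 : ℤ) < prof ν (content x) := by
  obtain ⟨r, c⟩ := x
  simp only [prof, content, Nat.cast_lt, Nat.lt_find_iff, not_and, not_not]
  constructor
  · intro h j hj h0
    exact ν.up_left_mem hj (by omega) h
  · intro h
    have := h r le_rfl (by omega)
    have e : ((r : ℤ) + ((c : ℤ) - r)).toNat = c := by omega
    rwa [e] at this

theorem mem_cells_iff_lt_prof (ν : YoungDiagram) (x : ℕ × ℕ) :
    x ∈ ν.cells ↔ (x.1 : ℤ) < prof ν (content x) := by
  rw [YoungDiagram.mem_cells, mem_iff_lt_prof]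

/-- The square in a given row on a given diagonal. -/
def sq (c r : ℤ) : ℕ × ℕ := (r.toNat, (r + c).toNat)

theorem sq_fst {c r : ℤ} (h : 0 ≤ r) : ((sq c r).1 : ℤ) = r := by
  simp [sq, h]

theorem content_sq {c r : ℤ} (h : 0 ≤ r) (h' : -c ≤ r) : content (sq c r) = c := by
  simp only [sq, content]
  omega

theorem sq_content_fst (x : ℕ × ℕ) : sq (content x) x.1 = x := by
  ext <;> simp [sq, content]

theorem eq_sq_iff {c r : ℤ} (h : 0 ≤ r) (h' : -c ≤ r) (x : ℕ × ℕ) :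
    x = sq c r ↔ content x = c ∧ (x.1 : ℤ) = r := by
  constructor
  · rintro rfl
    exact ⟨content_sq h h', sq_fst h⟩
  · rintro ⟨rfl, h2⟩
    rw [← h2, sq_content_fst]

theorem eq_of_content_eq {x y : ℕ × ℕ} (h : content x = content y) (h' : x.1 = y.1) : x = y := by
  rw [← sq_content_fst x, ← sq_content_fst y, h, h']

theorem sq_mem_iff (ν : YoungDiagram) {c r : ℤ} (h : 0 ≤ r) (h' : -c ≤ r) :
    sq c r ∈ ν ↔ r < prof ν c := by
  rw [mem_iff_lt_prof, content_sq h h', sq_fst h]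

/-- A function that describes the squares of `ν` in the way a profile does is the profile of `ν`. -/
theorem prof_eq_of_mem_iff (ν : YoungDiagram) (F : ℤ → ℤ) (h0 : ∀ c, 0 ≤ F c) (h1 : ∀ c, -c ≤ F c)
    (h : ∀ x : ℕ × ℕ, x ∈ ν ↔ (x.1 : ℤ) < F (content x)) (c : ℤ) : prof ν c = F c := by
  have key : ∀ r : ℤ, 0 ≤ r → -c ≤ r → (r < prof ν c ↔ r < F c) := by
    intro r hr hr'
    rw [← sq_mem_iff ν hr hr', h, content_sq hr hr', sq_fst hr]
  have a1 := key _ (prof_nonneg ν c) (neg_le_prof ν c)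
  have a2 := key _ (h0 c) (h1 c)
  omega

theorem prof_succ_le (ν : YoungDiagram) (c : ℤ) : prof ν (c + 1) ≤ prof ν c := by
  by_contra hlt
  have h0 := prof_nonneg ν c
  have h1 := neg_le_prof ν c
  have h2 : sq (c + 1) (prof ν c) ∈ ν := (sq_mem_iff ν h0 (by omega)).2 (by omega)
  have h3 : sq c (prof ν c) ∈ ν := by
    unfold sq at h2 ⊢
    exact ν.up_left_mem le_rfl (by omega) h2
  have := (sq_mem_iff ν h0 h1).1 h3
  omega

theorem prof_le_succ (ν : YoungDiagram) (c : ℤ) : prof ν c ≤ prof ν (c + 1) + 1 := by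
  by_contra hlt
  have h0 := prof_nonneg ν (c + 1)
  have h1 := neg_le_prof ν (c + 1)
  have h2 : sq c (prof ν (c + 1) + 1) ∈ ν := (sq_mem_iff ν (by omega) (by omega)).2 (by omega)
  have h3 : sq (c + 1) (prof ν (c + 1)) ∈ ν := by
    unfold sq at h2 ⊢
    exact ν.up_left_mem (by omega) (by omega) h2
  have := (sq_mem_iff ν h0 h1).1 h3
  omega

theorem ext_prof {ν ν' : YoungDiagram} (h : ∀ c, prof ν c = prof ν' c) : ν = ν' := by
  ext x
  rw [mem_cells_iff_lt_prof, mem_cells_iff_lt_prof, h]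

theorem le_iff_prof {ν ν' : YoungDiagram} : ν ≤ ν' ↔ ∀ c, prof ν c ≤ prof ν' c := by
  constructor
  · intro h c
    by_contra hlt
    have h0 := prof_nonneg ν' c
    have h1 := neg_le_prof ν' c
    have h2 := h ((sq_mem_iff ν h0 h1).2 (by omega))
    have := (sq_mem_iff ν' h0 h1).1 h2
    omega
  · intro h x hx
    rw [mem_iff_lt_prof] at hx ⊢
    have := h (content x)
    omega

theorem prof_antitone (ν : YoungDiagram) {c c' : ℤ} (h : c ≤ c') : prof ν c' ≤ prof ν c := by
  obtain ⟨n, rfl⟩ := Int.le.dest h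
  clear h
  induction n with
  | zero => simp
  | succ n ih =>
    have := prof_succ_le ν (c + n)
    push_cast
    rw [← add_assoc]
    omega

theorem prof_eq_zero (ν : YoungDiagram) {c : ℤ} (h : (ν.rowLen 0 : ℤ) ≤ c) : prof ν c = 0 := by
  by_contra hne
  have h0 := prof_nonneg ν c
  have h1 : sq c 0 ∈ ν := (sq_mem_iff ν le_rfl (by omega)).2 (by omega)
  have h2 : (0, c.toNat) ∈ ν := by simpa [sq] using h1
  have := YoungDiagram.mem_iff_lt_rowLen.1 h2
  omega

theorem prof_eq_neg (ν : YoungDiagram) {c : ℤ} (h : c ≤ -(ν.colLen 0 : ℤ)) : prof ν c = -c := by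
  by_contra hne
  have h0 := neg_le_prof ν c
  have h1 : sq c (-c) ∈ ν := (sq_mem_iff ν (by omega) (by omega)).2 (by omega)
  have h2 : ((-c).toNat, 0) ∈ ν := by simpa [sq] using h1
  have := YoungDiagram.mem_iff_lt_colLen.1 h2
  omega

theorem mem_beads_iff_prof (ν : YoungDiagram) (y : ℤ) :
    y ∈ beads ν ↔ prof ν y = prof ν (y + 1) + 1 := by
  have lt_row : ∀ j k : ℕ, k < ν.rowLen j ↔ (j : ℤ) < prof ν ((k : ℤ) - j) := by
    intro j k
    rw [← YoungDiagram.mem_iff_lt_rowLen, mem_iff_lt_prof]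
    rfl
  have s1 := prof_le_succ ν y
  constructor
  · rintro ⟨j, rfl⟩
    simp only at s1 ⊢
    have h1 := lt_row j (ν.rowLen j)
    have e : ((ν.rowLen j : ℤ) - j - 1 + 1) = (ν.rowLen j : ℤ) - j := by ring
    rw [e] at s1 ⊢
    have h3 : (j : ℤ) < prof ν ((ν.rowLen j : ℤ) - j - 1) := by
      rcases Nat.eq_zero_or_pos (ν.rowLen j) with h | h
      · have := neg_le_prof ν ((ν.rowLen j : ℤ) - j - 1)
        omega
      · have h2 := (lt_row j (ν.rowLen j - 1)).1 (by omega)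
        have e2 : (((ν.rowLen j - 1 : ℕ) : ℤ) - j) = (ν.rowLen j : ℤ) - j - 1 := by omega
        rwa [e2] at h2
    omega
  · intro h
    obtain ⟨j, hj⟩ : ∃ j : ℕ, (j : ℤ) = prof ν (y + 1) :=
      ⟨(prof ν (y + 1)).toNat, by have := prof_nonneg ν (y + 1); omega⟩
    refine ⟨j, ?_⟩
    have h0 := neg_le_prof ν (y + 1)
    have h1 := lt_row j (j + y + 1).toNat
    have e1 : (((j : ℤ) + y + 1).toNat : ℤ) - j = y + 1 := by omega
    rw [e1] at h1
    simp only
    rcases lt_or_ge ((j : ℤ) + y) 0 with h2 | h2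
    · omega
    · have h3 := lt_row j (j + y).toNat
      have e3 : (((j : ℤ) + y).toNat : ℤ) - j = y := by omega
      rw [e3] at h3
      omega

/-- A profile is determined by its descents. -/
theorem eq_of_descents (F G : ℤ → ℤ) (hd : ∀ c, F c - F (c + 1) = G c - G (c + 1))
    {N : ℤ} (hF : ∀ c, N ≤ c → F c = 0) (hG : ∀ c, N ≤ c → G c = 0) (c : ℤ) : F c = G c := by
  rcases le_or_gt N c with h | h
  · rw [hF c h, hG c h]
  · obtain ⟨n, hn⟩ := Int.le.dest h.le
    induction n generalizing c with
    | zero => rw [hF c (by omega), hG c (by omega)]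
    | succ n ih =>
      have h1 := hd c
      have h2 : F (c + 1) = G (c + 1) := by
        rcases le_or_gt N (c + 1) with h' | h'
        · rw [hF _ h', hG _ h']
        · exact ih (c + 1) h' (by push_cast at hn; omega)
      omega

theorem prof_sub_succ (ν : YoungDiagram) (c : ℤ) [Decidable (c ∈ beads ν)] :
    prof ν c - prof ν (c + 1) = if c ∈ beads ν then 1 else 0 := by
  have h1 := prof_succ_le ν c
  have h2 := prof_le_succ ν c
  have h3 := mem_beads_iff_prof ν c
  split_ifs with h <;> simp only [h, true_iff, false_iff] at h3 <;> omega

theorem beads_injective : Function.Injective beads := by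
  classical
  intro ν ν' h
  refine ext_prof (eq_of_descents _ _ (fun c => ?_) (N := max (ν.rowLen 0) (ν'.rowLen 0))
    (fun c hc => prof_eq_zero ν (by omega)) (fun c hc => prof_eq_zero ν' (by omega)))
  rw [prof_sub_succ, prof_sub_succ, h]

/-- Every function with the shape of a profile is the profile of a partition. -/
theorem exists_prof_eq (F : ℤ → ℤ) (h1 : ∀ c, F (c + 1) ≤ F c) (h2 : ∀ c, F c ≤ F (c + 1) + 1)
    (N : ℕ) (hN : ∀ c, (N : ℤ) ≤ c → F c = 0) (hN' : ∀ c, c ≤ -(N : ℤ) → F c = -c) :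
    ∃ ν : YoungDiagram, ∀ c, prof ν c = F c := by
  have mono : ∀ (n : ℕ) (c : ℤ), F (c + n) ≤ F c ∧ F c ≤ F (c + n) + n := by
    intro n
    induction n with
    | zero => simp
    | succ n ih =>
      intro c
      have a1 := ih c
      have a2 := h1 (c + n)
      have a3 := h2 (c + n)
      have e : c + ((n + 1 : ℕ) : ℤ) = c + n + 1 := by push_cast; ring
      rw [e]
      push_cast
      omega
  have mono' : ∀ c c' : ℤ, c ≤ c' → F c' ≤ F c ∧ F c ≤ F c' + (c' - c) := by
    intro c c' h
    obtain ⟨n, rfl⟩ := Int.le.dest h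
    have := mono n c
    omega
  have h0 : ∀ c, 0 ≤ F c := by
    intro c
    have a1 := (mono' c (max c N) (le_max_left _ _)).1
    have a2 := hN (max c N) (le_max_right _ _)
    omega
  have h0' : ∀ c, -c ≤ F c := by
    intro c
    have a1 := (mono' (min c (-N)) c (min_le_left _ _)).2
    have a2 := hN' (min c (-N)) (min_le_right _ _)
    omega
  have bound : ∀ x : ℕ × ℕ, (x.1 : ℤ) < F (content x) → x.1 < N ∧ x.2 < N := by
    rintro ⟨r, c⟩ h
    simp only [content] at h
    have a1 : ((c : ℤ) - r) < N := by
      by_contra hc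
      have := hN _ (not_lt.1 hc)
      omega
    have a2 : -(N : ℤ) < ((c : ℤ) - r) := by
      by_contra hc
      have := hN' _ (not_lt.1 hc)
      omega
    have a3 := (mono' ((c : ℤ) - r) N a1.le).2
    have a4 := (mono' (-(N : ℤ)) ((c : ℤ) - r) a2.le).1
    have a5 := hN N le_rfl
    have a6 := hN' (-N) le_rfl
    simp only
    omega
  refine ⟨⟨(Finset.range N ×ˢ Finset.range N).filter fun x => (x.1 : ℤ) < F (content x), ?_⟩, ?_⟩
  · intro a b hab ha
    simp only [Finset.coe_filter, Finset.mem_product, Finset.mem_range, Set.mem_ofPred_eq] at ha ⊢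
    have b1 : b.1 ≤ a.1 := hab.1
    have b2 : b.2 ≤ a.2 := hab.2
    have hF : (b.1 : ℤ) < F (content b) := by
      have := ha.2
      simp only [content] at this ⊢
      rcases le_total ((b.2 : ℤ) - b.1) ((a.2 : ℤ) - a.1) with h | h
      · have := (mono' _ _ h).1
        omega
      · have := (mono' _ _ h).2
        omega
    exact ⟨by omega, hF⟩
  · intro c
    refine prof_eq_of_mem_iff _ F h0 h0' (fun x => ?_) c
    rw [← YoungDiagram.mem_cells]
    simp only [Finset.mem_filter, Finset.mem_product, Finset.mem_range, and_iff_right_iff_imp]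
    exact bound x

/-! ### Partitions with given `2`-quotient -/

theorem exists_node (m : ℤ) (U V : YoungDiagram) :
    ∃ ν : YoungDiagram, ∀ c, prof ν c = prof U ((c - m + 1) / 2) + prof V ((c + m) / 2) := by
  have step : ∀ c : ℤ, ((c + 1 - m + 1) / 2 = (c - m + 1) / 2 ∧ (c + 1 + m) / 2 = (c + m) / 2 + 1) ∨
      ((c + 1 - m + 1) / 2 = (c - m + 1) / 2 + 1 ∧ (c + 1 + m) / 2 = (c + m) / 2) := by
    intro c
    omega
  refine exists_prof_eq _ (fun c => ?_) (fun c => ?_)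
    (2 * (U.rowLen 0 + V.rowLen 0 + U.colLen 0 + V.colLen 0) + m.natAbs + 2) (fun c hc => ?_)
    (fun c hc => ?_)
  · have a1 := prof_succ_le U ((c - m + 1) / 2)
    have a2 := prof_succ_le V ((c + m) / 2)
    rcases step c with ⟨e1, e2⟩ | ⟨e1, e2⟩ <;> simp only [e1, e2] <;> omega
  · have a1 := prof_le_succ U ((c - m + 1) / 2)
    have a2 := prof_le_succ V ((c + m) / 2)
    rcases step c with ⟨e1, e2⟩ | ⟨e1, e2⟩ <;> simp only [e1, e2] <;> omega
  · rw [prof_eq_zero U, prof_eq_zero V] <;> omega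
  · rw [prof_eq_neg U, prof_eq_neg V] <;> omega

/-- The partition with edge sequence `{2b + m : b ∈ B(U)} ∪ {2b + 1 - m : b ∈ B(V)}`. All partitions
`cq₂(γ_c, U, V)` and `cq₂(γ_c, V, U)` have this form, with `m = 2c` and `m = 1 - 2c` respectively, and
the generators `s_0`, `s_1` permute them by moving to a neighbouring value of `m`. -/
noncomputable def node (m : ℤ) (U V : YoungDiagram) : YoungDiagram := (exists_node m U V).choose

theorem prof_node (m : ℤ) (U V : YoungDiagram) (c : ℤ) :
    prof (node m U V) c = prof U ((c - m + 1) / 2) + prof V ((c + m) / 2) :=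
  (exists_node m U V).choose_spec c

theorem prof_node_left (m : ℤ) (U V : YoungDiagram) (q : ℤ) :
    prof (node m U V) (2 * q + m) = prof U q + prof V (q + m) := by
  rw [prof_node]
  congr 2 <;> omega

theorem prof_node_left_succ (m : ℤ) (U V : YoungDiagram) (q : ℤ) :
    prof (node m U V) (2 * q + m + 1) = prof U (q + 1) + prof V (q + m) := by
  rw [prof_node]
  congr 2 <;> omega

theorem prof_node_right (m : ℤ) (U V : YoungDiagram) (q : ℤ) :
    prof (node m U V) (2 * q + 1 - m) = prof U (q - m + 1) + prof V q := by
  rw [prof_node]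
  congr 2 <;> omega

theorem prof_node_right_succ (m : ℤ) (U V : YoungDiagram) (q : ℤ) :
    prof (node m U V) (2 * q + 1 - m + 1) = prof U (q - m + 1) + prof V (q + 1) := by
  rw [prof_node]
  congr 2 <;> omega

theorem beads_node (m : ℤ) (U V : YoungDiagram) :
    beads (node m U V) = (fun b => 2 * b + m) '' beads U ∪ (fun b => 2 * b + 1 - m) '' beads V := by
  ext y
  simp only [Set.mem_union, Set.mem_image]
  rw [mem_beads_iff_prof]
  constructor
  · intro h
    rcases Int.even_or_odd' (y - m) with ⟨q, hq | hq⟩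
    · obtain rfl : y = 2 * q + m := by omega
      rw [prof_node_left, prof_node_left_succ] at h
      exact Or.inl ⟨q, (mem_beads_iff_prof U q).2 (by omega), rfl⟩
    · obtain ⟨q', hq'⟩ : ∃ q', q' = q + m := ⟨_, rfl⟩
      obtain rfl : y = 2 * q' + 1 - m := by omega
      rw [prof_node_right, prof_node_right_succ] at h
      exact Or.inr ⟨q', (mem_beads_iff_prof V q').2 (by omega), rfl⟩
  · rintro (⟨q, h, rfl⟩ | ⟨q, h, rfl⟩)
    · rw [prof_node_left, prof_node_left_succ]
      rw [mem_beads_iff_prof] at h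
      omega
    · rw [prof_node_right, prof_node_right_succ]
      rw [mem_beads_iff_prof] at h
      omega

theorem cq_eq_node (c : ℤ) (U V : YoungDiagram) : cq c U V = node (2 * c) U V := by
  apply beads_injective
  rw [beads_cq, beads_node, cqBeads]
  congr 1 <;> refine Set.image_congr fun b _ => ?_ <;> ring

theorem cq_eq_node' (c : ℤ) (U V : YoungDiagram) : cq c V U = node (1 - 2 * c) U V := by
  apply beads_injective
  rw [beads_cq, beads_node, cqBeads, Set.union_comm]
  congr 1 <;> refine Set.image_congr fun b _ => ?_ <;> ring

theorem exists_large (U V : YoungDiagram) (M : ℤ) :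
    ∃ N : ℤ, M ≤ N ∧ (∀ c, N ≤ c → prof U c = 0) ∧ (∀ c, N ≤ c → prof V c = 0) :=
  ⟨max M (max (U.rowLen 0) (V.rowLen 0)), by omega, fun c hc => prof_eq_zero U (by omega),
    fun c hc => prof_eq_zero V (by omega)⟩

theorem node_injective {m : ℤ} {U V U' V' : YoungDiagram} (h : node m U V = node m U' V') :
    U = U' ∧ V = V' := by
  constructor
  · apply beads_injective
    ext q
    have h1 := prof_node_left m U V q
    have h2 := prof_node_left_succ m U V q
    rw [h, prof_node_left] at h1
    rw [h, prof_node_left_succ] at h2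
    rw [mem_beads_iff_prof, mem_beads_iff_prof]
    omega
  · apply beads_injective
    ext q
    have h1 := prof_node_right m U V q
    have h2 := prof_node_right_succ m U V q
    rw [h, prof_node_right] at h1
    rw [h, prof_node_right_succ] at h2
    rw [mem_beads_iff_prof, mem_beads_iff_prof]
    omega

theorem node_comm (m : ℤ) (U V : YoungDiagram) : node m U V = node (1 - m) V U := by
  apply ext_prof
  intro c
  rw [prof_node, prof_node, add_comm]
  congr 2 <;> omega

theorem node_eq_same_parity {m j : ℤ} {U V U' V' : YoungDiagram}
    (h : node m U V = node (m + 2 * j) U' V') : j = 0 := by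
  have key : ∀ q, prof U q = prof U' (q - j) := by
    obtain ⟨N, hN, h1, h2⟩ := exists_large U U' 0
    refine eq_of_descents _ _ (fun q => ?_) (N := max N (N + j)) (fun c hc => h1 c (by omega))
      (fun c hc => h2 _ (by omega))
    have a1 := prof_node_left m U V q
    have a2 := prof_node_left_succ m U V q
    have a3 := prof_node_left (m + 2 * j) U' V' (q - j)
    have a4 := prof_node_left_succ (m + 2 * j) U' V' (q - j)
    have e1 : 2 * (q - j) + (m + 2 * j) = 2 * q + m := by ring
    have e2 : q - j + 1 = q + 1 - j := by ring
    rw [e1, ← h] at a3 a4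
    rw [e2] at a4
    omega
  have a := key (-(U.colLen 0 : ℤ) - U'.colLen 0 - |j|)
  have := le_abs_self j
  have := neg_abs_le j
  rw [prof_eq_neg U (by omega), prof_eq_neg U' (by omega)] at a
  omega

/-- The parameters of `node m U V` are determined up to the symmetry `node m U V = node (1 - m) V U`. -/
theorem node_eq_iff {m m' : ℤ} {U V U' V' : YoungDiagram} :
    node m U V = node m' U' V' ↔
      (m' = m ∧ U = U' ∧ V = V') ∨ (m' = 1 - m ∧ U = V' ∧ V = U') := by
  constructor
  · intro h
    rcases Int.even_or_odd' (m' - m) with ⟨j, hj | hj⟩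
    · left
      obtain rfl : m' = m + 2 * j := by omega
      obtain rfl := node_eq_same_parity h
      simp only [mul_zero, add_zero, true_and] at h ⊢
      exact node_injective h
    · right
      rw [node_comm m'] at h
      obtain ⟨i, hi⟩ : ∃ i, 1 - m' = m + 2 * i := ⟨-j - m, by linarith⟩
      rw [hi] at h
      obtain rfl := node_eq_same_parity h
      simp only [mul_zero, add_zero] at h hi
      obtain ⟨h1, h2⟩ := node_injective h
      exact ⟨by omega, h1, h2⟩
  · rintro (⟨rfl, rfl, rfl⟩ | ⟨rfl, rfl, rfl⟩)
    · rfl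
    · exact node_comm _ _ _

/-! ### The action of the generators on profiles -/

/-- The diagonals on which `s_i` may add or remove squares. -/
def IsVar (i : Fin 2) (c : ℤ) : Prop := c % 2 = ((i : ℕ) : ℤ)

instance (i : Fin 2) (c : ℤ) : Decidable (IsVar i c) := inferInstanceAs (Decidable (_ = _))

theorem modEq_iff_isVar (i : Fin 2) (c : ℤ) : c ≡ ((i : ℕ) : ℤ) [ZMOD 2] ↔ IsVar i c := by
  have := i.2
  unfold IsVar Int.ModEq
  omega

theorem isVar_succ_iff (i : Fin 2) (c : ℤ) : IsVar i (c + 1) ↔ ¬ IsVar i c := by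
  have := i.2
  unfold IsVar
  omega

theorem isVar_pred_iff (i : Fin 2) (c : ℤ) : IsVar i (c - 1) ↔ ¬ IsVar i c := by
  have := i.2
  unfold IsVar
  omega

theorem isVar_add_two_iff (i : Fin 2) (c : ℤ) : IsVar i (c + 2) ↔ IsVar i c := by
  unfold IsVar
  omega

theorem isVar_sub_two_iff (i : Fin 2) (c : ℤ) : IsVar i (c - 2) ↔ IsVar i c := by
  unfold IsVar
  omega

theorem mem_reflect (i : Fin 2) (ν : YoungDiagram) (x : ℕ × ℕ) :
    x ∈ reflect i ν ↔ if IsVar i (content x) then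
        (x ∈ ν ∧ ((x.1 + 1, x.2) ∈ ν ∨ (x.1, x.2 + 1) ∈ ν)) ∨
          (x ∉ ν ∧ (x.1 = 0 ∨ (x.1 - 1, x.2) ∈ ν) ∧ (x.2 = 0 ∨ (x.1, x.2 - 1) ∈ ν))
      else x ∈ ν := by
  rw [← YoungDiagram.mem_cells]
  simp only [reflect, Finset.mem_filter, Finset.mem_product, Finset.mem_range, modEq_iff_isVar]
  rw [and_iff_right_iff_imp]
  have inside : ∀ y : ℕ × ℕ, y ∈ ν → y.1 < ν.colLen 0 ∧ y.2 < ν.rowLen 0 := by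
    rintro ⟨r, c⟩ hy
    exact ⟨YoungDiagram.mem_iff_lt_colLen.1 (ν.up_left_mem le_rfl (Nat.zero_le _) hy),
      YoungDiagram.mem_iff_lt_rowLen.1 (ν.up_left_mem (Nat.zero_le _) le_rfl hy)⟩
  intro h
  have key : x ∈ ν ∨ ((x.1 = 0 ∨ (x.1 - 1, x.2) ∈ ν) ∧ (x.2 = 0 ∨ (x.1, x.2 - 1) ∈ ν)) := by
    split_ifs at h
    · rcases h with h | h
      · exact Or.inl h.1
      · exact Or.inr h.2
    · exact Or.inl h
  rcases key with h | ⟨h1, h2⟩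
  · have := inside x h
    omega
  · constructor
    · rcases h1 with h1 | h1
      · omega
      · have := inside _ h1
        simp only at this
        omega
    · rcases h2 with h2 | h2
      · omega
      · have := inside _ h2
        simp only at this
        omega

theorem prof_reflect (i : Fin 2) (ν : YoungDiagram) (c : ℤ) :
    prof (reflect i ν) c =
      if IsVar i c then prof ν (c - 1) + prof ν (c + 1) - prof ν c else prof ν c := by
  have slope : ∀ c, prof ν (c + 1) ≤ prof ν c ∧ prof ν c ≤ prof ν (c + 1) + 1 :=
    fun c => ⟨prof_succ_le ν c, prof_le_succ ν c⟩
  have slope' : ∀ c, prof ν c ≤ prof ν (c - 1) ∧ prof ν (c - 1) ≤ prof ν c + 1 := by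
    intro c
    have := slope (c - 1)
    rwa [sub_add_cancel] at this
  refine prof_eq_of_mem_iff _
    (fun c => if IsVar i c then prof ν (c - 1) + prof ν (c + 1) - prof ν c else prof ν c)
    (fun c => ?_) (fun c => ?_) (fun x => ?_) c
  · have a1 := prof_nonneg ν c
    have a2 := prof_nonneg ν (c + 1)
    have a4 := slope c
    have a5 := slope' c
    split_ifs <;> omega
  · have a1 := neg_le_prof ν c
    have a2 := neg_le_prof ν (c - 1)
    have a3 := neg_le_prof ν (c + 1)
    have a4 := slope c
    have a5 := slope' c
    split_ifs <;> omega
  · obtain ⟨r, k⟩ := x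
    rw [mem_reflect]
    split_ifs with h
    · have a0 := prof_nonneg ν ((k : ℤ) - r + 1)
      have a1 := neg_le_prof ν ((k : ℤ) - r)
      have a2 := neg_le_prof ν ((k : ℤ) - r - 1)
      have a4 := slope ((k : ℤ) - r)
      have a5 := slope' ((k : ℤ) - r)
      have e1 : ((r, k) ∈ ν) ↔ (r : ℤ) < prof ν ((k : ℤ) - r) := mem_iff_lt_prof ν (r, k)
      have e2 : ((r + 1, k) ∈ ν) ↔ (r : ℤ) + 1 < prof ν ((k : ℤ) - r - 1) := by
        rw [mem_iff_lt_prof]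
        simp only [content]
        push_cast
        rw [sub_sub]
      have e3 : ((r, k + 1) ∈ ν) ↔ (r : ℤ) < prof ν ((k : ℤ) - r + 1) := by
        rw [mem_iff_lt_prof]
        simp only [content]
        push_cast
        rw [add_sub_right_comm]
      have e4 : (r = 0 ∨ (r - 1, k) ∈ ν) ↔ (r : ℤ) - 1 < prof ν ((k : ℤ) - r + 1) := by
        rcases Nat.eq_zero_or_pos r with hr | hr
        · simp only [hr, true_or, true_iff]
          subst hr
          omega
        · rw [mem_iff_lt_prof]
          simp only [content, hr.ne', false_or]
          rw [Nat.cast_sub (by omega)]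
          push_cast
          rw [show (k : ℤ) - (r - 1) = k - r + 1 by ring]
      have e5 : (k = 0 ∨ (r, k - 1) ∈ ν) ↔ (r : ℤ) < prof ν ((k : ℤ) - r - 1) := by
        rcases Nat.eq_zero_or_pos k with hr | hr
        · simp only [hr, true_or, true_iff]
          subst hr
          omega
        · rw [mem_iff_lt_prof]
          simp only [content, hr.ne', false_or]
          rw [Nat.cast_sub (by omega)]
          push_cast
          rw [show (k : ℤ) - 1 - r = k - r - 1 by ring]
      simp only [e1, e2, e3, e4, e5, content]
      omega
    · exact mem_iff_lt_prof ν _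

theorem reflect_node (i : Fin 2) (m : ℤ) (hi : IsVar i (m + 1)) (U V : YoungDiagram) :
    reflect i (node m U V) = node (m + 1) U V := by
  have h2 := i.2
  unfold IsVar at hi
  apply ext_prof
  intro c
  rw [prof_reflect]
  by_cases h : IsVar i c
  · rw [if_pos h]
    unfold IsVar at h
    simp only [prof_node]
    have e1 : (c - 1 - m + 1) / 2 = (c - (m + 1) + 1) / 2 := by omega
    have e2 : (c + 1 + m) / 2 = (c + (m + 1)) / 2 := by omega
    have e3 : (c + 1 - m + 1) / 2 = (c - m + 1) / 2 := by omega
    have e4 : (c - 1 + m) / 2 = (c + m) / 2 := by omega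
    rw [e1, e2, e3, e4]
    ring
  · rw [if_neg h]
    unfold IsVar at h
    simp only [prof_node]
    have e1 : (c - m + 1) / 2 = (c - (m + 1) + 1) / 2 := by omega
    have e2 : (c + m) / 2 = (c + (m + 1)) / 2 := by omega
    rw [e1, e2]

/-! ### Dominoes and their positions -/

theorem isDomino_pair {x y : ℕ × ℕ} (h : content y = content x - 1) (h' : y.1 = x.1 ∨ y.1 = x.1 + 1) :
    IsDomino {x, y} ∧ pos {x, y} = content x := by
  obtain ⟨r, c⟩ := x
  obtain ⟨r', c'⟩ := y
  simp only [content] at h h'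
  refine ⟨?_, ?_⟩
  · rcases h' with h' | h'
    · refine ⟨r', c', Or.inr ?_⟩
      rw [Finset.pair_comm]
      have : r = r' ∧ c = c' + 1 := by omega
      rw [this.1, this.2]
    · refine ⟨r, c, Or.inl ?_⟩
      have : r' = r + 1 ∧ c' = c := by omega
      rw [this.1, this.2]
  · simp only [pos, content, Finset.image_insert, Finset.image_singleton, Finset.max_insert,
      Finset.max_singleton]
    rw [← WithBot.coe_max, WithBot.unbotD_coe]
    omega

theorem IsDomino.exists_eq {d : Finset (ℕ × ℕ)} (h : IsDomino d) :
    ∃ x y, d = {x, y} ∧ content x = pos d ∧ content y = pos d - 1 ∧ (y.1 = x.1 ∨ y.1 = x.1 + 1) := by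
  obtain ⟨r, c, rfl | rfl⟩ := h
  · have h1 : content (r + 1, c) = content (r, c) - 1 := by simp only [content]; push_cast; ring
    refine ⟨(r, c), (r + 1, c), rfl, ?_, ?_, Or.inr rfl⟩
    · exact (isDomino_pair h1 (Or.inr rfl)).2.symm
    · rw [(isDomino_pair h1 (Or.inr rfl)).2, h1]
  · have h1 : content (r, c) = content (r, c + 1) - 1 := by simp only [content]; push_cast; ring
    rw [Finset.pair_comm]
    refine ⟨(r, c + 1), (r, c), rfl, ?_, ?_, Or.inl rfl⟩
    · exact (isDomino_pair h1 (Or.inl rfl)).2.symm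
    · rw [(isDomino_pair h1 (Or.inl rfl)).2, h1]

theorem IsDomino.content_mem {d : Finset (ℕ × ℕ)} (h : IsDomino d) {x : ℕ × ℕ} (hx : x ∈ d) :
    content x = pos d ∨ content x = pos d - 1 := by
  obtain ⟨y, z, hd, hy, hz, -⟩ := h.exists_eq
  rw [hd] at hx
  simp only [Finset.mem_insert, Finset.mem_singleton] at hx
  rcases hx with rfl | rfl
  · exact Or.inl hy
  · exact Or.inr hz

theorem IsDomino.exists_content_eq {d : Finset (ℕ × ℕ)} (h : IsDomino d) {c : ℤ}
    (hc : pos d = c ∨ pos d = c + 1) : ∃ x ∈ d, content x = c := by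
  obtain ⟨y, z, hd, hy, hz, -⟩ := h.exists_eq
  rcases hc with hc | hc
  · exact ⟨y, hd ▸ Finset.mem_insert_self _ _, by omega⟩
  · exact ⟨z, hd ▸ by simp, by omega⟩

theorem IsDomino.eq_of_content_eq {d : Finset (ℕ × ℕ)} (h : IsDomino d) {x y : ℕ × ℕ} (hx : x ∈ d)
    (hy : y ∈ d) (hxy : content x = content y) : x = y := by
  obtain ⟨u, v, hd, hu, hv, -⟩ := h.exists_eq
  rw [hd] at hx hy
  simp only [Finset.mem_insert, Finset.mem_singleton] at hx hy
  rcases hx with rfl | rfl <;> rcases hy with rfl | rfl <;> first | rfl | omega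

theorem IsDomino.card_diag {d : Finset (ℕ × ℕ)} (h : IsDomino d) (c : ℤ) :
    (d.filter fun x => content x = c).card = if pos d = c ∨ pos d = c + 1 then 1 else 0 := by
  split_ifs with hc
  · obtain ⟨x, hx, hxc⟩ := h.exists_content_eq hc
    rw [Finset.card_eq_one]
    refine ⟨x, ?_⟩
    ext y
    simp only [Finset.mem_filter, Finset.mem_singleton]
    constructor
    · rintro ⟨hy, hyc⟩
      exact h.eq_of_content_eq hy hx (by omega)
    · rintro rfl
      exact ⟨hx, hxc⟩
  · rw [Finset.card_eq_zero, Finset.filter_eq_empty_iff]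
    intro x hx hxc
    have := h.content_mem hx
    omega

theorem prof_eq_card (ν : YoungDiagram) (c : ℤ) :
    prof ν c = max 0 (-c) + ((ν.cells.filter fun x => content x = c).card : ℤ) := by
  have h1 := prof_nonneg ν c
  have h2 := neg_le_prof ν c
  have : (ν.cells.filter fun x => content x = c).card = (Finset.Ico (max 0 (-c)) (prof ν c)).card := by
    symm
    refine Finset.card_nbij (sq c) (fun r hr => ?_) (fun r hr r' hr' h => ?_) (fun x hx => ?_)
    · rw [Finset.mem_coe, Finset.mem_Ico] at hr
      rw [Finset.mem_coe, Finset.mem_filter, YoungDiagram.mem_cells, sq_mem_iff ν (by omega) (by omega),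
        content_sq (by omega) (by omega)]
      exact ⟨hr.2, rfl⟩
    · rw [Finset.mem_coe, Finset.mem_Ico] at hr hr'
      rw [← sq_fst (c := c) (r := r) (by omega), h, sq_fst (by omega)]
    · rw [Finset.mem_coe, Finset.mem_filter, mem_cells_iff_lt_prof] at hx
      obtain ⟨hx1, rfl⟩ := hx
      refine ⟨x.1, ?_, sq_content_fst x⟩
      rw [Finset.mem_coe, Finset.mem_Ico]
      refine ⟨?_, hx1⟩
      simp only [content]
      omega
  rw [this, Int.card_Ico]
  omega

theorem mem_hull (s : Finset (ℕ × ℕ)) (x : ℕ × ℕ) : x ∈ hull s ↔ ∃ y ∈ s, x ≤ y := by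
  rw [← YoungDiagram.mem_cells]
  simp [hull]

theorem hull_cells {s : Finset (ℕ × ℕ)} (hs : IsLowerSet (s : Set (ℕ × ℕ))) : (hull s).cells = s := by
  ext x
  rw [YoungDiagram.mem_cells, mem_hull]
  exact ⟨fun ⟨y, hy, hxy⟩ => hs hxy hy, fun h => ⟨x, h, le_rfl⟩⟩

theorem hull_self (ν : YoungDiagram) : hull ν.cells = ν := by
  have := hull_cells ν.isLowerSet
  ext x
  rw [this]

/-- A set of squares is a lower set when it is closed under going one step up or to the left. -/
theorem isLowerSet_of_step {s : Set (ℕ × ℕ)} (h1 : ∀ r c, (r + 1, c) ∈ s → (r, c) ∈ s)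
    (h2 : ∀ r c, (r, c + 1) ∈ s → (r, c) ∈ s) : IsLowerSet s := by
  have k1 : ∀ n r c, (r + n, c) ∈ s → (r, c) ∈ s := by
    intro n
    induction n with
    | zero => exact fun r c h => h
    | succ n ih => exact fun r c h => ih r c (h1 _ _ h)
  have k2 : ∀ n r c, (r, c + n) ∈ s → (r, c) ∈ s := by
    intro n
    induction n with
    | zero => exact fun r c h => h
    | succ n ih => exact fun r c h => ih r c (h2 _ _ h)
  rintro ⟨r, c⟩ ⟨r', c'⟩ hle h
  obtain ⟨hr, hc⟩ : r' ≤ r ∧ c' ≤ c := hle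
  obtain ⟨a, rfl⟩ := Nat.exists_eq_add_of_le hr
  obtain ⟨b, rfl⟩ := Nat.exists_eq_add_of_le hc
  exact k1 a _ _ (k2 b _ _ h)

theorem SkewShape.mem_cells (χ : SkewShape) (x : ℕ × ℕ) :
    x ∈ χ.cells ↔ x ∈ χ.outer ∧ x ∉ χ.inner := by
  simp [SkewShape.cells]

theorem SkewShape.between {χ : SkewShape} {x y z : ℕ × ℕ} (hx : x ∈ χ.cells) (hy : y ∈ χ.cells)
    (hxz : x ≤ z) (hzy : z ≤ y) : z ∈ χ.cells := by
  rw [SkewShape.mem_cells] at hx hy ⊢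
  exact ⟨χ.outer.isLowerSet hzy hy.1, fun h => hx.2 (χ.inner.isLowerSet hxz h)⟩

/-! ### The standardisation of a semistandard domino tableau -/

namespace IsSSDT

variable {D : DominoTableau}

theorem mem_cells (h : IsSSDT D.shape D) {d} (hd : d ∈ D.dominoes) {x : ℕ × ℕ} (hx : x ∈ d.1) :
    x ∈ D.shape.cells := by
  rw [← h.cover]
  exact Finset.mem_biUnion.2 ⟨d, hd, hx⟩

theorem exists_mem (h : IsSSDT D.shape D) {x : ℕ × ℕ} (hx : x ∈ D.shape.cells) :
    ∃ d ∈ D.dominoes, x ∈ d.1 := by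
  rw [← h.cover] at hx
  exact Finset.mem_biUnion.1 hx

theorem eq_of_mem (h : IsSSDT D.shape D) {d e} (hd : d ∈ D.dominoes) (he : e ∈ D.dominoes)
    {x : ℕ × ℕ} (hx : x ∈ d.1) (hx' : x ∈ e.1) : d = e := by
  by_contra hne
  exact Finset.disjoint_left.1 (h.disjoint d hd e he hne) hx hx'

/-- Dominoes with equal entries have different positions. -/
theorem eq_of_pos_eq (h : IsSSDT D.shape D) {d e} (hd : d ∈ D.dominoes) (he : e ∈ D.dominoes)
    (h2 : d.2 = e.2) (hp : pos d.1 = pos e.1) : d = e := by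
  obtain ⟨x, hx, hxp⟩ := (h.isDomino d hd).exists_content_eq (Or.inl rfl)
  obtain ⟨y, hy, hyp⟩ := (h.isDomino e he).exists_content_eq (Or.inl rfl)
  wlog hxy : x.1 ≤ y.1 generalizing d e x y
  · exact (this he hd h2.symm hp.symm y hy hyp x hx hxp (le_of_not_ge hxy)).symm
  have hc : content x = content y := by omega
  rcases hxy.eq_or_lt with h1 | h1
  · exact h.eq_of_mem hd he hx (eq_of_content_eq hc h1 ▸ hy)
  · exfalso
    have h3 : x.2 < y.2 := by simp only [content] at hc; omega
    obtain ⟨g, hg, hz⟩ := h.exists_mem (SkewShape.between (z := (x.1, y.2)) (h.mem_cells hd hx)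
      (h.mem_cells he hy) ⟨le_rfl, h3.le⟩ ⟨h1.le, le_rfl⟩)
    have a1 := h.row_weak d hd g hg _ _ _ hx hz h3
    by_cases hge : g = e
    · subst hge
      have := (h.isDomino g hg).content_mem hz
      simp only [content] at this hyp
      omega
    · have := h.col_strict g hg e he hge _ _ _ hz hy h1
      omega

theorem stdBefore_or (h : IsSSDT D.shape D) {d e} (hd : d ∈ D.dominoes) (he : e ∈ D.dominoes)
    (hne : d ≠ e) : StdBefore d e ∨ StdBefore e d := by
  unfold StdBefore
  by_cases h2 : d.2 = e.2
  · have : pos d.1 ≠ pos e.1 := fun hp => hne (h.eq_of_pos_eq hd he h2 hp)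
    omega
  · omega

theorem stdBefore_of_left (h : IsSSDT D.shape D) {d e} (hd : d ∈ D.dominoes) (he : e ∈ D.dominoes)
    (hne : d ≠ e) {i j₁ j₂ : ℕ} (h1 : (i, j₁) ∈ d.1) (h2 : (i, j₂) ∈ e.1) (hj : j₁ < j₂) :
    StdBefore d e := by
  have hw := h.row_weak d hd e he _ _ _ h1 h2 hj
  rcases hw.lt_or_eq with hw | hw
  · exact Or.inl hw
  · refine Or.inr ⟨hw, ?_⟩
    have a1 := (h.isDomino d hd).content_mem h1
    have a2 := (h.isDomino e he).content_mem h2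
    have a3 : pos d.1 ≠ pos e.1 := fun hp => hne (h.eq_of_pos_eq hd he hw hp)
    simp only [content] at a1 a2
    omega

theorem stdBefore_of_above (h : IsSSDT D.shape D) {d e} (hd : d ∈ D.dominoes) (he : e ∈ D.dominoes)
    (hne : d ≠ e) {i₁ i₂ j : ℕ} (h1 : (i₁, j) ∈ d.1) (h2 : (i₂, j) ∈ e.1) (hi : i₁ < i₂) :
    StdBefore d e :=
  Or.inl (h.col_strict d hd e he hne _ _ _ h1 h2 hi)

end IsSSDT

theorem StdBefore.trans {a b c : Finset (ℕ × ℕ) × ℕ} (h1 : StdBefore a b) (h2 : StdBefore b c) :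
    StdBefore a c := by
  unfold StdBefore at *
  omega

theorem StdBefore.irrefl (a : Finset (ℕ × ℕ) × ℕ) : ¬ StdBefore a a := by
  unfold StdBefore
  omega

theorem StdBefore.asymm {a b : Finset (ℕ × ℕ) × ℕ} (h1 : StdBefore a b) : ¬ StdBefore b a :=
  fun h2 => StdBefore.irrefl a (h1.trans h2)

/-- A set of dominoes of `D` that form an initial part of its standardisation. -/
def IsInitial (D : DominoTableau) (A : Finset (Finset (ℕ × ℕ) × ℕ)) : Prop :=
  A ⊆ D.dominoes ∧ ∀ d ∈ A, ∀ e ∈ D.dominoes, StdBefore e d → e ∈ A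

/-- The partition formed by the inner shape of `D` and a set of dominoes. -/
def fill (D : DominoTableau) (A : Finset (Finset (ℕ × ℕ) × ℕ)) : YoungDiagram :=
  hull (D.shape.inner.cells ∪ A.biUnion Prod.fst)

open Classical in
/-- The dominoes that precede `d` in the standardisation of `D`. -/
noncomputable def before (D : DominoTableau) (d : Finset (ℕ × ℕ) × ℕ) :
    Finset (Finset (ℕ × ℕ) × ℕ) :=
  D.dominoes.filter fun e => StdBefore e d

theorem mem_before {D : DominoTableau} {d e : Finset (ℕ × ℕ) × ℕ} :
    e ∈ before D d ↔ e ∈ D.dominoes ∧ StdBefore e d := by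
  simp [before]

theorem stdShape_eq_fill (D : DominoTableau) (d : Finset (ℕ × ℕ) × ℕ) :
    stdShape D d = fill D (before D d) := rfl

theorem dominoBelow_eq_fill (D : DominoTableau) (k : ℕ) :
    dominoBelow D k = fill D (D.dominoes.filter fun d => d.2 < k) := rfl

theorem isInitial_before (D : DominoTableau) (d : Finset (ℕ × ℕ) × ℕ) : IsInitial D (before D d) :=
  ⟨fun _ he => (mem_before.1 he).1,
    fun _ he _ hf hfe => mem_before.2 ⟨hf, hfe.trans (mem_before.1 he).2⟩⟩

theorem isInitial_insert_before {D : DominoTableau} {d : Finset (ℕ × ℕ) × ℕ} (hd : d ∈ D.dominoes) :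
    IsInitial D (insert d (before D d)) := by
  refine ⟨Finset.insert_subset hd (isInitial_before D d).1, fun e he f hf hfe => ?_⟩
  rw [Finset.mem_insert] at he
  refine Finset.mem_insert_of_mem (mem_before.2 ⟨hf, ?_⟩)
  rcases he with rfl | he
  · exact hfe
  · exact hfe.trans (mem_before.1 he).2

theorem isInitial_below (D : DominoTableau) (k : ℕ) :
    IsInitial D (D.dominoes.filter fun d => d.2 < k) := by
  refine ⟨Finset.filter_subset _ _, fun d hd e he hed => ?_⟩
  rw [Finset.mem_filter] at hd ⊢
  refine ⟨he, ?_⟩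
  unfold StdBefore at hed
  omega

theorem isInitial_self (D : DominoTableau) : IsInitial D D.dominoes :=
  ⟨subset_rfl, fun _ _ _ he _ => he⟩

namespace IsSSDT

variable {D : DominoTableau}

theorem isLowerSet_initial (h : IsSSDT D.shape D) {A} (hA : IsInitial D A) :
    IsLowerSet ((D.shape.inner.cells ∪ A.biUnion Prod.fst : Finset (ℕ × ℕ)) : Set (ℕ × ℕ)) := by
  have key : ∀ x y : ℕ × ℕ, x ≤ y → x ∉ D.shape.inner → ∀ d ∈ A, y ∈ d.1 →
      ∃ e ∈ D.dominoes, x ∈ e.1 := by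
    intro x y hxy hx d hd hy
    refine h.exists_mem ((SkewShape.mem_cells _ _).2 ⟨?_, hx⟩)
    exact D.shape.outer.isLowerSet hxy
      ((SkewShape.mem_cells _ _).1 (h.mem_cells (hA.1 hd) hy)).1
  refine isLowerSet_of_step (fun r c hx => ?_) (fun r c hx => ?_) <;>
    simp only [Finset.coe_union, Set.mem_union, Finset.mem_coe, Finset.mem_biUnion,
      YoungDiagram.mem_cells] at hx ⊢
  · rw [or_iff_not_imp_left]
    intro hi
    rcases hx with hx | ⟨d, hd, hx⟩
    · exact absurd (D.shape.inner.up_left_mem (Nat.le_succ r) le_rfl hx) hi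
    · obtain ⟨e, he, hxe⟩ := key (r, c) (r + 1, c) ⟨Nat.le_succ r, le_rfl⟩ hi d hd hx
      refine ⟨e, ?_, hxe⟩
      by_cases hed : e = d
      · exact hed ▸ hd
      · exact hA.2 d hd e he (h.stdBefore_of_above he (hA.1 hd) hed hxe hx (Nat.lt_succ_self r))
  · rw [or_iff_not_imp_left]
    intro hi
    rcases hx with hx | ⟨d, hd, hx⟩
    · exact absurd (D.shape.inner.up_left_mem le_rfl (Nat.le_succ c) hx) hi
    · obtain ⟨e, he, hxe⟩ := key (r, c) (r, c + 1) ⟨le_rfl, Nat.le_succ c⟩ hi d hd hx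
      refine ⟨e, ?_, hxe⟩
      by_cases hed : e = d
      · exact hed ▸ hd
      · exact hA.2 d hd e he (h.stdBefore_of_left he (hA.1 hd) hed hxe hx (Nat.lt_succ_self c))

theorem cells_fill (h : IsSSDT D.shape D) {A} (hA : IsInitial D A) :
    (fill D A).cells = D.shape.inner.cells ∪ A.biUnion Prod.fst :=
  hull_cells (h.isLowerSet_initial hA)

theorem mem_fill (h : IsSSDT D.shape D) {A} (hA : IsInitial D A) (x : ℕ × ℕ) :
    x ∈ fill D A ↔ x ∈ D.shape.inner ∨ ∃ d ∈ A, x ∈ d.1 := by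
  rw [← YoungDiagram.mem_cells, h.cells_fill hA]
  simp

theorem not_mem_inner (h : IsSSDT D.shape D) {d} (hd : d ∈ D.dominoes) {x : ℕ × ℕ} (hx : x ∈ d.1) :
    x ∉ D.shape.inner :=
  ((SkewShape.mem_cells _ _).1 (h.mem_cells hd hx)).2

theorem fill_empty (D : DominoTableau) : fill D ∅ = D.shape.inner := by
  simp [fill, hull_self]

theorem fill_self (h : IsSSDT D.shape D) : fill D D.dominoes = D.shape.outer := by
  ext x
  rw [YoungDiagram.mem_cells, h.mem_fill (isInitial_self D), YoungDiagram.mem_cells]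
  constructor
  · rintro (hx | ⟨d, hd, hx⟩)
    · exact h.inner_le hx
    · exact ((SkewShape.mem_cells _ _).1 (h.mem_cells hd hx)).1
  · intro hx
    by_cases hi : x ∈ D.shape.inner
    · exact Or.inl hi
    · exact Or.inr (h.exists_mem ((SkewShape.mem_cells _ _).2 ⟨hx, hi⟩))

theorem prof_fill (h : IsSSDT D.shape D) {A} (hA : IsInitial D A) (c : ℤ) :
    prof (fill D A) c = prof D.shape.inner c +
      ((A.filter fun d => pos d.1 = c ∨ pos d.1 = c + 1).card : ℤ) := by
  rw [prof_eq_card, prof_eq_card, h.cells_fill hA, Finset.filter_union, Finset.card_union_of_disjoint,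
    Finset.filter_biUnion, Finset.card_biUnion]
  · have : ∀ d ∈ A, (d.1.filter fun x => content x = c).card =
        if pos d.1 = c ∨ pos d.1 = c + 1 then 1 else 0 :=
      fun d hd => (h.isDomino d (hA.1 hd)).card_diag c
    rw [Finset.sum_congr rfl this, ← Finset.card_filter]
    push_cast
    ring
  · intro d hd e he hne
    exact Finset.disjoint_filter_filter (h.disjoint d (hA.1 hd) e (hA.1 he) hne)
  · refine Finset.disjoint_filter_filter ?_
    rw [Finset.disjoint_left]
    intro x hx hx'
    obtain ⟨d, hd, hxd⟩ := Finset.mem_biUnion.1 hx'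
    exact h.not_mem_inner (hA.1 hd) hxd hx

theorem stdShapeAfter_eq_fill (h : IsSSDT D.shape D) (d : Finset (ℕ × ℕ) × ℕ) :
    stdShapeAfter D d = fill D (insert d (before D d)) := by
  have : (stdShape D d).cells ∪ d.1 =
      D.shape.inner.cells ∪ (insert d (before D d)).biUnion Prod.fst := by
    rw [stdShape_eq_fill, h.cells_fill (isInitial_before D d), Finset.biUnion_insert,
      Finset.union_assoc, Finset.union_comm d.1]
  unfold stdShapeAfter
  rw [this]
  rfl

theorem prof_stdShapeAfter (h : IsSSDT D.shape D) {d} (hd : d ∈ D.dominoes) (c : ℤ) :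
    prof (stdShapeAfter D d) c = prof (stdShape D d) c +
      if pos d.1 = c ∨ pos d.1 = c + 1 then 1 else 0 := by
  rw [h.stdShapeAfter_eq_fill d, stdShape_eq_fill, h.prof_fill (isInitial_before D d),
    h.prof_fill (isInitial_insert_before hd), Finset.filter_insert]
  split_ifs
  · rw [Finset.card_insert_of_notMem]
    · push_cast
      ring
    · intro hm
      exact StdBefore.irrefl d (mem_before.1 (Finset.mem_filter.1 hm).1).2
  · simp

/-- Dominoes of an initial part have been added when that part is complete. -/
theorem prof_stdShape_lt (h : IsSSDT D.shape D) {A} (hA : IsInitial D A) {d} (hd : d ∈ A) (c : ℤ) :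
    prof (stdShape D d) c + (if pos d.1 = c ∨ pos d.1 = c + 1 then 1 else 0) ≤ prof (fill D A) c := by
  rw [← h.prof_stdShapeAfter (hA.1 hd), h.stdShapeAfter_eq_fill d,
    h.prof_fill (isInitial_insert_before (hA.1 hd)), h.prof_fill hA]
  have : insert d (before D d) ⊆ A :=
    Finset.insert_subset hd fun e he => hA.2 d hd e (mem_before.1 he).1 (mem_before.1 he).2
  have := Finset.card_le_card (Finset.filter_subset_filter
    (fun d : Finset (ℕ × ℕ) × ℕ => pos d.1 = c ∨ pos d.1 = c + 1) this)
  omega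

theorem le_prof_stdShape (h : IsSSDT D.shape D) {A} (hA : IsInitial D A) {d} (hd : d ∈ D.dominoes)
    (hdA : d ∉ A) (c : ℤ) : prof (fill D A) c ≤ prof (stdShape D d) c := by
  rw [stdShape_eq_fill, h.prof_fill (isInitial_before D d), h.prof_fill hA]
  have : A ⊆ before D d := by
    intro e he
    refine mem_before.2 ⟨hA.1 he, ?_⟩
    have hne : e ≠ d := fun hed => hdA (hed ▸ he)
    refine (h.stdBefore_or (hA.1 he) hd hne).resolve_right fun hde => hdA (hA.2 e he d hd hde)
  have := Finset.card_le_card (Finset.filter_subset_filter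
    (fun d : Finset (ℕ × ℕ) × ℕ => pos d.1 = c ∨ pos d.1 = c + 1) this)
  omega

/-- A domino occupies the first free squares of the two diagonals that it meets. -/
theorem row_eq_prof (h : IsSSDT D.shape D) {d} (hd : d ∈ D.dominoes) {x : ℕ × ℕ} (hx : x ∈ d.1) :
    (x.1 : ℤ) = prof (stdShape D d) (content x) := by
  have h1 : x ∉ stdShape D d := by
    rw [stdShape_eq_fill, h.mem_fill (isInitial_before D d)]
    rintro (h' | ⟨e, he, hxe⟩)
    · exact h.not_mem_inner hd hx h'
    · obtain rfl := h.eq_of_mem (mem_before.1 he).1 hd hxe hx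
      exact StdBefore.irrefl _ (mem_before.1 he).2
  have h2 : x ∈ stdShapeAfter D d := by
    rw [h.stdShapeAfter_eq_fill d, h.mem_fill (isInitial_insert_before hd)]
    exact Or.inr ⟨d, Finset.mem_insert_self _ _, hx⟩
  rw [mem_iff_lt_prof] at h1 h2
  rw [h.prof_stdShapeAfter hd] at h2
  split_ifs at h2 <;> omega

theorem mem_domino_iff (h : IsSSDT D.shape D) {d} (hd : d ∈ D.dominoes) (x : ℕ × ℕ) :
    x ∈ d.1 ↔ (content x = pos d.1 ∨ content x = pos d.1 - 1) ∧
      (x.1 : ℤ) = prof (stdShape D d) (content x) := by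
  constructor
  · exact fun hx => ⟨(h.isDomino d hd).content_mem hx, h.row_eq_prof hd hx⟩
  · rintro ⟨hc, hr⟩
    obtain ⟨y, hy, hyc⟩ := (h.isDomino d hd).exists_content_eq (c := content x) (by omega)
    have hr' := h.row_eq_prof hd hy
    rw [hyc] at hr'
    rwa [eq_of_content_eq hyc.symm (by omega : x.1 = y.1)]

end IsSSDT

/-! ### Moving dominoes -/

/-- The position of a domino after it has been moved for `s_i`. -/
def otherPos (i : Fin 2) (p : ℤ) : ℤ := if IsVar i p then p - 1 else p + 1

/-- The diagonal on which a domino in position `p` has the square that does not move for `s_i`. -/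
def fixedDiag (i : Fin 2) (p : ℤ) : ℤ := if IsVar i p then p - 1 else p

/-- The diagonal on which a domino in position `p` has the square that moves for `s_i`. -/
def varDiag (i : Fin 2) (p : ℤ) : ℤ := if IsVar i p then p else p - 1

/-- The row in which a domino, whether moved or not, has its variable square on the diagonal `a`, in
terms of the profile `ρ` before the domino is added. It depends only on the two neighbouring
diagonals, on which squares do not move. -/
def midRow (ρ : ℤ → ℤ) (a : ℤ) : ℤ := (ρ (a - 1) + ρ (a + 1)) / 2

/-- The squares of a domino that is added in position `p` when the profile is `ρ`. -/
def InPlace (i : Fin 2) (ρ : ℤ → ℤ) (p : ℤ) (x : ℕ × ℕ) : Prop :=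
  (content x = fixedDiag i p ∧ (x.1 : ℤ) = ρ (fixedDiag i p)) ∨
    (content x = varDiag i p ∧ (x.1 : ℤ) = midRow ρ (varDiag i p))

theorem otherPos_otherPos (i : Fin 2) (p : ℤ) : otherPos i (otherPos i p) = p := by
  by_cases h : IsVar i p
  · have h' : ¬ IsVar i (p - 1) := by rw [isVar_pred_iff]; simpa using h
    simp [otherPos, h, h']
  · have h' : IsVar i (p + 1) := by rw [isVar_succ_iff]; exact h
    simp [otherPos, h, h']

theorem fixedDiag_otherPos (i : Fin 2) (p : ℤ) : fixedDiag i (otherPos i p) = fixedDiag i p := by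
  by_cases h : IsVar i p
  · have h' : ¬ IsVar i (p - 1) := by rw [isVar_pred_iff]; simpa using h
    simp [otherPos, fixedDiag, h, h']
  · have h' : IsVar i (p + 1) := by rw [isVar_succ_iff]; exact h
    simp [otherPos, fixedDiag, h, h']

theorem not_isVar_fixedDiag (i : Fin 2) (p : ℤ) : ¬ IsVar i (fixedDiag i p) := by
  unfold fixedDiag
  split_ifs with h
  · rw [isVar_pred_iff]
    simpa using h
  · exact h

theorem isVar_varDiag (i : Fin 2) (p : ℤ) : IsVar i (varDiag i p) := by
  unfold varDiag
  split_ifs with h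
  · exact h
  · rw [isVar_pred_iff]
    exact h

theorem pos_cases (i : Fin 2) (p : ℤ) :
    (p = fixedDiag i p ∧ varDiag i p = fixedDiag i p - 1 ∧ otherPos i p = fixedDiag i p + 1 ∧
      varDiag i (otherPos i p) = fixedDiag i p + 1) ∨
    (p = fixedDiag i p + 1 ∧ varDiag i p = fixedDiag i p + 1 ∧ otherPos i p = fixedDiag i p ∧
      varDiag i (otherPos i p) = fixedDiag i p - 1) := by
  by_cases h : IsVar i p
  · have e1 : otherPos i p = p - 1 := if_pos h
    have e2 : fixedDiag i p = p - 1 := if_pos h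
    have e3 : varDiag i p = p := if_pos h
    have e4 : varDiag i (p - 1) = p - 1 - 1 :=
      if_neg (by rw [isVar_pred_iff]; exact not_not.2 h)
    rw [e1, e2, e3, e4]
    omega
  · have e1 : otherPos i p = p + 1 := if_neg h
    have e2 : fixedDiag i p = p := if_neg h
    have e3 : varDiag i p = p - 1 := if_neg h
    have e4 : varDiag i (p + 1) = p + 1 := if_pos (by rw [isVar_succ_iff]; exact h)
    rw [e1, e2, e3, e4]
    omega

theorem fixedDiag_ne_varDiag (i : Fin 2) (p q : ℤ) : fixedDiag i p ≠ varDiag i q :=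
  fun h => not_isVar_fixedDiag i p (h ▸ isVar_varDiag i q)

/-- On a diagonal where squares move, `s_i` exchanges the smaller and the larger half of the sum of the
neighbouring profile values. -/
theorem midRow_cases (ν : YoungDiagram) (a : ℤ) :
    (prof ν a = midRow (prof ν) a ∧
      prof ν (a - 1) + prof ν (a + 1) - prof ν a = (prof ν (a - 1) + prof ν (a + 1) + 1) / 2) ∨
    (prof ν a = (prof ν (a - 1) + prof ν (a + 1) + 1) / 2 ∧
      prof ν (a - 1) + prof ν (a + 1) - prof ν a = midRow (prof ν) a) := by
  have a1 := prof_succ_le ν a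
  have a2 := prof_le_succ ν a
  have a3 := prof_succ_le ν (a - 1)
  have a4 := prof_le_succ ν (a - 1)
  rw [sub_add_cancel] at a3 a4
  unfold midRow
  omega

namespace IsSSDT

variable {D : DominoTableau}

theorem slopes (h : IsSSDT D.shape D) {d} (hd : d ∈ D.dominoes) (c : ℤ) :
    prof (stdShape D d) (c + 1) ≤ prof (stdShape D d) c ∧
    prof (stdShape D d) c ≤ prof (stdShape D d) (c + 1) + 1 ∧
    prof (stdShape D d) (c + 1) + (if pos d.1 = c + 1 ∨ pos d.1 = c + 1 + 1 then 1 else 0) ≤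
      prof (stdShape D d) c + (if pos d.1 = c ∨ pos d.1 = c + 1 then 1 else 0) ∧
    prof (stdShape D d) c + (if pos d.1 = c ∨ pos d.1 = c + 1 then 1 else 0) ≤
      prof (stdShape D d) (c + 1) + (if pos d.1 = c + 1 ∨ pos d.1 = c + 1 + 1 then 1 else 0) + 1 := by
  have a1 := prof_succ_le (stdShape D d) c
  have a2 := prof_le_succ (stdShape D d) c
  have a3 := prof_succ_le (stdShapeAfter D d) c
  have a4 := prof_le_succ (stdShapeAfter D d) c
  rw [h.prof_stdShapeAfter hd, h.prof_stdShapeAfter hd] at a3 a4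
  exact ⟨a1, a2, a3, a4⟩

/-- A domino in position `p` moves a bead from `p - 2` to `p`. -/
theorem prof_stdShape_pos (h : IsSSDT D.shape D) {d} (hd : d ∈ D.dominoes) :
    prof (stdShape D d) (pos d.1) = prof (stdShape D d) (pos d.1 + 1) ∧
    prof (stdShape D d) (pos d.1 - 2) = prof (stdShape D d) (pos d.1 - 1) + 1 := by
  have a1 := h.slopes hd (pos d.1)
  have a2 := h.slopes hd (pos d.1 - 2)
  rw [show pos d.1 - 2 + 1 = pos d.1 - 1 by ring] at a2
  rw [if_neg (by omega), if_pos (by omega)] at a1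
  rw [if_pos (by omega), if_neg (by omega)] at a2
  omega

theorem mem_iff_inPlace (h : IsSSDT D.shape D) (i : Fin 2) {d} (hd : d ∈ D.dominoes) (x : ℕ × ℕ) :
    x ∈ d.1 ↔ InPlace i (prof (stdShape D d)) (pos d.1) x := by
  rw [h.mem_domino_iff hd]
  obtain ⟨b1, b2⟩ := h.prof_stdShape_pos hd
  have a1 := h.slopes hd (pos d.1 - 1)
  have a2 := h.slopes hd (pos d.1)
  rw [sub_add_cancel] at a1
  unfold InPlace midRow
  rcases pos_cases i (pos d.1) with ⟨h1, h2, -, -⟩ | ⟨h1, h2, -, -⟩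
  · rw [h2, ← h1, show pos d.1 - 1 - 1 = pos d.1 - 2 by ring, sub_add_cancel]
    constructor
    · rintro ⟨hc | hc, hr⟩
      · exact Or.inl ⟨hc, hc ▸ hr⟩
      · rw [hc] at hr
        exact Or.inr ⟨hc, by omega⟩
    · rintro (⟨hc, hr⟩ | ⟨hc, hr⟩)
      · exact ⟨Or.inl hc, hc ▸ hr⟩
      · refine ⟨Or.inr hc, ?_⟩
        rw [hc]
        omega
  · have h3 : fixedDiag i (pos d.1) = pos d.1 - 1 := by omega
    rw [h2, h3, sub_add_cancel]
    constructor
    · rintro ⟨hc | hc, hr⟩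
      · rw [hc] at hr
        exact Or.inr ⟨hc, by omega⟩
      · exact Or.inl ⟨hc, hc ▸ hr⟩
    · rintro (⟨hc, hr⟩ | ⟨hc, hr⟩)
      · exact ⟨Or.inr hc, hc ▸ hr⟩
      · refine ⟨Or.inl hc, ?_⟩
        rw [hc]
        omega

/-- The effect of adding a domino, after application of `s_i`. -/
theorem prof_reflect_stdShapeAfter (h : IsSSDT D.shape D) (i : Fin 2) {d} (hd : d ∈ D.dominoes)
    (c : ℤ) : prof (reflect i (stdShapeAfter D d)) c = prof (reflect i (stdShape D d)) c +
      if otherPos i (pos d.1) = c ∨ otherPos i (pos d.1) = c + 1 then 1 else 0 := by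
  rw [prof_reflect, prof_reflect, h.prof_stdShapeAfter hd, h.prof_stdShapeAfter hd,
    h.prof_stdShapeAfter hd]
  by_cases hc : IsVar i c
  · rw [if_pos hc, if_pos hc]
    have hp : c ≠ fixedDiag i (pos d.1) := fun he => not_isVar_fixedDiag i _ (he ▸ hc)
    have hp' : c + 2 ≠ fixedDiag i (pos d.1) := fun he =>
      not_isVar_fixedDiag i _ (he ▸ (isVar_add_two_iff i c).2 hc)
    have hp'' : c - 2 ≠ fixedDiag i (pos d.1) := fun he =>
      not_isVar_fixedDiag i _ (he ▸ (isVar_sub_two_iff i c).2 hc)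
    rcases pos_cases i (pos d.1) with ⟨h1, -, h3, -⟩ | ⟨h1, -, h3, -⟩ <;> rw [h3] <;> split_ifs <;>
      omega
  · rw [if_neg hc, if_neg hc]
    have hp : c + 1 ≠ fixedDiag i (pos d.1) := fun he =>
      not_isVar_fixedDiag i _ (he ▸ (isVar_succ_iff i c).2 hc)
    have hp' : c - 1 ≠ fixedDiag i (pos d.1) := fun he =>
      not_isVar_fixedDiag i _ (he ▸ (isVar_pred_iff i c).2 hc)
    rcases pos_cases i (pos d.1) with ⟨h1, -, h3, -⟩ | ⟨h1, -, h3, -⟩ <;> rw [h3] <;> split_ifs <;>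
      omega

theorem prof_reflect_stdShape_varDiag (h : IsSSDT D.shape D) (i : Fin 2) {d} (hd : d ∈ D.dominoes) :
    prof (reflect i (stdShape D d)) (varDiag i (otherPos i (pos d.1))) =
      midRow (prof (stdShape D d)) (varDiag i (otherPos i (pos d.1))) := by
  rw [prof_reflect, if_pos (isVar_varDiag _ _)]
  unfold midRow
  rcases pos_cases i (pos d.1) with ⟨h1, -, -, h4⟩ | ⟨h1, -, -, h4⟩
  · rw [h4, ← h1, add_sub_cancel_right]
    have a1 := h.slopes hd (pos d.1)
    have a2 := h.slopes hd (pos d.1 + 1)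
    rw [if_neg (by omega), if_pos (by omega)] at a1
    rw [if_neg (by omega), if_neg (by omega)] at a2
    omega
  · have h5 : fixedDiag i (pos d.1) - 1 = pos d.1 - 2 := by omega
    rw [h4, h5]
    have a1 := h.slopes hd (pos d.1 - 2)
    have a2 := h.slopes hd (pos d.1 - 2 - 1)
    rw [if_pos (by omega), if_neg (by omega)] at a1
    rw [sub_add_cancel, if_neg (by omega), if_neg (by omega)] at a2
    omega

theorem mem_moved_iff (h : IsSSDT D.shape D) (i : Fin 2) {d} (hd : d ∈ D.dominoes) (x : ℕ × ℕ) :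
    x ∈ moved i D d ↔ InPlace i (prof (stdShape D d)) (otherPos i (pos d.1)) x := by
  have h1 := h.prof_reflect_stdShape_varDiag i hd
  have h2 : prof (reflect i (stdShape D d)) (fixedDiag i (pos d.1)) =
      prof (stdShape D d) (fixedDiag i (pos d.1)) := by
    rw [prof_reflect, if_neg (not_isVar_fixedDiag _ _)]
  rw [moved, Finset.mem_sdiff, mem_cells_iff_lt_prof, mem_cells_iff_lt_prof,
    h.prof_reflect_stdShapeAfter i hd]
  unfold InPlace
  rw [← h1, fixedDiag_otherPos, ← h2]
  have h3 : (otherPos i (pos d.1) = content x ∨ otherPos i (pos d.1) = content x + 1) ↔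
      (content x = fixedDiag i (pos d.1) ∨ content x = varDiag i (otherPos i (pos d.1))) := by
    rcases pos_cases i (pos d.1) with ⟨-, -, h3, h4⟩ | ⟨-, -, h3, h4⟩ <;> rw [h4, h3] <;> omega
  simp only [h3]
  split_ifs with h4
  · rcases h4 with h4 | h4
    · have := fixedDiag_ne_varDiag i (pos d.1) (otherPos i (pos d.1))
      rw [← h4] at this ⊢
      simp only [true_and, this, false_and, or_false]
      omega
    · have := (fixedDiag_ne_varDiag i (pos d.1) (otherPos i (pos d.1))).symm
      rw [← h4] at this ⊢
      simp only [true_and, this, false_and, false_or]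
      omega
  · rw [not_or] at h4
    simp only [h4.1, h4.2, false_and, or_self, iff_false]
    omega

end IsSSDT

/-- The squares described by `InPlace` form a domino in the given position. -/
theorem isDomino_of_inPlace (i : Fin 2) (ν : YoungDiagram) (p : ℤ) (d : Finset (ℕ × ℕ))
    (hd : ∀ x, x ∈ d ↔ InPlace i (prof ν) p x) : IsDomino d ∧ pos d = p := by
  obtain ⟨f, hf⟩ : ∃ f, f = fixedDiag i p := ⟨_, rfl⟩
  have n1 := prof_nonneg ν f
  have n2 := neg_le_prof ν f
  unfold InPlace at hd
  rcases pos_cases i p with ⟨h1, h2, -, -⟩ | ⟨h1, h2, -, -⟩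
  · have b1 := prof_nonneg ν (f - 1 - 1)
    have b2 := neg_le_prof ν (f - 1 - 1)
    have a1 := prof_succ_le ν (f - 1 - 1)
    have a2 := prof_le_succ ν (f - 1 - 1)
    have a3 := prof_succ_le ν (f - 1)
    have a4 := prof_le_succ ν (f - 1)
    rw [sub_add_cancel] at a1 a2 a3 a4
    simp only [h2, ← hf] at hd
    have hm : midRow (prof ν) (f - 1) = (prof ν (f - 1 - 1) + prof ν f) / 2 := by
      unfold midRow
      rw [sub_add_cancel]
    rw [hm] at hd
    have e : d = {sq f (prof ν f), sq (f - 1) ((prof ν (f - 1 - 1) + prof ν f) / 2)} := by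
      ext x
      rw [hd, Finset.mem_insert, Finset.mem_singleton, eq_sq_iff (by omega) (by omega),
        eq_sq_iff (by omega) (by omega)]
    have := isDomino_pair (x := sq f (prof ν f))
      (y := sq (f - 1) ((prof ν (f - 1 - 1) + prof ν f) / 2))
      (by rw [content_sq (by omega) (by omega), content_sq (by omega) (by omega)])
      (by
        have e1 := sq_fst (c := f) n1
        have e2 := sq_fst (c := f - 1) (r := (prof ν (f - 1 - 1) + prof ν f) / 2) (by omega)
        omega)
    rw [e]
    exact ⟨this.1, by rw [this.2, content_sq (by omega) (by omega)]; omega⟩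
  · have b1 := prof_nonneg ν (f + 1 + 1)
    have b2 := neg_le_prof ν (f + 1 + 1)
    have a1 := prof_succ_le ν f
    have a2 := prof_le_succ ν f
    have a3 := prof_succ_le ν (f + 1)
    have a4 := prof_le_succ ν (f + 1)
    simp only [h2, ← hf] at hd
    have hm : midRow (prof ν) (f + 1) = (prof ν f + prof ν (f + 1 + 1)) / 2 := by
      unfold midRow
      rw [add_sub_cancel_right]
    rw [hm] at hd
    have e : d = {sq (f + 1) ((prof ν f + prof ν (f + 1 + 1)) / 2), sq f (prof ν f)} := by
      ext x
      rw [hd, Finset.mem_insert, Finset.mem_singleton, eq_sq_iff (by omega) (by omega),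
        eq_sq_iff (by omega) (by omega), or_comm]
    have := isDomino_pair (x := sq (f + 1) ((prof ν f + prof ν (f + 1 + 1)) / 2))
      (y := sq f (prof ν f))
      (by rw [content_sq (by omega) (by omega), content_sq (by omega) (by omega)]; ring)
      (by
        have e1 := sq_fst (c := f) n1
        have e2 := sq_fst (c := f + 1) (r := (prof ν f + prof ν (f + 1 + 1)) / 2) (by omega)
        omega)
    rw [e]
    exact ⟨this.1, by rw [this.2, content_sq (by omega) (by omega)]; omega⟩

namespace IsSSDT

variable {D : DominoTableau}

/-! ### Moving all dominoes -/

/-- Applying `s_i` to an initial part of the standardisation gives the image of the inner shape together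
with the moved dominoes. -/
theorem mem_reflect_fill (h : IsSSDT D.shape D) (i : Fin 2) {A} (hA : IsInitial D A) (x : ℕ × ℕ) :
    x ∈ reflect i (fill D A) ↔ x ∈ reflect i D.shape.inner ∨ ∃ d ∈ A, x ∈ moved i D d := by
  revert hA
  refine Finset.induction_on_max_value (fun d : Finset (ℕ × ℕ) × ℕ => toLex (d.2, pos d.1)) A ?_ ?_
  · intro _
    simp [fill_empty]
  · intro d s hds hmax ih hA
    have hd : d ∈ D.dominoes := hA.1 (Finset.mem_insert_self _ _)
    have hlt : ∀ e ∈ s, ¬ StdBefore d e := by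
      intro e he hde
      have := hmax e he
      rw [Prod.Lex.toLex_le_toLex] at this
      unfold StdBefore at hde
      simp only at this
      omega
    have hs : s = before D d := by
      ext e
      rw [mem_before]
      constructor
      · intro he
        have heD := hA.1 (Finset.mem_insert_of_mem he)
        exact ⟨heD, (h.stdBefore_or heD hd (fun hed => hds (hed ▸ he))).resolve_right (hlt e he)⟩
      · rintro ⟨heD, hed⟩
        refine Finset.mem_of_mem_insert_of_ne (hA.2 d (Finset.mem_insert_self _ _) e heD hed) ?_
        rintro rfl
        exact StdBefore.irrefl _ hed
    have hm : x ∈ moved i D d ↔ x ∈ reflect i (fill D (insert d s)) ∧ x ∉ reflect i (fill D s) := by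
      rw [moved, h.stdShapeAfter_eq_fill d, stdShape_eq_fill, ← hs, Finset.mem_sdiff,
        YoungDiagram.mem_cells, YoungDiagram.mem_cells]
    have hle : x ∈ reflect i (fill D s) → x ∈ reflect i (fill D (insert d s)) := by
      have := h.prof_reflect_stdShapeAfter i hd (content x)
      rw [h.stdShapeAfter_eq_fill d, stdShape_eq_fill, ← hs] at this
      rw [mem_iff_lt_prof, mem_iff_lt_prof, this]
      split_ifs <;> omega
    have ih' := ih (hs ▸ isInitial_before D d)
    have hor : x ∈ reflect i (fill D (insert d s)) ↔ x ∈ reflect i (fill D s) ∨ x ∈ moved i D d := by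
      rw [hm]
      exact ⟨fun h1 => or_iff_not_imp_left.2 fun h2 => ⟨h1, h2⟩, fun h1 => h1.elim hle And.left⟩
    rw [Finset.exists_mem_insert, hor, ih', or_assoc, or_comm (a := ∃ e ∈ s, x ∈ moved i D e)]

theorem not_mem_reflect_inner_of_mem_moved (h : IsSSDT D.shape D) (i : Fin 2) {d} {x : ℕ × ℕ}
    (hx : x ∈ moved i D d) : x ∉ reflect i D.shape.inner := by
  intro hx'
  rw [moved, Finset.mem_sdiff] at hx
  exact hx.2 ((h.mem_reflect_fill i (isInitial_before D d) x).2 (Or.inl hx'))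

theorem eq_of_mem_moved (h : IsSSDT D.shape D) {i : Fin 2} {d e} (hd : d ∈ D.dominoes)
    (he : e ∈ D.dominoes) {x : ℕ × ℕ} (hx : x ∈ moved i D d) (hx' : x ∈ moved i D e) : d = e := by
  have key : ∀ {d e}, d ∈ D.dominoes → x ∈ moved i D d → x ∈ moved i D e → ¬ StdBefore d e := by
    intro d e hd hx hx' hde
    rw [moved, Finset.mem_sdiff] at hx'
    exact hx'.2 ((h.mem_reflect_fill i (isInitial_before D e) x).2
      (Or.inr ⟨d, mem_before.2 ⟨hd, hde⟩, hx⟩))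
  by_contra hne
  rcases h.stdBefore_or hd he hne with hlt | hlt
  · exact key hd hx hx' hlt
  · exact key he hx' hx hlt

theorem exists_mem_moved_iff (h : IsSSDT D.shape D) (i : Fin 2) (x : ℕ × ℕ) :
    (∃ d ∈ D.dominoes, x ∈ moved i D d) ↔
      x ∈ reflect i D.shape.outer ∧ x ∉ reflect i D.shape.inner := by
  have := h.mem_reflect_fill i (isInitial_self D) x
  rw [h.fill_self] at this
  rw [this]
  constructor
  · rintro ⟨d, hd, hx⟩
    exact ⟨Or.inr ⟨d, hd, hx⟩, h.not_mem_reflect_inner_of_mem_moved i hx⟩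
  · rintro ⟨hx | hx, hx'⟩
    · exact absurd hx hx'
    · exact hx

theorem reflect_inner_le (h : IsSSDT D.shape D) (i : Fin 2) :
    reflect i D.shape.inner ≤ reflect i D.shape.outer := by
  intro x hx
  have := h.mem_reflect_fill i (isInitial_self D) x
  rw [h.fill_self] at this
  exact this.2 (Or.inl hx)

/-! ### Open and closed chains -/

/-- A set of dominoes that occupies the same squares before and after being moved contains no
dominoes of open chains. -/
theorem not_isOpenChain_of_closed (h : IsSSDT D.shape D) {i : Fin 2} {Z} (hZ : Z ⊆ D.dominoes)
    (hm : ∀ x, (∃ z ∈ Z, x ∈ moved i D z) ↔ ∃ z ∈ Z, x ∈ z.1) {d} (hd : d ∈ Z) :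
    ¬ IsOpenChain i D d := by
  classical
  have hlink : ∀ a b, Linked i D a b → (a ∈ Z ↔ b ∈ Z) := by
    rintro a b ⟨ha, hb, hab⟩
    obtain ⟨x, hxa, hxb⟩ := Finset.not_disjoint_iff.1 hab
    constructor
    · intro haZ
      obtain ⟨z, hz, hxz⟩ := (hm x).2 ⟨a, haZ, hxa⟩
      rwa [h.eq_of_mem_moved hb (hZ hz) hxb hxz]
    · intro hbZ
      obtain ⟨z, hz, hxz⟩ := (hm x).1 ⟨b, hbZ, hxb⟩
      rwa [h.eq_of_mem ha (hZ hz) hxa hxz]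
  have hgen : ∀ a b, Relation.EqvGen (Linked i D) a b → (a ∈ Z ↔ b ∈ Z) := by
    intro a b hab
    induction hab with
    | rel a b hab => exact hlink a b hab
    | refl a => rfl
    | symm a b _ ih => exact ih.symm
    | trans a b c _ _ ih1 ih2 => exact ih1.trans ih2
  intro hopen
  apply hopen
  ext x
  simp only [Finset.mem_biUnion, chain, Finset.mem_filter]
  constructor
  · rintro ⟨e, ⟨he, hde⟩, hx⟩
    obtain ⟨z, hz, hxz⟩ := (hm x).1 ⟨e, (hgen d e hde).1 hd, hx⟩
    refine ⟨z, ⟨hZ hz, hde.trans _ _ _ (Relation.EqvGen.symm _ _ (Relation.EqvGen.rel _ _ ?_))⟩, hxz⟩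
    exact ⟨hZ hz, he, Finset.not_disjoint_iff.2 ⟨x, hxz, hx⟩⟩
  · rintro ⟨e, ⟨he, hde⟩, hx⟩
    obtain ⟨z, hz, hxz⟩ := (hm x).2 ⟨e, (hgen d e hde).1 hd, hx⟩
    refine ⟨z, ⟨hZ hz, hde.trans _ _ _ (Relation.EqvGen.rel _ _ ?_)⟩, hxz⟩
    exact ⟨he, hZ hz, Finset.not_disjoint_iff.2 ⟨x, hx, hxz⟩⟩

end IsSSDT

section chains

variable {i : Fin 2} {D : DominoTableau} {d e : Finset (ℕ × ℕ) × ℕ}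

theorem mem_chain : e ∈ chain i D d ↔ e ∈ D.dominoes ∧ Relation.EqvGen (Linked i D) d e := by
  simp [chain]

theorem self_mem_chain (hd : d ∈ D.dominoes) : d ∈ chain i D d :=
  mem_chain.2 ⟨hd, Relation.EqvGen.refl _⟩

theorem chain_eq_of_mem (he : e ∈ chain i D d) : chain i D e = chain i D d := by
  have he := (mem_chain.1 he).2
  ext f
  rw [mem_chain, mem_chain]
  exact ⟨fun hf => ⟨hf.1, he.trans _ _ _ hf.2⟩,
    fun hf => ⟨hf.1, (Relation.EqvGen.symm _ _ he).trans _ _ _ hf.2⟩⟩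

theorem isOpenChain_iff_of_mem_chain (he : e ∈ chain i D d) :
    IsOpenChain i D e ↔ IsOpenChain i D d := by
  unfold IsOpenChain
  rw [chain_eq_of_mem he]

theorem isOpenChain_iff_of_linked (hl : Linked i D d e) : IsOpenChain i D e ↔ IsOpenChain i D d :=
  isOpenChain_iff_of_mem_chain (mem_chain.2 ⟨hl.2.1, Relation.EqvGen.rel _ _ hl⟩)

theorem exists_mem_chain_iff (hd : ¬ IsOpenChain i D d) (x : ℕ × ℕ) :
    (∃ z ∈ chain i D d, x ∈ moved i D z) ↔ ∃ z ∈ chain i D d, x ∈ z.1 := by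
  have := not_not.1 hd
  rw [← Finset.mem_biUnion, this, Finset.mem_biUnion]

end chains

open Classical in
/-- The domino that replaces `d` in `s_i ∘ D`. -/
noncomputable def newDom (i : Fin 2) (D : DominoTableau) (d : Finset (ℕ × ℕ) × ℕ) :
    Finset (ℕ × ℕ) × ℕ :=
  if IsOpenChain i D d then (moved i D d, d.2) else d

open Classical in
/-- The position in `s_i ∘ D` of the domino that replaces `d`. -/
noncomputable def newPos (i : Fin 2) (D : DominoTableau) (d : Finset (ℕ × ℕ) × ℕ) : ℤ :=
  if IsOpenChain i D d then otherPos i (pos d.1) else pos d.1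

theorem newDom_of_open {i : Fin 2} {D : DominoTableau} {d} (h : IsOpenChain i D d) :
    newDom i D d = (moved i D d, d.2) := if_pos h

theorem newDom_of_not_open {i : Fin 2} {D : DominoTableau} {d} (h : ¬ IsOpenChain i D d) :
    newDom i D d = d := if_neg h

theorem newDom_snd (i : Fin 2) (D : DominoTableau) (d) : (newDom i D d).2 = d.2 := by
  unfold newDom
  split_ifs <;> rfl

theorem mem_moveOpen {i : Fin 2} {D : DominoTableau} {e} :
    e ∈ (moveOpen i D).dominoes ↔ ∃ d ∈ D.dominoes, newDom i D d = e := by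
  simp [moveOpen, newDom]

theorem fixedDiag_newPos (i : Fin 2) (D : DominoTableau) (d) :
    fixedDiag i (newPos i D d) = fixedDiag i (pos d.1) := by
  unfold newPos
  split_ifs
  · exact fixedDiag_otherPos _ _
  · rfl

namespace IsSSDT

variable {D : DominoTableau}

theorem mem_newDom_iff (h : IsSSDT D.shape D) (i : Fin 2) {d} (hd : d ∈ D.dominoes) (x : ℕ × ℕ) :
    x ∈ (newDom i D d).1 ↔ InPlace i (prof (stdShape D d)) (newPos i D d) x := by
  unfold newDom newPos
  split_ifs
  · exact h.mem_moved_iff i hd x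
  · exact h.mem_iff_inPlace i hd x

theorem isDomino_newDom (h : IsSSDT D.shape D) (i : Fin 2) {d} (hd : d ∈ D.dominoes) :
    IsDomino (newDom i D d).1 ∧ pos (newDom i D d).1 = newPos i D d :=
  isDomino_of_inPlace i (stdShape D d) (newPos i D d) _ (h.mem_newDom_iff i hd)

/-- The dominoes of `s_i ∘ D` are disjoint: dominoes of which one would take a square from the other belong to
the same chain, so that both are moved or both stay in place. -/
theorem eq_of_mem_newDom (h : IsSSDT D.shape D) {i : Fin 2} {d e} (hd : d ∈ D.dominoes)
    (he : e ∈ D.dominoes) {x : ℕ × ℕ} (hx : x ∈ (newDom i D d).1) (hx' : x ∈ (newDom i D e).1) :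
    d = e := by
  by_cases h1 : IsOpenChain i D d <;> by_cases h2 : IsOpenChain i D e
  · rw [newDom_of_open h1] at hx
    rw [newDom_of_open h2] at hx'
    exact h.eq_of_mem_moved hd he hx hx'
  · rw [newDom_of_open h1] at hx
    rw [newDom_of_not_open h2] at hx'
    exact absurd ((isOpenChain_iff_of_linked
      ⟨he, hd, Finset.not_disjoint_iff.2 ⟨x, hx', hx⟩⟩).1 h1) h2
  · rw [newDom_of_not_open h1] at hx
    rw [newDom_of_open h2] at hx'
    exact absurd ((isOpenChain_iff_of_linked
      ⟨hd, he, Finset.not_disjoint_iff.2 ⟨x, hx, hx'⟩⟩).1 h2) h1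
  · rw [newDom_of_not_open h1] at hx
    rw [newDom_of_not_open h2] at hx'
    exact h.eq_of_mem hd he hx hx'

theorem exists_mem_newDom_iff (h : IsSSDT D.shape D) (i : Fin 2) (x : ℕ × ℕ) :
    (∃ d ∈ D.dominoes, x ∈ (newDom i D d).1) ↔
      x ∈ reflect i D.shape.outer ∧ x ∉ reflect i D.shape.inner := by
  rw [← h.exists_mem_moved_iff]
  constructor
  · rintro ⟨d, hd, hx⟩
    by_cases ho : IsOpenChain i D d
    · rw [newDom_of_open ho] at hx
      exact ⟨d, hd, hx⟩
    · rw [newDom_of_not_open ho] at hx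
      obtain ⟨e, he, hxe⟩ := (exists_mem_chain_iff ho x).2 ⟨d, self_mem_chain hd, hx⟩
      exact ⟨e, (mem_chain.1 he).1, hxe⟩
  · rintro ⟨d, hd, hx⟩
    by_cases ho : IsOpenChain i D d
    · refine ⟨d, hd, ?_⟩
      rwa [newDom_of_open ho]
    · obtain ⟨e, he, hxe⟩ := (exists_mem_chain_iff ho x).1 ⟨d, self_mem_chain hd, hx⟩
      refine ⟨e, (mem_chain.1 he).1, ?_⟩
      rwa [newDom_of_not_open ((isOpenChain_iff_of_mem_chain he).not.2 ho)]

/-! ### The tableau after moving the open chains is semistandard -/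

theorem prof_inner_le_fill (h : IsSSDT D.shape D) {A} (hA : IsInitial D A) (c : ℤ) :
    prof D.shape.inner c ≤ prof (fill D A) c := by
  rw [h.prof_fill hA]
  omega

theorem prof_fill_le_outer (h : IsSSDT D.shape D) {A} (hA : IsInitial D A) (c : ℤ) :
    prof (fill D A) c ≤ prof D.shape.outer c := by
  rw [← h.fill_self, h.prof_fill hA, h.prof_fill (isInitial_self D)]
  have := Finset.card_le_card (Finset.filter_subset_filter
    (fun d : Finset (ℕ × ℕ) × ℕ => pos d.1 = c ∨ pos d.1 = c + 1) hA.1)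
  omega

/-- The squares of `s_i ∘ D` that come from the inner shape and an initial set of dominoes. -/
def InNew (i : Fin 2) (D : DominoTableau) (A : Finset (Finset (ℕ × ℕ) × ℕ)) (x : ℕ × ℕ) : Prop :=
  x ∈ reflect i D.shape.inner ∨ ∃ d ∈ A, x ∈ (newDom i D d).1

/-- On diagonals where squares do not move, moving dominoes has no effect on initial parts. -/
theorem inNew_iff_of_fixed (h : IsSSDT D.shape D) {i : Fin 2} {A} (hA : IsInitial D A) {x : ℕ × ℕ}
    (hx : ¬ IsVar i (content x)) : InNew i D A x ↔ (x.1 : ℤ) < prof (fill D A) (content x) := by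
  have hin : ∀ ν : YoungDiagram, x ∈ reflect i ν ↔ (x.1 : ℤ) < prof ν (content x) := by
    intro ν
    rw [mem_iff_lt_prof, prof_reflect, if_neg hx]
  have hd : ∀ d ∈ D.dominoes, x ∈ (newDom i D d).1 →
      content x = fixedDiag i (pos d.1) ∧ (x.1 : ℤ) = prof (stdShape D d) (content x) := by
    intro d hd hxd
    rw [h.mem_newDom_iff i hd] at hxd
    rcases hxd with ⟨h1, h2⟩ | ⟨h1, -⟩
    · rw [fixedDiag_newPos] at h1 h2
      exact ⟨h1, by rw [h1]; exact h2⟩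
    · exact absurd (isVar_varDiag i (newPos i D d)) (h1 ▸ hx)
  constructor
  · rintro (hx' | ⟨d, hdA, hxd⟩)
    · have := h.prof_inner_le_fill hA (content x)
      have := (hin _).1 hx'
      omega
    · obtain ⟨h1, h2⟩ := hd d (hA.1 hdA) hxd
      have h3 := h.prof_stdShape_lt hA hdA (content x)
      rw [if_pos] at h3
      · omega
      · rcases pos_cases i (pos d.1) with h4 | h4 <;> omega
  · intro hlt
    unfold InNew
    rw [or_iff_not_imp_left]
    intro hni
    have := h.prof_fill_le_outer hA (content x)
    obtain ⟨d, hdD, hxd⟩ := (h.exists_mem_newDom_iff i x).2 ⟨(hin _).2 (by omega), hni⟩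
    refine ⟨d, ?_, hxd⟩
    by_contra hdA
    have h1 := h.le_prof_stdShape hA hdD hdA (content x)
    have h2 := (hd d hdD hxd).2
    omega

theorem prof_reflect_var_bounds (ν : YoungDiagram) (i : Fin 2) {a : ℤ} (ha : IsVar i a) :
    (prof ν (a - 1) + prof ν (a + 1)) / 2 ≤ prof (reflect i ν) a ∧
      prof (reflect i ν) a ≤ (prof ν (a - 1) + prof ν (a + 1) + 1) / 2 := by
  rw [prof_reflect, if_pos ha]
  rcases midRow_cases ν a with h | h <;> unfold midRow at h <;> omega

theorem pos_neighbours {i : Fin 2} {p : ℤ} {D : DominoTableau} {d : Finset (ℕ × ℕ) × ℕ}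
    (hp : varDiag i (newPos i D d) = p) :
    fixedDiag i (pos d.1) = p - 1 ∨ fixedDiag i (pos d.1) = p + 1 := by
  rw [← fixedDiag_newPos i D d]
  rcases pos_cases i (newPos i D d) with h | h <;> omega

theorem row_var_newDom (h : IsSSDT D.shape D) {i : Fin 2} {d} (hd : d ∈ D.dominoes) {x : ℕ × ℕ}
    (hx : IsVar i (content x)) (hxd : x ∈ (newDom i D d).1) :
    varDiag i (newPos i D d) = content x ∧
      (x.1 : ℤ) = (prof (stdShape D d) (content x - 1) + prof (stdShape D d) (content x + 1)) / 2 := by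
  rw [h.mem_newDom_iff i hd] at hxd
  rcases hxd with ⟨h1, -⟩ | ⟨h1, h2⟩
  · exact absurd (h1 ▸ hx) (not_isVar_fixedDiag i (newPos i D d))
  · rw [← h1] at h2
    exact ⟨h1.symm, h2⟩

/-- On a diagonal where squares move, all squares of an initial part of `s_i ∘ D` are determined by the
neighbouring diagonals, with the exception of at most one: this lemma shows which squares are certainly
present, and `row_le_of_inNew_var` which ones are certainly absent. -/
theorem inNew_of_var (h : IsSSDT D.shape D) {i : Fin 2} {A} (hA : IsInitial D A) {x : ℕ × ℕ}
    (hx : IsVar i (content x))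
    (hlt : (x.1 : ℤ) < (prof (fill D A) (content x - 1) + prof (fill D A) (content x + 1)) / 2) :
    InNew i D A x := by
  unfold InNew
  rw [or_iff_not_imp_left]
  intro hni
  have h1 := h.prof_fill_le_outer hA (content x - 1)
  have h2 := h.prof_fill_le_outer hA (content x + 1)
  have h3 := (prof_reflect_var_bounds D.shape.outer i hx).1
  obtain ⟨d, hdD, hxd⟩ := (h.exists_mem_newDom_iff i x).2
    ⟨(mem_iff_lt_prof _ _).2 (by omega), hni⟩
  refine ⟨d, ?_, hxd⟩
  by_contra hdA
  have h4 := h.le_prof_stdShape hA hdD hdA (content x - 1)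
  have h5 := h.le_prof_stdShape hA hdD hdA (content x + 1)
  have h6 := (h.row_var_newDom hdD hx hxd).2
  omega

theorem row_le_of_inNew_var (h : IsSSDT D.shape D) {i : Fin 2} {A} (hA : IsInitial D A) {x : ℕ × ℕ}
    (hx : IsVar i (content x)) (hxA : InNew i D A x) :
    (x.1 : ℤ) ≤ (prof (fill D A) (content x - 1) + prof (fill D A) (content x + 1) - 1) / 2 := by
  rcases hxA with hx' | ⟨d, hdA, hxd⟩
  · have h1 := h.prof_inner_le_fill hA (content x - 1)
    have h2 := h.prof_inner_le_fill hA (content x + 1)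
    have h3 := (prof_reflect_var_bounds D.shape.inner i hx).2
    rw [mem_iff_lt_prof] at hx'
    omega
  · obtain ⟨h1, h2⟩ := h.row_var_newDom (hA.1 hdA) hx hxd
    have h3 := h.prof_stdShape_lt hA hdA (content x - 1)
    have h4 := h.prof_stdShape_lt hA hdA (content x + 1)
    rcases pos_neighbours h1 with h5 | h5 <;> rcases pos_cases i (pos d.1) with h6 | h6 <;>
      split_ifs at h3 h4 <;> omega

theorem inNew_up (h : IsSSDT D.shape D) {i : Fin 2} {A} (hA : IsInitial D A) {r c : ℕ}
    (hx : InNew i D A (r + 1, c)) : InNew i D A (r, c) := by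
  obtain ⟨k, hk⟩ : ∃ k, k = content (r, c) := ⟨_, rfl⟩
  have hk' : content (r + 1, c) = k - 1 := by rw [hk]; simp only [content]; push_cast; ring
  have s1 := prof_le_succ (fill D A) (k - 1)
  have s2 := prof_le_succ (fill D A) k
  have s3 := prof_le_succ (fill D A) (k - 1 - 1)
  rw [sub_add_cancel] at s1 s3
  by_cases hv : IsVar i k
  · have hv' : ¬ IsVar i (k - 1) := by rw [isVar_pred_iff]; exact not_not.2 hv
    rw [h.inNew_iff_of_fixed hA (hk' ▸ hv'), hk'] at hx
    refine h.inNew_of_var hA (hk ▸ hv) ?_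
    rw [← hk]
    push_cast at hx ⊢
    omega
  · have hv' : IsVar i (k - 1) := by rw [isVar_pred_iff]; exact hv
    have := h.row_le_of_inNew_var hA (hk' ▸ hv') hx
    rw [h.inNew_iff_of_fixed hA (hk ▸ hv), ← hk]
    rw [hk', sub_add_cancel] at this
    push_cast at this ⊢
    omega

theorem inNew_left (h : IsSSDT D.shape D) {i : Fin 2} {A} (hA : IsInitial D A) {r c : ℕ}
    (hx : InNew i D A (r, c + 1)) : InNew i D A (r, c) := by
  obtain ⟨k, hk⟩ : ∃ k, k = content (r, c) := ⟨_, rfl⟩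
  have hk' : content (r, c + 1) = k + 1 := by rw [hk]; simp only [content]; push_cast; ring
  have s1 := prof_succ_le (fill D A) (k - 1)
  have s2 := prof_succ_le (fill D A) k
  have s3 := prof_succ_le (fill D A) (k + 1)
  rw [sub_add_cancel] at s1
  by_cases hv : IsVar i k
  · have hv' : ¬ IsVar i (k + 1) := by rw [isVar_succ_iff]; exact not_not.2 hv
    rw [h.inNew_iff_of_fixed hA (hk' ▸ hv'), hk'] at hx
    refine h.inNew_of_var hA (hk ▸ hv) ?_
    rw [← hk]
    push_cast at hx ⊢
    omega
  · have hv' : IsVar i (k + 1) := by rw [isVar_succ_iff]; exact hv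
    have := h.row_le_of_inNew_var hA (hk' ▸ hv') hx
    rw [h.inNew_iff_of_fixed hA (hk ▸ hv), ← hk]
    rw [hk', add_sub_cancel_right] at this
    push_cast at this ⊢
    omega

theorem inNew_of_le (h : IsSSDT D.shape D) {i : Fin 2} {A} (hA : IsInitial D A) {x y : ℕ × ℕ}
    (hxy : x ≤ y) (hy : InNew i D A y) : InNew i D A x := by
  have : IsLowerSet {x | InNew i D A x} :=
    isLowerSet_of_step (fun r c => h.inNew_up hA) (fun r c => h.inNew_left hA)
  exact this hxy hy

theorem not_mem_reflect_inner_of_mem_newDom (h : IsSSDT D.shape D) {i : Fin 2} {d}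
    (hd : d ∈ D.dominoes) {x : ℕ × ℕ} (hx : x ∈ (newDom i D d).1) : x ∉ reflect i D.shape.inner :=
  ((h.exists_mem_newDom_iff i x).1 ⟨d, hd, hx⟩).2

/-- In `s_i ∘ D` a domino that lies to the left of or above another one precedes it in the
standardisation. -/
theorem stdBefore_of_le (h : IsSSDT D.shape D) {i : Fin 2} {d e} (hd : d ∈ D.dominoes)
    (he : e ∈ D.dominoes) (hne : d ≠ e) {x y : ℕ × ℕ} (hx : x ∈ (newDom i D d).1)
    (hy : y ∈ (newDom i D e).1) (hxy : x ≤ y) : StdBefore d e := by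
  have hA := isInitial_insert_before he
  have hyA : InNew i D (insert e (before D e)) y := Or.inr ⟨e, Finset.mem_insert_self _ _, hy⟩
  rcases h.inNew_of_le hA hxy hyA with h1 | ⟨g, hg, hxg⟩
  · exact absurd h1 (h.not_mem_reflect_inner_of_mem_newDom hd hx)
  · obtain rfl := h.eq_of_mem_newDom hd (hA.1 hg) hx hxg
    exact (mem_before.1 (Finset.mem_of_mem_insert_of_ne hg hne)).2

/-- Two dominoes with the same entry that share the diagonal of their fixed squares form a closed
chain (they exchange their variable squares), so that moving open chains cannot reverse
their order. -/
theorem not_isOpenChain_of_same_fixedDiag (h : IsSSDT D.shape D) {i : Fin 2} {d e}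
    (hd : d ∈ D.dominoes) (he : e ∈ D.dominoes) (h2 : d.2 = e.2) (hp : pos d.1 < pos e.1)
    (hf : fixedDiag i (pos d.1) = fixedDiag i (pos e.1)) :
    ¬ IsOpenChain i D d ∧ ¬ IsOpenChain i D e := by
  obtain ⟨f, hf0⟩ : ∃ f, f = fixedDiag i (pos d.1) := ⟨_, rfl⟩
  obtain ⟨hd1, hd2, hd3, hd4⟩ : pos d.1 = f ∧ varDiag i (pos d.1) = f - 1 ∧
      otherPos i (pos d.1) = f + 1 ∧ varDiag i (otherPos i (pos d.1)) = f + 1 := by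
    rcases pos_cases i (pos d.1) with h4 | h4 <;> rcases pos_cases i (pos e.1) with h5 | h5 <;> omega
  obtain ⟨he1, he2, he3, he4⟩ : pos e.1 = f + 1 ∧ varDiag i (pos e.1) = f + 1 ∧
      otherPos i (pos e.1) = f ∧ varDiag i (otherPos i (pos e.1)) = f - 1 := by
    rcases pos_cases i (pos d.1) with h4 | h4 <;> rcases pos_cases i (pos e.1) with h5 | h5 <;> omega
  have hbe : before D e = insert d (before D d) := by
    ext g
    rw [Finset.mem_insert, mem_before, mem_before]
    constructor
    · rintro ⟨hg, hge⟩
      by_cases hgd : g = d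
      · exact Or.inl hgd
      · right
        refine ⟨hg, ?_⟩
        rcases h.stdBefore_or hg hd hgd with h3 | h3
        · exact h3
        · unfold StdBefore at *
          omega
    · rintro (rfl | ⟨hg, hgd⟩)
      · exact ⟨hd, Or.inr ⟨h2, hp⟩⟩
      · exact ⟨hg, hgd.trans (Or.inr ⟨h2, hp⟩)⟩
  have hρ : ∀ c, prof (stdShape D e) c = prof (stdShape D d) c + if f = c ∨ f = c + 1 then 1 else 0 := by
    intro c
    rw [stdShape_eq_fill, hbe, ← h.stdShapeAfter_eq_fill d, h.prof_stdShapeAfter hd, hd1]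
  have a1 := h.prof_stdShape_pos hd
  have a2 := h.prof_stdShape_pos he
  rw [hd1] at a1
  rw [he1, show f + 1 - 2 = f - 1 by ring, add_sub_cancel_right] at a2
  have b1 := hρ (f - 2)
  have b2 := hρ (f - 1)
  have b3 := hρ f
  have b4 := hρ (f + 1)
  have b5 := hρ (f + 1 + 1)
  rw [if_neg (by omega)] at b1 b4 b5
  rw [if_pos (by omega)] at b2 b3
  have m1 : midRow (prof (stdShape D e)) (f + 1) = midRow (prof (stdShape D d)) (f + 1) := by
    unfold midRow
    rw [add_sub_cancel_right]
    omega
  have m2 : midRow (prof (stdShape D e)) (f - 1) = midRow (prof (stdShape D d)) (f - 1) := by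
    unfold midRow
    rw [sub_add_cancel, show f - 1 - 1 = f - 2 by ring]
    omega
  have hZ : ({d, e} : Finset _) ⊆ D.dominoes := by
    intro g hg
    rw [Finset.mem_insert, Finset.mem_singleton] at hg
    rcases hg with rfl | rfl
    · exact hd
    · exact he
  have key : ∀ x, (∃ z ∈ ({d, e} : Finset _), x ∈ moved i D z) ↔
      ∃ z ∈ ({d, e} : Finset _), x ∈ z.1 := by
    intro x
    simp only [Finset.mem_insert, Finset.mem_singleton, exists_eq_or_imp, exists_eq_left]
    rw [h.mem_moved_iff i hd, h.mem_moved_iff i he, h.mem_iff_inPlace i hd, h.mem_iff_inPlace i he]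
    unfold InPlace
    rw [fixedDiag_otherPos, fixedDiag_otherPos, hd4, he4, hd2, he2, m1, m2, ← hf]
    tauto
  exact ⟨h.not_isOpenChain_of_closed hZ key (by simp), h.not_isOpenChain_of_closed hZ key (by simp)⟩

/-- Moving open chains preserves the order of the positions of dominoes with equal entries. -/
theorem newPos_lt_newPos (h : IsSSDT D.shape D) {i : Fin 2} {d e} (hd : d ∈ D.dominoes)
    (he : e ∈ D.dominoes) (h2 : d.2 = e.2) (hp : pos d.1 < pos e.1) :
    newPos i D d < newPos i D e := by
  by_cases hf : fixedDiag i (pos d.1) = fixedDiag i (pos e.1)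
  · obtain ⟨h3, h4⟩ := h.not_isOpenChain_of_same_fixedDiag hd he h2 hp hf
    simpa [newPos, h3, h4] using hp
  · have h1 := not_isVar_fixedDiag i (pos d.1)
    have h3 : fixedDiag i (pos e.1) ≠ fixedDiag i (pos d.1) + 1 := by
      intro he'
      refine not_isVar_fixedDiag i (pos e.1) ?_
      rw [he', isVar_succ_iff]
      exact h1
    have h4 := pos_cases i (pos d.1)
    have h5 := pos_cases i (pos e.1)
    have h6 := pos_cases i (newPos i D d)
    have h7 := pos_cases i (newPos i D e)
    rw [fixedDiag_newPos] at h6 h7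
    omega

theorem stdBefore_newDom (h : IsSSDT D.shape D) {i : Fin 2} {d e} (hd : d ∈ D.dominoes)
    (he : e ∈ D.dominoes) (hde : StdBefore d e) : StdBefore (newDom i D d) (newDom i D e) := by
  unfold StdBefore
  rw [newDom_snd, newDom_snd, (h.isDomino_newDom i hd).2, (h.isDomino_newDom i he).2]
  rcases hde with hde | ⟨h2, hp⟩
  · exact Or.inl hde
  · exact Or.inr ⟨h2, h.newPos_lt_newPos hd he h2 hp⟩

theorem moveOpen (h : IsSSDT D.shape D) (i : Fin 2) :
    IsSSDT ⟨reflect i D.shape.outer, reflect i D.shape.inner⟩ (moveOpen i D) where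
  shape_eq := rfl
  inner_le := h.reflect_inner_le i
  isDomino := by
    intro d' hd'
    obtain ⟨d, hd, rfl⟩ := mem_moveOpen.1 hd'
    exact (h.isDomino_newDom i hd).1
  disjoint := by
    intro d' hd' e' he' hne
    obtain ⟨d, hd, rfl⟩ := mem_moveOpen.1 hd'
    obtain ⟨e, he, rfl⟩ := mem_moveOpen.1 he'
    rw [Finset.disjoint_left]
    intro x hx hx'
    exact hne (by rw [h.eq_of_mem_newDom hd he hx hx'])
  cover := by
    ext x
    rw [SkewShape.mem_cells, ← h.exists_mem_newDom_iff i, Finset.mem_biUnion]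
    constructor
    · rintro ⟨d', hd', hx⟩
      obtain ⟨d, hd, rfl⟩ := mem_moveOpen.1 hd'
      exact ⟨d, hd, hx⟩
    · rintro ⟨d, hd, hx⟩
      exact ⟨_, mem_moveOpen.2 ⟨d, hd, rfl⟩, hx⟩
  row_weak := by
    intro d' hd' e' he' r j₁ j₂ h1 h2 hj
    obtain ⟨d, hd, rfl⟩ := mem_moveOpen.1 hd'
    obtain ⟨e, he, rfl⟩ := mem_moveOpen.1 he'
    rw [newDom_snd, newDom_snd]
    by_cases hne : d = e
    · rw [hne]
    · have := h.stdBefore_of_le hd he hne h1 h2 ⟨le_rfl, hj.le⟩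
      unfold StdBefore at this
      omega
  col_strict := by
    intro d' hd' e' he' hne' r₁ r₂ j h1 h2 hr
    obtain ⟨d, hd, rfl⟩ := mem_moveOpen.1 hd'
    obtain ⟨e, he, rfl⟩ := mem_moveOpen.1 he'
    rw [newDom_snd, newDom_snd]
    have hne : d ≠ e := fun hde => hne' (by rw [hde])
    have hlt := h.stdBefore_of_le hd he hne h1 h2 ⟨hr.le, le_rfl⟩
    refine hlt.resolve_right ?_
    rintro ⟨h3, h4⟩
    have a1 := h.newPos_lt_newPos (i := i) hd he h3 h4
    obtain ⟨b1, b2⟩ := h.isDomino_newDom i hd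
    obtain ⟨b3, b4⟩ := h.isDomino_newDom i he
    have c1 := b1.content_mem h1
    have c2 := b3.content_mem h2
    simp only [content] at c1 c2
    omega

end IsSSDT

/-! ### Moving open chains is an involution -/

theorem reflect_reflect (i : Fin 2) (ν : YoungDiagram) : reflect i (reflect i ν) = ν := by
  apply ext_prof
  intro c
  have h1 := isVar_pred_iff i c
  have h2 := isVar_succ_iff i c
  rw [prof_reflect, prof_reflect, prof_reflect, prof_reflect]
  by_cases h : IsVar i c
  · rw [if_pos h, if_neg (h1.not.2 (not_not.2 h)), if_neg (h2.not.2 (not_not.2 h)), if_pos h]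
    ring
  · rw [if_neg h, if_neg h]

namespace IsSSDT

variable {D : DominoTableau}

/-- A domino lies in a closed chain if and only if it belongs to some set of dominoes that occupies the
same squares after being moved. -/
theorem not_isOpenChain_iff (h : IsSSDT D.shape D) {i : Fin 2} {d} (hd : d ∈ D.dominoes) :
    ¬ IsOpenChain i D d ↔ ∃ Z ⊆ D.dominoes, d ∈ Z ∧
      ∀ x, (∃ z ∈ Z, x ∈ moved i D z) ↔ ∃ z ∈ Z, x ∈ z.1 := by
  constructor
  · intro ho
    exact ⟨chain i D d, fun e he => (mem_chain.1 he).1, self_mem_chain hd, exists_mem_chain_iff ho⟩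
  · rintro ⟨Z, hZ, hdZ, hm⟩
    exact h.not_isOpenChain_of_closed hZ hm hdZ

theorem newDom_injOn (h : IsSSDT D.shape D) {i : Fin 2} {d e} (hd : d ∈ D.dominoes)
    (he : e ∈ D.dominoes) (hde : newDom i D d = newDom i D e) : d = e := by
  obtain ⟨x, y, hxy, -⟩ := (h.isDomino_newDom i hd).1.exists_eq
  have hx : x ∈ (newDom i D d).1 := by rw [hxy]; exact Finset.mem_insert_self _ _
  exact h.eq_of_mem_newDom hd he hx (hde ▸ hx)

theorem stdBefore_newDom_iff (h : IsSSDT D.shape D) {i : Fin 2} {d e} (hd : d ∈ D.dominoes)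
    (he : e ∈ D.dominoes) : StdBefore (newDom i D d) (newDom i D e) ↔ StdBefore d e := by
  refine ⟨fun h1 => ?_, h.stdBefore_newDom hd he⟩
  by_cases hne : d = e
  · subst hne
    exact absurd h1 (StdBefore.irrefl _)
  · exact (h.stdBefore_or hd he hne).resolve_right fun h2 => h1.asymm (h.stdBefore_newDom he hd h2)

theorem moveOpen_self (h : IsSSDT D.shape D) (i : Fin 2) :
    IsSSDT (DominoLR.moveOpen i D).shape (DominoLR.moveOpen i D) := h.moveOpen i

/-- The profiles in the standardisations of `D` and of `s_i ∘ D` agree on the diagonals on which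
squares do not move. -/
theorem prof_stdShape_moveOpen (h : IsSSDT D.shape D) {i : Fin 2} {d} (hd : d ∈ D.dominoes) {c : ℤ}
    (hc : ¬ IsVar i c) :
    prof (stdShape (DominoLR.moveOpen i D) (newDom i D d)) c = prof (stdShape D d) c := by
  have key : ∀ r : ℤ, 0 ≤ r → -c ≤ r →
      (r < prof (stdShape (DominoLR.moveOpen i D) (newDom i D d)) c ↔ r < prof (stdShape D d) c) := by
    intro r h0 h1
    have e1 : content (sq c r) = c := content_sq h0 h1
    have h2 := h.inNew_iff_of_fixed (i := i) (isInitial_before D d) (x := sq c r) (e1.symm ▸ hc)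
    rw [e1, sq_fst h0] at h2
    rw [← sq_mem_iff _ h0 h1, stdShape_eq_fill D, ← h2, stdShape_eq_fill,
      (h.moveOpen_self i).mem_fill (isInitial_before _ _)]
    unfold InNew
    refine or_congr Iff.rfl ?_
    constructor
    · rintro ⟨e', he', hx⟩
      obtain ⟨he'1, he'2⟩ := mem_before.1 he'
      obtain ⟨e, he, rfl⟩ := mem_moveOpen.1 he'1
      exact ⟨e, mem_before.2 ⟨he, (h.stdBefore_newDom_iff he hd).1 he'2⟩, hx⟩
    · rintro ⟨e, he, hx⟩
      obtain ⟨he1, he2⟩ := mem_before.1 he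
      exact ⟨newDom i D e, mem_before.2 ⟨mem_moveOpen.2 ⟨e, he1, rfl⟩,
        (h.stdBefore_newDom_iff he1 hd).2 he2⟩, hx⟩
  have a1 := key (prof (stdShape (DominoLR.moveOpen i D) (newDom i D d)) c) (prof_nonneg _ _)
    (neg_le_prof _ _)
  have a2 := key (prof (stdShape D d) c) (prof_nonneg _ _) (neg_le_prof _ _)
  omega

theorem mem_moved_newDom (h : IsSSDT D.shape D) {i : Fin 2} {d} (hd : d ∈ D.dominoes) (x : ℕ × ℕ) :
    x ∈ moved i (DominoLR.moveOpen i D) (newDom i D d) ↔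
      InPlace i (prof (stdShape D d)) (otherPos i (newPos i D d)) x := by
  rw [(h.moveOpen_self i).mem_moved_iff i (mem_moveOpen.2 ⟨d, hd, rfl⟩), (h.isDomino_newDom i hd).2]
  unfold InPlace midRow
  have h0 := not_isVar_fixedDiag i (otherPos i (newPos i D d))
  have h1 : ¬ IsVar i (varDiag i (otherPos i (newPos i D d)) - 1) := by
    rw [isVar_pred_iff]
    exact not_not.2 (isVar_varDiag _ _)
  have h2 : ¬ IsVar i (varDiag i (otherPos i (newPos i D d)) + 1) := by
    rw [isVar_succ_iff]
    exact not_not.2 (isVar_varDiag _ _)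
  rw [h.prof_stdShape_moveOpen hd h0, h.prof_stdShape_moveOpen hd h1, h.prof_stdShape_moveOpen hd h2]

theorem moved_newDom_of_open (h : IsSSDT D.shape D) {i : Fin 2} {d} (hd : d ∈ D.dominoes)
    (ho : IsOpenChain i D d) : moved i (DominoLR.moveOpen i D) (newDom i D d) = d.1 := by
  ext x
  rw [h.mem_moved_newDom hd, h.mem_iff_inPlace i hd]
  unfold newPos
  rw [if_pos ho, otherPos_otherPos]

theorem moved_newDom_of_not_open (h : IsSSDT D.shape D) {i : Fin 2} {d} (hd : d ∈ D.dominoes)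
    (ho : ¬ IsOpenChain i D d) :
    moved i (DominoLR.moveOpen i D) (newDom i D d) = moved i D d := by
  ext x
  rw [h.mem_moved_newDom hd, h.mem_moved_iff i hd]
  unfold newPos
  rw [if_neg ho]

/-- A set of dominoes of `D` that occupies the same squares before and after moving corresponds to such a set
of dominoes of `s_i ∘ D`: for dominoes in open chains the roles of the two places are exchanged, and for
the others nothing changes. -/
theorem isOpenChain_newDom_iff (h : IsSSDT D.shape D) {i : Fin 2} {d} (hd : d ∈ D.dominoes) :
    IsOpenChain i (DominoLR.moveOpen i D) (newDom i D d) ↔ IsOpenChain i D d := by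
  classical
  rw [← not_iff_not, (h.moveOpen_self i).not_isOpenChain_iff (mem_moveOpen.2 ⟨d, hd, rfl⟩)]
  constructor
  · rintro ⟨Z', hZ', hdZ', hm⟩
    refine (h.not_isOpenChain_iff hd).2
      ⟨D.dominoes.filter fun z => newDom i D z ∈ Z', Finset.filter_subset _ _,
        Finset.mem_filter.2 ⟨hd, hdZ'⟩, fun x => ?_⟩
    simp only [Finset.mem_filter]
    constructor
    · rintro ⟨z, ⟨hz, hzZ⟩, hx⟩
      by_cases hzo : IsOpenChain i D z
      · obtain ⟨w', hw', hxw⟩ := (hm x).2 ⟨_, hzZ, by rwa [newDom_of_open hzo]⟩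
        obtain ⟨w, hw, rfl⟩ := mem_moveOpen.1 (hZ' hw')
        by_cases hwo : IsOpenChain i D w
        · rw [h.moved_newDom_of_open hw hwo] at hxw
          exact ⟨w, ⟨hw, hw'⟩, hxw⟩
        · rw [h.moved_newDom_of_not_open hw hwo] at hxw
          exact absurd (h.eq_of_mem_moved hz hw hx hxw ▸ hzo) hwo
      · obtain ⟨w', hw', hxw⟩ := (hm x).1 ⟨_, hzZ, by rwa [h.moved_newDom_of_not_open hz hzo]⟩
        obtain ⟨w, hw, rfl⟩ := mem_moveOpen.1 (hZ' hw')
        by_cases hwo : IsOpenChain i D w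
        · rw [newDom_of_open hwo] at hxw
          exact absurd (h.eq_of_mem_moved hw hz hxw hx ▸ hwo) hzo
        · rw [newDom_of_not_open hwo] at hxw
          exact ⟨w, ⟨hw, hw'⟩, hxw⟩
    · rintro ⟨z, ⟨hz, hzZ⟩, hx⟩
      by_cases hzo : IsOpenChain i D z
      · obtain ⟨w', hw', hxw⟩ := (hm x).1 ⟨_, hzZ, by rwa [h.moved_newDom_of_open hz hzo]⟩
        obtain ⟨w, hw, rfl⟩ := mem_moveOpen.1 (hZ' hw')
        by_cases hwo : IsOpenChain i D w
        · rw [newDom_of_open hwo] at hxw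
          exact ⟨w, ⟨hw, hw'⟩, hxw⟩
        · rw [newDom_of_not_open hwo] at hxw
          exact absurd (h.eq_of_mem hz hw hx hxw ▸ hzo) hwo
      · obtain ⟨w', hw', hxw⟩ := (hm x).2 ⟨_, hzZ, by rwa [newDom_of_not_open hzo]⟩
        obtain ⟨w, hw, rfl⟩ := mem_moveOpen.1 (hZ' hw')
        by_cases hwo : IsOpenChain i D w
        · rw [h.moved_newDom_of_open hw hwo] at hxw
          exact absurd (h.eq_of_mem hw hz hxw hx ▸ hwo) hzo
        · rw [h.moved_newDom_of_not_open hw hwo] at hxw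
          exact ⟨w, ⟨hw, hw'⟩, hxw⟩
  · intro ho
    have hc : ∀ e ∈ chain i D d, e ∈ D.dominoes ∧ ¬ IsOpenChain i D e := fun e he =>
      ⟨(mem_chain.1 he).1, (isOpenChain_iff_of_mem_chain he).not.2 ho⟩
    refine ⟨chain i D d, fun e he => ?_, ?_, fun x => ?_⟩
    · exact mem_moveOpen.2 ⟨e, (hc e he).1, newDom_of_not_open (hc e he).2⟩
    · rw [newDom_of_not_open ho]
      exact self_mem_chain hd
    · rw [← exists_mem_chain_iff ho x]
      refine exists_congr fun e => and_congr_right fun he => ?_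
      have := h.moved_newDom_of_not_open (hc e he).1 (hc e he).2
      rw [newDom_of_not_open (hc e he).2] at this
      rw [this]

theorem newDom_newDom (h : IsSSDT D.shape D) {i : Fin 2} {d} (hd : d ∈ D.dominoes) :
    newDom i (DominoLR.moveOpen i D) (newDom i D d) = d := by
  by_cases ho : IsOpenChain i D d
  · rw [newDom_of_open ((h.isOpenChain_newDom_iff hd).2 ho), h.moved_newDom_of_open hd ho, newDom_snd]
  · rw [newDom_of_not_open ((h.isOpenChain_newDom_iff hd).not.2 ho), newDom_of_not_open ho]

theorem moveOpen_moveOpen (h : IsSSDT D.shape D) (i : Fin 2) :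
    DominoLR.moveOpen i (DominoLR.moveOpen i D) = D := by
  have h1 : (DominoLR.moveOpen i (DominoLR.moveOpen i D)).shape = D.shape := by
    change (⟨reflect i (reflect i D.shape.outer), reflect i (reflect i D.shape.inner)⟩ : SkewShape) = _
    rw [reflect_reflect, reflect_reflect]
  have h2 : (DominoLR.moveOpen i (DominoLR.moveOpen i D)).dominoes = D.dominoes := by
    ext e
    rw [mem_moveOpen]
    constructor
    · rintro ⟨d', hd', rfl⟩
      obtain ⟨d, hd, rfl⟩ := mem_moveOpen.1 hd'
      rwa [h.newDom_newDom hd]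
    · intro he
      exact ⟨newDom i D e, mem_moveOpen.2 ⟨e, he, rfl⟩, h.newDom_newDom he⟩
  calc _ = (⟨(DominoLR.moveOpen i (DominoLR.moveOpen i D)).shape,
      (DominoLR.moveOpen i (DominoLR.moveOpen i D)).dominoes⟩ : DominoTableau) := rfl
    _ = _ := by rw [h1, h2]

theorem dominoWt_moveOpen (h : IsSSDT D.shape D) (i : Fin 2) :
    dominoWt (DominoLR.moveOpen i D) = dominoWt D := by
  classical
  funext k
  symm
  refine Finset.card_nbij (newDom i D) (fun d hd => ?_) (fun d hd e he hde => ?_) (fun d' hd' => ?_)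
  · rw [Finset.mem_coe, Finset.mem_filter] at hd ⊢
    exact ⟨mem_moveOpen.2 ⟨d, hd.1, rfl⟩, by rw [newDom_snd]; exact hd.2⟩
  · rw [Finset.mem_coe, Finset.mem_filter] at hd he
    exact h.newDom_injOn hd.1 he.1 hde
  · rw [Finset.mem_coe, Finset.mem_filter] at hd'
    obtain ⟨d, hd, rfl⟩ := mem_moveOpen.1 hd'.1
    refine ⟨d, ?_, rfl⟩
    rw [Finset.mem_coe, Finset.mem_filter]
    exact ⟨hd, by rw [← newDom_snd i D d]; exact hd'.2⟩

/-- When the shape is fixed by `s_i`, all chains are closed. -/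
theorem moveOpen_eq_self (h : IsSSDT D.shape D) {i : Fin 2} (ho : reflect i D.shape.outer = D.shape.outer)
    (hi : reflect i D.shape.inner = D.shape.inner) : DominoLR.moveOpen i D = D := by
  have hc : ∀ d ∈ D.dominoes, ¬ IsOpenChain i D d := by
    intro d hd
    refine h.not_isOpenChain_of_closed subset_rfl (fun x => ?_) hd
    rw [h.exists_mem_moved_iff, ho, hi, ← SkewShape.mem_cells, ← h.cover, Finset.mem_biUnion]
  have h1 : (DominoLR.moveOpen i D).shape = D.shape := by
    change (⟨reflect i D.shape.outer, reflect i D.shape.inner⟩ : SkewShape) = _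
    rw [ho, hi]
  have h2 : (DominoLR.moveOpen i D).dominoes = D.dominoes := by
    ext e
    rw [mem_moveOpen]
    constructor
    · rintro ⟨d, hd, rfl⟩
      rwa [newDom_of_not_open (hc d hd)]
    · intro he
      exact ⟨e, he, newDom_of_not_open (hc e he)⟩
  calc _ = (⟨(DominoLR.moveOpen i D).shape, (DominoLR.moveOpen i D).dominoes⟩ : DominoTableau) := rfl
    _ = _ := by rw [h1, h2]

/-- When all chains are open, `s_i` is applied to all partitions in the tableau. -/
theorem dominoBelow_moveOpen (h : IsSSDT D.shape D) {i : Fin 2}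
    (ho : ∀ d ∈ D.dominoes, IsOpenChain i D d) (k : ℕ) :
    dominoBelow (DominoLR.moveOpen i D) k = reflect i (dominoBelow D k) := by
  ext x
  rw [YoungDiagram.mem_cells, YoungDiagram.mem_cells, dominoBelow_eq_fill, dominoBelow_eq_fill,
    h.mem_reflect_fill i (isInitial_below D k), (h.moveOpen_self i).mem_fill (isInitial_below _ k)]
  refine or_congr Iff.rfl ?_
  simp only [Finset.mem_filter]
  constructor
  · rintro ⟨d', ⟨hd', hk⟩, hx⟩
    obtain ⟨d, hd, rfl⟩ := mem_moveOpen.1 hd'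
    rw [newDom_of_open (ho d hd)] at hk hx
    exact ⟨d, ⟨hd, hk⟩, hx⟩
  · rintro ⟨d, ⟨hd, hk⟩, hx⟩
    refine ⟨newDom i D d, ⟨mem_moveOpen.2 ⟨d, hd, rfl⟩, ?_⟩, ?_⟩ <;> rw [newDom_of_open (ho d hd)]
    · exact hk
    · exact hx

end IsSSDT

/-! ### Strips: partitions that differ by the squares or dominoes with one entry -/

/-- The indicator function of a finite set of integers. -/
def ind (X : Finset ℤ) (p : ℤ) : ℤ := if p ∈ X then 1 else 0

theorem ind_of_mem {X : Finset ℤ} {p : ℤ} (h : p ∈ X) : ind X p = 1 := if_pos h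

theorem ind_of_not_mem {X : Finset ℤ} {p : ℤ} (h : p ∉ X) : ind X p = 0 := if_neg h

theorem ind_nonneg (X : Finset ℤ) (p : ℤ) : 0 ≤ ind X p := by
  unfold ind
  split_ifs <;> omega

theorem ind_le_one (X : Finset ℤ) (p : ℤ) : ind X p ≤ 1 := by
  unfold ind
  split_ifs <;> omega

theorem mem_iff_ind {X : Finset ℤ} {p : ℤ} : p ∈ X ↔ ind X p = 1 := by
  unfold ind
  split_ifs <;> simp_all

/-- The number of elements of `X` that are at least `x`. -/
def tail (X : Finset ℤ) (x : ℤ) : ℤ := ((X.filter fun p => x ≤ p).card : ℤ)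

theorem tail_nonneg (X : Finset ℤ) (x : ℤ) : 0 ≤ tail X x := by
  simp [tail]

theorem tail_eq (X : Finset ℤ) (x : ℤ) : tail X x = tail X (x + 1) + ind X x := by
  unfold tail ind
  by_cases h : x ∈ X
  · have : (X.filter fun p => x ≤ p) = insert x (X.filter fun p => x + 1 ≤ p) := by
      ext p
      simp only [Finset.mem_filter, Finset.mem_insert]
      constructor
      · rintro ⟨h1, h2⟩
        rcases h2.eq_or_lt with h3 | h3
        · exact Or.inl h3.symm
        · exact Or.inr ⟨h1, h3⟩
      · rintro (rfl | ⟨h1, h2⟩)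
        · exact ⟨h, le_rfl⟩
        · exact ⟨h1, by omega⟩
    rw [this, Finset.card_insert_of_notMem (by simp), if_pos h]
    push_cast
    rfl
  · have : (X.filter fun p => x ≤ p) = X.filter fun p => x + 1 ≤ p := by
      refine Finset.filter_congr fun p hp => ?_
      have : p ≠ x := fun hpx => h (hpx ▸ hp)
      omega
    rw [this, if_neg h, add_zero]

theorem tail_antitone (X : Finset ℤ) {x y : ℤ} (h : x ≤ y) : tail X y ≤ tail X x := by
  unfold tail
  refine Nat.cast_le.2 (Finset.card_le_card fun p hp => ?_)
  rw [Finset.mem_filter] at hp ⊢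
  exact ⟨hp.1, h.trans hp.2⟩

theorem exists_upper_bound (X : Finset ℤ) : ∃ N : ℤ, ∀ p ∈ X, p < N := by
  obtain ⟨N, hN⟩ := X.bddAbove
  exact ⟨N + 1, fun p hp => by have := hN (Finset.mem_coe.2 hp); omega⟩

/-- `ν'` is obtained from `ν` by adding, in increasing order, dominoes in the positions in `X`. -/
structure DominoStrip (ν ν' : YoungDiagram) (X : Finset ℤ) : Prop where
  prof_eq : ∀ c, prof ν' c = prof ν c + ind X c + ind X (c + 1)
  hole : ∀ p ∈ X, prof ν p = prof ν (p + 1)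

/-- The positions of the dominoes with entry `k`. -/
def posSet (D : DominoTableau) (k : ℕ) : Finset ℤ :=
  (D.dominoes.filter fun d => d.2 = k).image fun d => pos d.1

theorem mem_posSet {D : DominoTableau} {k : ℕ} {p : ℤ} :
    p ∈ posSet D k ↔ ∃ d ∈ D.dominoes, d.2 = k ∧ pos d.1 = p := by
  simp [posSet, and_assoc]

namespace IsSSDT

variable {D : DominoTableau}

theorem card_entry_filter (h : IsSSDT D.shape D) (k : ℕ) (P : ℤ → Prop) [DecidablePred P] :
    (D.dominoes.filter fun d => d.2 = k ∧ P (pos d.1)).card = ((posSet D k).filter P).card := by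
  refine Finset.card_nbij (fun d => pos d.1) (fun d hd => ?_) (fun d hd e he hde => ?_)
    (fun p hp => ?_)
  · rw [Finset.mem_coe, Finset.mem_filter] at hd ⊢
    exact ⟨mem_posSet.2 ⟨d, hd.1, hd.2.1, rfl⟩, hd.2.2⟩
  · rw [Finset.mem_coe, Finset.mem_filter] at hd he
    exact h.eq_of_pos_eq hd.1 he.1 (hd.2.1.trans he.2.1.symm) hde
  · rw [Finset.mem_coe, Finset.mem_filter] at hp
    obtain ⟨d, hd, hk, rfl⟩ := mem_posSet.1 hp.1
    refine ⟨d, ?_, rfl⟩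
    rw [Finset.mem_coe, Finset.mem_filter]
    exact ⟨hd, hk, hp.2⟩

theorem sum_entry_pos (h : IsSSDT D.shape D) (k : ℕ) (c : ℤ) :
    ∑ d ∈ D.dominoes, (if d.2 = k ∧ pos d.1 = c then (1 : ℤ) else 0) = ind (posSet D k) c := by
  have := h.card_entry_filter k (fun p => p = c)
  rw [Finset.sum_boole, this, Finset.filter_eq']
  unfold ind
  split_ifs <;> simp

theorem dominoStrip (h : IsSSDT D.shape D) (k : ℕ) :
    DominoStrip (dominoBelow D k) (dominoBelow D (k + 1)) (posSet D k) := by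
  have hprof : ∀ c, prof (dominoBelow D (k + 1)) c =
      prof (dominoBelow D k) c + ind (posSet D k) c + ind (posSet D k) (c + 1) := by
    intro c
    rw [dominoBelow_eq_fill, dominoBelow_eq_fill, h.prof_fill (isInitial_below D _),
      h.prof_fill (isInitial_below D _), ← h.sum_entry_pos, ← h.sum_entry_pos, Finset.filter_filter,
      Finset.filter_filter, add_assoc, add_assoc, ← Finset.sum_boole, ← Finset.sum_boole,
      ← Finset.sum_add_distrib, ← Finset.sum_add_distrib]
    congr 1
    refine Finset.sum_congr rfl fun d _ => ?_
    split_ifs <;> omega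
  refine ⟨hprof, fun p hp => ?_⟩
  obtain ⟨d, hd, hk, rfl⟩ := mem_posSet.1 hp
  have h1 := (h.prof_stdShape_pos hd).1
  have key : ∀ c, pos d.1 ≤ c → prof (stdShape D d) c = prof (dominoBelow D k) c := by
    intro c hc
    rw [stdShape_eq_fill, dominoBelow_eq_fill, h.prof_fill (isInitial_below D _),
      h.prof_fill (isInitial_before D d)]
    congr 3
    ext e
    rw [Finset.mem_filter, Finset.mem_filter, mem_before, Finset.mem_filter, ← hk]
    unfold StdBefore
    constructor
    · rintro ⟨⟨he, hlt⟩, hpe⟩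
      exact ⟨⟨he, by omega⟩, hpe⟩
    · rintro ⟨⟨he, hlt⟩, hpe⟩
      exact ⟨⟨he, by omega⟩, hpe⟩
  rwa [key _ le_rfl, key _ (by omega)] at h1

theorem prof_stdShape_eq (h : IsSSDT D.shape D) (d) (c : ℤ) :
    prof (stdShape D d) c = prof (dominoBelow D d.2) c +
      (if c < pos d.1 then ind (posSet D d.2) c else 0) +
      (if c + 1 < pos d.1 then ind (posSet D d.2) (c + 1) else 0) := by
  have e1 : ∀ c : ℤ, (if c < pos d.1 then ind (posSet D d.2) c else 0) =
      ∑ e ∈ D.dominoes, (if e.2 = d.2 ∧ pos e.1 = c ∧ c < pos d.1 then (1 : ℤ) else 0) := by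
    intro c
    rw [← h.sum_entry_pos]
    split_ifs with hc <;> simp [hc]
  rw [e1, e1, stdShape_eq_fill, dominoBelow_eq_fill, h.prof_fill (isInitial_below D _),
    h.prof_fill (isInitial_before D d)]
  classical
  have e2 : before D d = D.dominoes.filter fun e => StdBefore e d := by
    ext e
    rw [mem_before, Finset.mem_filter]
  rw [e2, Finset.filter_filter, Finset.filter_filter, add_assoc, add_assoc, ← Finset.sum_boole,
    ← Finset.sum_boole, ← Finset.sum_add_distrib, ← Finset.sum_add_distrib]
  congr 1
  refine Finset.sum_congr rfl fun e _ => ?_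
  unfold StdBefore
  split_ifs <;> omega

theorem dominoWt_eq (h : IsSSDT D.shape D) (k : ℕ) : dominoWt D k = (posSet D k).card := by
  have := h.card_entry_filter k (fun _ => True)
  simpa [dominoWt] using this

end IsSSDT

/-! ### The Yamanouchi condition in terms of positions -/

theorem prof_le_add (ν : YoungDiagram) {c c' : ℤ} (h : c ≤ c') : prof ν c ≤ prof ν c' + (c' - c) := by
  obtain ⟨n, rfl⟩ := Int.le.dest h
  clear h
  induction n with
  | zero => simp
  | succ n ih =>
    have := prof_le_succ ν (c + n)
    push_cast
    rw [← add_assoc]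
    omega

/-- Two consecutive strips satisfy the lattice condition: this is the Yamanouchi condition for a pair
of consecutive entries, expressed by positions only. -/
def Dominates (X₀ X₁ : Finset ℤ) : Prop := ∀ x, tail X₁ x ≤ tail X₀ (x + 1)

theorem col_lt_of_hole (ν : YoungDiagram) {p q : ℤ} (hp : prof ν p = prof ν (p + 1)) (h : p < q) :
    prof ν p + p < prof ν q + q := by
  have := prof_le_add ν (show p + 1 ≤ q by omega)
  omega

/-- The number of elements of a strip that are read up to a given position. -/
theorem DominoStrip.card_read_same {ν ν' : YoungDiagram} {X : Finset ℤ} (h : DominoStrip ν ν' X) (q : ℤ) :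
    ((X.filter fun p => prof ν q + q < prof ν p + p ∨
      prof ν q + q = prof ν p + p ∧ prof ν p ≤ prof ν q).card : ℤ) = tail X q := by
  unfold tail
  congr 2
  refine Finset.filter_congr fun p hp => ?_
  constructor
  · intro h1
    by_contra hlt
    have := col_lt_of_hole ν (h.hole p hp) (not_le.1 hlt)
    omega
  · intro h1
    have := prof_le_add ν h1
    omega

/-- The number of elements of the first strip that are read up to a given element of the second. The
element `q + 1` of the first strip is missing from the count when `q + 2` belongs to that strip as well,
since then the domino in position `q + 1` is read after the one in position `q` of the second strip. -/
theorem DominoStrip.card_read_prev {ν₀ ν₁ ν₂ : YoungDiagram} {X₀ X₁ : Finset ℤ}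
    (h₀ : DominoStrip ν₀ ν₁ X₀) (h₁ : DominoStrip ν₁ ν₂ X₁) {q : ℤ} (hq : q ∈ X₁) :
    ((X₀.filter fun p => prof ν₁ q + q < prof ν₀ p + p ∨
      prof ν₁ q + q = prof ν₀ p + p ∧ prof ν₀ p ≤ prof ν₁ q).card : ℤ) =
      tail X₀ (q + 1) - if q + 1 ∈ X₀ ∧ q + 2 ∈ X₀ then 1 else 0 := by
  have e0 := h₀.prof_eq q
  have e1 := h₀.prof_eq (q + 1)
  have hq1 := h₁.hole q hq
  rw [show q + 1 + 1 = q + 2 by ring] at e1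
  have i0 := ind_nonneg X₀ q
  have i1 := ind_nonneg X₀ (q + 1)
  have i2 := ind_nonneg X₀ (q + 2)
  have i0' := ind_le_one X₀ q
  have i1' := ind_le_one X₀ (q + 1)
  have i2' := ind_le_one X₀ (q + 2)
  have s0 := prof_le_succ ν₀ q
  have s1 := prof_succ_le ν₀ q
  have hh0 : ind X₀ q = 1 → prof ν₀ q = prof ν₀ (q + 1) := fun hi => h₀.hole q (mem_iff_ind.2 hi)
  have hh1 : ind X₀ (q + 1) = 1 → prof ν₀ (q + 1) = prof ν₀ (q + 2) := by
    intro hi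
    have := h₀.hole (q + 1) (mem_iff_ind.2 hi)
    rwa [show q + 1 + 1 = q + 2 by ring] at this
  have low : ∀ p ∈ X₀, p ≤ q → ¬ (prof ν₁ q + q < prof ν₀ p + p ∨
      prof ν₁ q + q = prof ν₀ p + p ∧ prof ν₀ p ≤ prof ν₁ q) := by
    intro p hp hpq
    have a1 := prof_le_add ν₀ hpq
    rcases hpq.eq_or_lt with rfl | hlt
    · have := ind_of_mem hp
      omega
    · have := col_lt_of_hole ν₀ (h₀.hole p hp) hlt
      omega
  have high : ∀ θ p, prof ν₁ q + q ≤ prof ν₀ θ + θ → θ ≤ p → q ≤ p →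
      (prof ν₁ q + q < prof ν₀ p + p ∨ prof ν₁ q + q = prof ν₀ p + p ∧ prof ν₀ p ≤ prof ν₁ q) := by
    intro θ p h1 h2 h3
    have := prof_le_add ν₀ h2
    omega
  by_cases hc : q + 1 ∈ X₀ ∧ q + 2 ∈ X₀
  · rw [if_pos hc, tail_eq X₀ (q + 1), ind_of_mem hc.1, show q + 1 + 1 = q + 2 by ring,
      add_sub_cancel_right]
    have j1 := ind_of_mem hc.1
    have j2 := ind_of_mem hc.2
    unfold tail
    congr 2
    refine Finset.filter_congr fun p hp => ⟨fun h1 => ?_, fun h1 => ?_⟩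
    · by_contra hlt
      rcases lt_or_ge q p with h2 | h2
      · obtain rfl : p = q + 1 := by omega
        have := hh1 j1
        omega
      · exact low p hp h2 h1
    · exact high (q + 2) p (by have := hh1 j1; omega) h1 (by omega)
  · rw [if_neg hc, sub_zero]
    rw [mem_iff_ind, mem_iff_ind] at hc
    unfold tail
    congr 2
    refine Finset.filter_congr fun p hp => ⟨fun h1 => ?_, fun h1 => ?_⟩
    · by_contra hlt
      exact low p hp (by omega) h1
    · exact high (q + 1) p (by omega) h1 (by omega)

/-- The lattice condition in terms of positions implies the stronger one that comes from the reading
order. The two differ when `q + 1` and `q + 2` both belong to `X₀`; then the former condition at the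
first element of `X₁` that follows `q` leaves room for one more. -/
theorem DominoStrip.tail_le_of_dominates {ν₀ ν₁ ν₂ : YoungDiagram} {X₀ X₁ : Finset ℤ}
    (h₀ : DominoStrip ν₀ ν₁ X₀) (h₁ : DominoStrip ν₁ ν₂ X₁) (hd : Dominates X₀ X₁) {q : ℤ}
    (hq : q ∈ X₁) : tail X₁ q ≤ tail X₀ (q + 1) - if q + 1 ∈ X₀ ∧ q + 2 ∈ X₀ then 1 else 0 := by
  obtain ⟨N, hN⟩ := exists_upper_bound X₁
  obtain ⟨n, hn⟩ := Int.le.dest (hN q hq).le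
  induction n generalizing q with
  | zero =>
    have := hN q hq
    omega
  | succ n ih =>
    have hdq := hd q
    split_ifs with hc
    · have t1 := tail_eq X₁ q
      have t2 := tail_eq X₀ (q + 1)
      have t3 := tail_eq X₀ (q + 2)
      have t4 := tail_eq X₁ (q + 1)
      rw [show q + 1 + 1 = q + 2 by ring] at t2 t4
      rw [show q + 2 + 1 = q + 3 by ring] at t3
      have j0 := ind_of_mem hq
      have j1 := ind_of_mem hc.1
      have j2 := ind_of_mem hc.2
      by_cases hq1 : q + 1 ∈ X₁
      · have e1 := h₀.prof_eq (q + 1)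
        have e2 := h₀.prof_eq (q + 2)
        have k1 := h₁.hole _ hq1
        have k2 := h₀.hole _ hc.1
        rw [show q + 1 + 1 = q + 2 by ring] at e1 k1 k2
        rw [show q + 2 + 1 = q + 3 by ring] at e2
        have hq3 : q + 3 ∈ X₀ := mem_iff_ind.2 (by omega)
        have := ih hq1 (by push_cast at hn; omega)
        rw [show q + 1 + 1 = q + 2 by ring, show q + 1 + 2 = q + 3 by ring, if_pos ⟨hc.2, hq3⟩] at this
        omega
      · have := hd (q + 2)
        have j3 := ind_of_not_mem hq1
        rw [show q + 2 + 1 = q + 3 by ring] at this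
        omega
    · omega

theorem IsDomino.exists_corner {d : Finset (ℕ × ℕ)} (h : IsDomino d) :
    ∃ x ∈ d, content x = pos d ∧ d.sup Prod.snd = x.2 ∧ (d.image Prod.fst).min = (x.1 : WithTop ℕ) := by
  obtain ⟨x, y, hd, hx, hy, hxy⟩ := h.exists_eq
  have hx' : x ∈ d := by rw [hd]; exact Finset.mem_insert_self _ _
  refine ⟨x, hx', hx, ?_, ?_⟩
  · rw [hd]
    simp only [content] at hx hy
    simp only [Finset.sup_insert, Finset.sup_singleton]
    exact sup_eq_left.2 (by omega)
  · rw [hd, Finset.image_insert, Finset.image_singleton, Finset.min_insert, Finset.min_singleton]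
    exact min_eq_left (WithTop.coe_le_coe.2 (by omega))

namespace IsSSDT

variable {D : DominoTableau}

/-- The reading order in terms of positions. A domino is read in the column of its square on the
diagonal of larger index, and that square is the first one on this diagonal which is free before the
dominoes with the same entry are added. -/
theorem dominoRead_iff (h : IsSSDT D.shape D) {d e} (hd : d ∈ D.dominoes) (he : e ∈ D.dominoes) :
    DominoRead d.1 e.1 ↔
      (prof (dominoBelow D e.2) (pos e.1) + pos e.1 < prof (dominoBelow D d.2) (pos d.1) + pos d.1 ∨
        prof (dominoBelow D e.2) (pos e.1) + pos e.1 = prof (dominoBelow D d.2) (pos d.1) + pos d.1 ∧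
          prof (dominoBelow D d.2) (pos d.1) ≤ prof (dominoBelow D e.2) (pos e.1)) := by
  have key : ∀ {d}, d ∈ D.dominoes → ∃ x : ℕ × ℕ, d.1.sup Prod.snd = x.2 ∧
      (d.1.image Prod.fst).min = (x.1 : WithTop ℕ) ∧
      (x.1 : ℤ) = prof (dominoBelow D d.2) (pos d.1) ∧
      (x.2 : ℤ) = prof (dominoBelow D d.2) (pos d.1) + pos d.1 := by
    intro d hd
    obtain ⟨x, hx, hxp, h1, h2⟩ := (h.isDomino d hd).exists_corner
    have h3 := h.row_eq_prof hd hx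
    rw [h.prof_stdShape_eq d, hxp, if_neg (lt_irrefl _), if_neg (by omega), add_zero, add_zero] at h3
    simp only [content] at hxp
    exact ⟨x, h1, h2, h3, by omega⟩
  obtain ⟨x, hx1, hx2, hx3, hx4⟩ := key hd
  obtain ⟨y, hy1, hy2, hy3, hy4⟩ := key he
  unfold DominoRead
  have hle : ((x.1 : ℕ) : WithTop ℕ) ≤ ((y.1 : ℕ) : WithTop ℕ) ↔ x.1 ≤ y.1 := WithTop.coe_le_coe
  rw [hx1, hx2, hy1, hy2, hle]
  omega

theorem dominoReadUpTo_eq (h : IsSSDT D.shape D) {e} (he : e ∈ D.dominoes) (k : ℕ) :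
    dominoReadUpTo D e.1 k = ((posSet D k).filter fun p =>
      prof (dominoBelow D e.2) (pos e.1) + pos e.1 < prof (dominoBelow D k) p + p ∨
        prof (dominoBelow D e.2) (pos e.1) + pos e.1 = prof (dominoBelow D k) p + p ∧
          prof (dominoBelow D k) p ≤ prof (dominoBelow D e.2) (pos e.1)).card := by
  rw [← h.card_entry_filter]
  unfold dominoReadUpTo
  congr 1
  ext d
  simp only [Finset.mem_filter]
  refine and_congr_right fun hd => ?_
  rw [h.dominoRead_iff hd he, and_comm]
  constructor
  · rintro ⟨rfl, h1⟩
    exact ⟨rfl, h1⟩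
  · rintro ⟨rfl, h1⟩
    exact ⟨rfl, h1⟩

/-- The Yamanouchi condition holds at all dominoes if it holds, for each entry, at the last domino with this
entry that is read; there it amounts to `Dominates`. -/
theorem mem_yam2_iff (h : IsSSDT D.shape D) :
    D ∈ Yam2 D.shape ↔ ∀ k, Dominates (posSet D k) (posSet D (k + 1)) := by
  constructor
  · rintro ⟨-, hY⟩ k x
    by_cases hne : ((posSet D (k + 1)).filter fun p => x ≤ p).Nonempty
    · have hq := Finset.min'_mem _ hne
      obtain ⟨q, hq0⟩ : ∃ q, q = Finset.min' _ hne := ⟨_, rfl⟩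
      rw [← hq0, Finset.mem_filter] at hq
      obtain ⟨hq1, hq2⟩ := hq
      have e1 : tail (posSet D (k + 1)) x = tail (posSet D (k + 1)) q := by
        unfold tail
        congr 2
        refine Finset.filter_congr fun p hp => ⟨fun h1 => ?_, fun h1 => by omega⟩
        rw [hq0]
        exact Finset.min'_le _ _ (Finset.mem_filter.2 ⟨hp, h1⟩)
      obtain ⟨e, he, hek, rfl⟩ := mem_posSet.1 hq1
      have h1 := hY e he k
      rw [h.dominoReadUpTo_eq he, h.dominoReadUpTo_eq he, hek] at h1
      have h2 := (h.dominoStrip (k + 1)).card_read_same (pos e.1)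
      have h3 := (h.dominoStrip k).card_read_prev (h.dominoStrip (k + 1)) hq1
      have h4 := tail_antitone (posSet D k) (show x + 1 ≤ pos e.1 + 1 by omega)
      split_ifs at h3 <;> omega
    · rw [Finset.not_nonempty_iff_eq_empty] at hne
      have : tail (posSet D (k + 1)) x = 0 := by simp [tail, hne]
      rw [this]
      exact tail_nonneg _ _
  · intro hD
    refine ⟨h, fun e he k => ?_⟩
    rw [h.dominoReadUpTo_eq he, h.dominoReadUpTo_eq he]
    obtain ⟨a, ha⟩ : ∃ a, a = prof (dominoBelow D e.2) (pos e.1) + pos e.1 := ⟨_, rfl⟩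
    obtain ⟨b, hb⟩ : ∃ b, b = prof (dominoBelow D e.2) (pos e.1) := ⟨_, rfl⟩
    rw [← ha, ← hb]
    rcases Finset.eq_empty_or_nonempty ((posSet D (k + 1)).filter fun p =>
        a < prof (dominoBelow D (k + 1)) p + p ∨ a = prof (dominoBelow D (k + 1)) p + p ∧
          prof (dominoBelow D (k + 1)) p ≤ b) with hne | hne
    · rw [hne]
      simp
    · have hq := Finset.min'_mem _ hne
      obtain ⟨q, hq0⟩ : ∃ q, q = Finset.min' _ hne := ⟨_, rfl⟩
      rw [← hq0, Finset.mem_filter] at hq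
      obtain ⟨hq1, hq2⟩ := hq
      have h1 : (((posSet D (k + 1)).filter fun p =>
          a < prof (dominoBelow D (k + 1)) p + p ∨ a = prof (dominoBelow D (k + 1)) p + p ∧
          prof (dominoBelow D (k + 1)) p ≤ b).card : ℤ) ≤ tail (posSet D (k + 1)) q := by
        unfold tail
        refine Nat.cast_le.2 (Finset.card_le_card fun p hp => ?_)
        rw [Finset.mem_filter]
        refine ⟨(Finset.mem_filter.1 hp).1, ?_⟩
        rw [hq0]
        exact Finset.min'_le _ _ hp
      have h2 := (h.dominoStrip k).tail_le_of_dominates (h.dominoStrip (k + 1)) (hD k) hq1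
      rw [← (h.dominoStrip k).card_read_prev (h.dominoStrip (k + 1)) hq1] at h2
      have h3 := h1.trans h2
      rw [Nat.cast_le] at h3
      refine h3.trans (Finset.card_le_card fun p hp => ?_)
      rw [Finset.mem_filter] at hp ⊢
      exact ⟨hp.1, by omega⟩

end IsSSDT

/-! ### Moving open chains preserves the Yamanouchi condition -/

/-- A crossing of two consecutive strips at `f`: the first strip has a domino in position `f + 1` only
and the second one a domino in position `f` only (among the positions `f` and `f + 1`), and the two
strips have equally many dominoes to the right. Exchanging the positions of these two dominoes would
violate the lattice condition. -/
def IsCrossing (X₀ X₁ : Finset ℤ) (f : ℤ) : Prop :=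
  ind X₀ f = 0 ∧ ind X₀ (f + 1) = 1 ∧ ind X₁ f = 1 ∧ ind X₁ (f + 1) = 0 ∧
    tail X₁ (f + 2) = tail X₀ (f + 2)

theorem Dominates.tail_le {X₀ X₁ : Finset ℤ} (h : Dominates X₀ X₁) (x : ℤ) : tail X₁ x ≤ tail X₀ x :=
  (h x).trans (tail_antitone X₀ (by omega))

theorem tail_eq_two (X : Finset ℤ) (x : ℤ) : tail X x = tail X (x + 2) + ind X x + ind X (x + 1) := by
  have h1 := tail_eq X x
  have h2 := tail_eq X (x + 1)
  rw [show x + 1 + 1 = x + 2 by ring] at h2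
  omega

/-- The row of the variable square on the diagonal `f - 1` for a domino of a strip whose fixed square is on
the diagonal `f`, if this domino is the first of the strip to meet that diagonal. -/
def leftRow (ν : YoungDiagram) (X : Finset ℤ) (f : ℤ) : ℤ :=
  (prof ν (f - 2) + ind X (f - 2) + ind X (f - 1) + prof ν f) / 2

section crossing

variable {ν₀ ν₁ ν₂ : YoungDiagram} {X₀ X₁ : Finset ℤ}

theorem DominoStrip.bead_of_mem (h : DominoStrip ν₀ ν₁ X₀) (y : ℤ) :
    prof ν₀ y - prof ν₀ (y + 1) + ind X₀ y - ind X₀ (y + 2) = prof ν₁ y - prof ν₁ (y + 1) := by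
  have h1 := h.prof_eq y
  have h2 := h.prof_eq (y + 1)
  rw [show y + 1 + 1 = y + 2 by ring] at h2
  omega

theorem DominoStrip.hole_of_ind (h : DominoStrip ν₀ ν₁ X₀) (y : ℤ) (hy : ind X₀ y = 1) :
    prof ν₀ y = prof ν₀ (y + 1) := h.hole y (mem_iff_ind.2 hy)

/-- To the right of a crossing at `f` there are two possibilities. Either the variable squares on the
diagonal `f + 1` of its two dominoes (one of them before, the other after moving) coincide, or there is
another crossing at `f + 2`, and for each strip the squares on this diagonal of its dominoes in the two
crossings coincide. -/
theorem IsCrossing.right (h₀ : DominoStrip ν₀ ν₁ X₀) (h₁ : DominoStrip ν₁ ν₂ X₁)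
    (hd : Dominates X₀ X₁) {f : ℤ} (hf : IsCrossing X₀ X₁ f) :
    (prof ν₀ f + prof ν₀ (f + 2)) / 2 = (prof ν₁ f + prof ν₁ (f + 2)) / 2 ∨
      IsCrossing X₀ X₁ (f + 2) ∧
      (prof ν₀ f + prof ν₀ (f + 2)) / 2 = leftRow ν₀ X₀ (f + 2) ∧
      (prof ν₁ f + prof ν₁ (f + 2)) / 2 = leftRow ν₁ X₁ (f + 2) := by
  obtain ⟨c1, c2, c3, c4, c5⟩ := hf
  have d2 := hd (f + 2)
  have t2 := tail_eq X₀ (f + 2)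
  have t2' := tail_eq_two X₀ (f + 2)
  have t3' := tail_eq_two X₁ (f + 2)
  have d4 := hd.tail_le (f + 4)
  have b0 := h₀.bead_of_mem f
  have b1 := h₀.bead_of_mem (f + 1)
  have b2 := h₁.bead_of_mem (f + 1)
  have k0 := h₀.hole_of_ind _ c2
  have k1 := h₁.hole_of_ind _ c3
  have e0 := h₀.prof_eq f
  have e2 := h₀.prof_eq (f + 2)
  have s1 := prof_le_succ ν₁ (f + 1)
  have s2 := prof_succ_le ν₁ (f + 1)
  have s3 := prof_succ_le ν₂ (f + 1)
  unfold IsCrossing leftRow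
  rw [show f + 2 - 2 = f by ring, show f + 2 - 1 = f + 1 by ring, show f + 2 + 2 = f + 4 by ring]
  simp only [add_assoc, show (1 : ℤ) + 1 = 2 by rfl, show (2 : ℤ) + 2 = 4 by rfl,
    show (2 : ℤ) + 1 = 3 by rfl, show (1 : ℤ) + 2 = 3 by rfl] at *
  have i1 := ind_nonneg X₀ (f + 2)
  have i2 := ind_nonneg X₀ (f + 3)
  have i3 := ind_nonneg X₁ (f + 2)
  have i4 := ind_nonneg X₁ (f + 3)
  have i5 := ind_le_one X₁ (f + 2)
  have i6 := ind_le_one X₁ (f + 3)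
  have i7 := ind_le_one X₀ (f + 3)
  have g0 : prof ν₀ f = prof ν₀ (f + 2) := by omega
  rcases (show ind X₀ (f + 3) = 0 ∨ ind X₀ (f + 3) = 1 by omega) with hc | hc
  · left
    omega
  · right
    omega

/-- The counterpart of `IsCrossing.right` for the diagonal `f - 1`. -/
theorem IsCrossing.left (h₀ : DominoStrip ν₀ ν₁ X₀) (h₁ : DominoStrip ν₁ ν₂ X₁)
    (hd : Dominates X₀ X₁) {f : ℤ} (hf : IsCrossing X₀ X₁ f) :
    leftRow ν₀ X₀ f = leftRow ν₁ X₁ f ∨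
      IsCrossing X₀ X₁ (f - 2) ∧
      (prof ν₀ (f - 2) + prof ν₀ f) / 2 = leftRow ν₀ X₀ f ∧
      (prof ν₁ (f - 2) + prof ν₁ f) / 2 = leftRow ν₁ X₁ f := by
  have hf' := hf
  obtain ⟨c1, c2, c3, c4, c5⟩ := hf
  have dm1 := hd (f - 1)
  have tm1 := tail_eq X₁ (f - 1)
  have t0 := tail_eq_two X₀ f
  have t1 := tail_eq_two X₁ f
  have t2 := tail_eq_two X₀ (f - 2)
  have t3 := tail_eq_two X₁ (f - 2)
  have dm2 := hd.tail_le (f - 2)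
  have b0 := h₀.bead_of_mem (f - 2)
  have b1 := h₀.bead_of_mem (f - 1)
  have b2 := h₁.bead_of_mem (f - 2)
  have b3 := h₁.bead_of_mem (f - 1)
  have e0 := h₀.prof_eq f
  have em2 := h₀.prof_eq (f - 2)
  have s1 := prof_le_succ ν₁ (f - 1)
  have s2 := prof_succ_le ν₁ (f - 1)
  have s3 := prof_succ_le ν₂ (f - 1)
  have s4 := prof_succ_le ν₂ (f - 2)
  have s5 := prof_le_succ ν₁ (f - 2)
  have s6 := prof_succ_le ν₁ (f - 2)
  have k0 := h₀.hole_of_ind (f - 2)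
  have k1 := h₀.hole_of_ind (f - 1)
  have k2 := h₁.hole_of_ind (f - 2)
  have u1 := prof_le_succ ν₀ (f - 1)
  have u2 := prof_le_succ ν₀ (f - 2)
  have u3 := prof_succ_le ν₀ (f - 1)
  have u4 := prof_succ_le ν₀ (f - 2)
  unfold IsCrossing leftRow
  simp only [sub_add_cancel, show f - 2 + 1 = f - 1 by ring, show f - 1 + 2 = f + 1 by ring] at *
  have i1 := ind_nonneg X₀ (f - 2)
  have i2 := ind_nonneg X₀ (f - 1)
  have i3 := ind_nonneg X₁ (f - 2)
  have i4 := ind_nonneg X₁ (f - 1)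
  have i5 := ind_le_one X₁ (f - 2)
  have i6 := ind_le_one X₁ (f - 1)
  have i7 := ind_le_one X₀ (f - 1)
  have i8 := ind_le_one X₀ (f - 2)
  have g0 : ind X₁ (f - 1) = 0 := by omega
  rcases (show ind X₁ (f - 2) = 0 ∨ ind X₁ (f - 2) = 1 by omega) with hc | hc
  · left
    omega
  · right
    have g1 := k2 hc
    have g2 : ind X₀ (f - 2) = 0 := by
      rcases (show ind X₀ (f - 2) = 0 ∨ ind X₀ (f - 2) = 1 by omega) with h | h
      · exact h
      · have := k0 h
        omega
    omega

/-- The lattice condition excludes a single domino of the first strip that faces two of the second, when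
this makes the numbers of dominoes to the right equal. -/
theorem Dominates.not_one_two (h₀ : DominoStrip ν₀ ν₁ X₀) (h₁ : DominoStrip ν₁ ν₂ X₁)
    (hd : Dominates X₀ X₁) {f : ℤ} (h : tail X₀ (f + 2) = tail X₁ (f + 2) + 1)
    (hn : ind X₀ f + ind X₀ (f + 1) = 1) (h2 : ind X₁ f = 1) (h3 : ind X₁ (f + 1) = 1) : False := by
  have df := hd f
  have dm := hd (f - 1)
  have t0 := tail_eq_two X₀ f
  have t1 := tail_eq_two X₁ f
  have t2 := tail_eq X₀ f
  have t3 := tail_eq X₁ (f - 1)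
  have b1 := h₀.bead_of_mem (f - 1)
  have b3 := h₁.bead_of_mem (f - 1)
  have k1 := h₀.hole_of_ind (f - 1)
  have s1 := prof_succ_le ν₂ (f - 1)
  have s2 := prof_le_succ ν₀ (f - 1)
  have i1 := ind_nonneg X₀ (f - 1)
  have i2 := ind_le_one X₀ (f - 1)
  have i3 := ind_nonneg X₁ (f - 1)
  simp only [sub_add_cancel, show f - 1 + 2 = f + 1 by ring] at *
  rcases (show ind X₀ (f - 1) = 0 ∨ ind X₀ (f - 1) = 1 by omega) with hc | hc
  · omega
  · have := k1 hc
    omega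

/-- The lattice condition excludes two dominoes of the first strip that face a single one of the second,
when the numbers of dominoes to the right are equal. -/
theorem Dominates.not_two_one (h₀ : DominoStrip ν₀ ν₁ X₀) (h₁ : DominoStrip ν₁ ν₂ X₁)
    (hd : Dominates X₀ X₁) {f : ℤ} (h : tail X₀ (f + 2) = tail X₁ (f + 2))
    (h2 : ind X₀ f = 1) (hn : ind X₁ f + ind X₁ (f + 1) = 1) : False := by
  have d1 := hd (f + 1)
  have d2 := hd (f + 2)
  have t1 := tail_eq X₁ (f + 1)
  have t2 := tail_eq X₀ (f + 2)
  have b0 := h₀.bead_of_mem f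
  have k0 := h₀.hole_of_ind f h2
  have k1 := h₁.hole_of_ind f
  have i1 := ind_nonneg X₁ (f + 1)
  simp only [add_assoc, show (1 : ℤ) + 1 = 2 by rfl] at *
  have := k1 (by omega)
  omega

end crossing

namespace IsSSDT

variable {D : DominoTableau} {i : Fin 2}

theorem fixedDiag_of_not_isVar {f p : ℤ} (hf : ¬ IsVar i f) (hp : p = f ∨ p = f + 1) :
    fixedDiag i p = f := by
  have h1 := not_isVar_fixedDiag i p
  have h2 := isVar_succ_iff i f
  have h3 := isVar_pred_iff i f
  rcases pos_cases i p with h | h <;> rcases hp with hp | hp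
  · omega
  · exact absurd (h2.2 hf) (by rwa [show f + 1 = fixedDiag i p by omega])
  · exact absurd (h3.2 hf) (by rwa [show f - 1 = fixedDiag i p by omega])
  · omega

/-- The squares of a domino in position `f + 1`, before and after moving. -/
theorem squares_right (h : IsSSDT D.shape D) {f : ℤ} (hf : ¬ IsVar i f) {d} (hd : d ∈ D.dominoes)
    (hp : pos d.1 = f + 1) (x : ℕ × ℕ) :
    (x ∈ d.1 ↔ (content x = f ∧ (x.1 : ℤ) = prof (stdShape D d) f) ∨
      (content x = f + 1 ∧ (x.1 : ℤ) =
        (prof (dominoBelow D d.2) f + ind (posSet D d.2) f + prof (dominoBelow D d.2) (f + 2)) / 2)) ∧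
    (x ∈ moved i D d ↔ (content x = f ∧ (x.1 : ℤ) = prof (stdShape D d) f) ∨
      (content x = f - 1 ∧ (x.1 : ℤ) =
        (prof (dominoBelow D d.2) (f - 2) + ind (posSet D d.2) (f - 2) + ind (posSet D d.2) (f - 1) +
          (prof (dominoBelow D d.2) f + ind (posSet D d.2) f)) / 2)) := by
  have hfix := fixedDiag_of_not_isVar hf (Or.inr hp)
  have e0 := h.prof_stdShape_eq d f
  have e2 := h.prof_stdShape_eq d (f + 2)
  have em := h.prof_stdShape_eq d (f - 2)
  rw [hp, if_pos (by omega), if_neg (by omega), add_zero] at e0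
  rw [hp, if_neg (by omega), if_neg (by omega), add_zero, add_zero] at e2
  rw [hp, if_pos (by omega), if_pos (by omega), show f - 2 + 1 = f - 1 by ring] at em
  rw [h.mem_iff_inPlace i hd, h.mem_moved_iff i hd]
  unfold InPlace midRow
  rw [fixedDiag_otherPos, hfix]
  rcases pos_cases i (pos d.1) with h1 | ⟨-, h2, -, h4⟩
  · omega
  · rw [h4, h2, hfix, add_sub_cancel_right, sub_add_cancel, show f + 1 + 1 = f + 2 by ring,
      show f - 1 - 1 = f - 2 by ring, e0, e2, em]
    exact ⟨Iff.rfl, Iff.rfl⟩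

/-- The squares of a domino in position `f`, before and after moving. -/
theorem squares_left (h : IsSSDT D.shape D) {f : ℤ} (hf : ¬ IsVar i f) {d} (hd : d ∈ D.dominoes)
    (hp : pos d.1 = f) (x : ℕ × ℕ) :
    (x ∈ d.1 ↔ (content x = f ∧ (x.1 : ℤ) = prof (stdShape D d) f) ∨
      (content x = f - 1 ∧ (x.1 : ℤ) = leftRow (dominoBelow D d.2) (posSet D d.2) f)) ∧
    (x ∈ moved i D d ↔ (content x = f ∧ (x.1 : ℤ) = prof (stdShape D d) f) ∨
      (content x = f + 1 ∧ (x.1 : ℤ) =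
        (prof (dominoBelow D d.2) f + prof (dominoBelow D d.2) (f + 2)) / 2)) := by
  have hfix := fixedDiag_of_not_isVar hf (Or.inl hp)
  have e0 := h.prof_stdShape_eq d f
  have e2 := h.prof_stdShape_eq d (f + 2)
  have em := h.prof_stdShape_eq d (f - 2)
  rw [hp, if_neg (by omega), if_neg (by omega), add_zero, add_zero] at e0
  rw [hp, if_neg (by omega), if_neg (by omega), add_zero, add_zero] at e2
  rw [hp, if_pos (by omega), if_pos (by omega), show f - 2 + 1 = f - 1 by ring] at em
  rw [h.mem_iff_inPlace i hd, h.mem_moved_iff i hd]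
  unfold InPlace midRow leftRow
  rw [fixedDiag_otherPos, hfix]
  rcases pos_cases i (pos d.1) with ⟨-, h2, -, h4⟩ | h1
  · rw [h4, h2, hfix, add_sub_cancel_right, sub_add_cancel, show f + 1 + 1 = f + 2 by ring,
      show f - 1 - 1 = f - 2 by ring, e0, e2, em]
    exact ⟨Iff.rfl, Iff.rfl⟩
  · omega

/-- In a Yamanouchi domino tableau the dominoes of crossings lie in closed chains: neighbouring crossings
are linked to each other, and the two dominoes of a crossing to each other at both ends of
a series of consecutive crossings. -/
theorem not_isOpenChain_of_isCrossing (h : IsSSDT D.shape D) {k : ℕ}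
    (hd : Dominates (posSet D k) (posSet D (k + 1))) {f : ℤ} (hf : ¬ IsVar i f)
    (hc : IsCrossing (posSet D k) (posSet D (k + 1)) f) {d} (hdD : d ∈ D.dominoes)
    (hdp : (d.2 = k ∧ pos d.1 = f + 1) ∨ (d.2 = k + 1 ∧ pos d.1 = f)) : ¬ IsOpenChain i D d := by
  classical
  obtain ⟨Z, hZ⟩ : ∃ Z, Z = D.dominoes.filter fun d => ∃ f, ¬ IsVar i f ∧
      IsCrossing (posSet D k) (posSet D (k + 1)) f ∧
      ((d.2 = k ∧ pos d.1 = f + 1) ∨ (d.2 = k + 1 ∧ pos d.1 = f)) := ⟨_, rfl⟩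
  have h₀ := h.dominoStrip k
  have h₁ := h.dominoStrip (k + 1)
  -- the two dominoes of a crossing, with their squares before and after moving
  have first : ∀ {f}, ¬ IsVar i f → IsCrossing (posSet D k) (posSet D (k + 1)) f → ∀ {d},
      d ∈ D.dominoes → d.2 = k → pos d.1 = f + 1 → ∀ x : ℕ × ℕ,
      (x ∈ d.1 ↔ (content x = f ∧ (x.1 : ℤ) = prof (stdShape D d) f) ∨ (content x = f + 1 ∧ (x.1 : ℤ) =
        (prof (dominoBelow D k) f + prof (dominoBelow D k) (f + 2)) / 2)) ∧
      (x ∈ moved i D d ↔ (content x = f ∧ (x.1 : ℤ) = prof (stdShape D d) f) ∨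
        (content x = f - 1 ∧ (x.1 : ℤ) = leftRow (dominoBelow D k) (posSet D k) f)) := by
    intro f hf hc d hd hk hp x
    have := h.squares_right hf hd hp x
    rwa [hk, hc.1, add_zero] at this
  have second : ∀ {f}, ¬ IsVar i f → ∀ {d}, d ∈ D.dominoes → d.2 = k + 1 → pos d.1 = f → ∀ x : ℕ × ℕ,
      (x ∈ d.1 ↔ (content x = f ∧ (x.1 : ℤ) = prof (stdShape D d) f) ∨ (content x = f - 1 ∧ (x.1 : ℤ) =
        leftRow (dominoBelow D (k + 1)) (posSet D (k + 1)) f)) ∧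
      (x ∈ moved i D d ↔ (content x = f ∧ (x.1 : ℤ) = prof (stdShape D d) f) ∨
        (content x = f + 1 ∧ (x.1 : ℤ) =
          (prof (dominoBelow D (k + 1)) f + prof (dominoBelow D (k + 1)) (f + 2)) / 2)) := by
    intro f hf d hd hk hp x
    have := h.squares_left hf hd hp x
    rwa [hk] at this
  have ex₀ : ∀ {f}, ¬ IsVar i f → IsCrossing (posSet D k) (posSet D (k + 1)) f →
      ∃ d ∈ Z, d ∈ D.dominoes ∧ d.2 = k ∧ pos d.1 = f + 1 := by
    intro f hf hc
    obtain ⟨d, hd, hk, hp⟩ := mem_posSet.1 (mem_iff_ind.2 hc.2.1)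
    exact ⟨d, hZ ▸ Finset.mem_filter.2 ⟨hd, f, hf, hc, Or.inl ⟨hk, hp⟩⟩, hd, hk, hp⟩
  have ex₁ : ∀ {f}, ¬ IsVar i f → IsCrossing (posSet D k) (posSet D (k + 1)) f →
      ∃ d ∈ Z, d ∈ D.dominoes ∧ d.2 = k + 1 ∧ pos d.1 = f := by
    intro f hf hc
    obtain ⟨d, hd, hk, hp⟩ := mem_posSet.1 (mem_iff_ind.2 hc.2.2.1)
    exact ⟨d, hZ ▸ Finset.mem_filter.2 ⟨hd, f, hf, hc, Or.inr ⟨hk, hp⟩⟩, hd, hk, hp⟩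
  refine h.not_isOpenChain_of_closed (Z := Z) (hZ ▸ Finset.filter_subset _ _) (fun x => ?_)
    (hZ ▸ Finset.mem_filter.2 ⟨hdD, f, hf, hc, hdp⟩)
  constructor
  · rintro ⟨z, hz, hx⟩
    have hz' := hz
    rw [hZ, Finset.mem_filter] at hz'
    obtain ⟨hzD, f, hf, hc, ⟨hk, hp⟩ | ⟨hk, hp⟩⟩ := hz'
    · rcases ((first hf hc hzD hk hp x).2).1 hx with hx | ⟨hx1, hx2⟩
      · exact ⟨z, hz, ((first hf hc hzD hk hp x).1).2 (Or.inl hx)⟩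
      · rcases hc.left h₀ h₁ hd with e | ⟨hc', e, -⟩
        · obtain ⟨w, hw, hwD, hwk, hwp⟩ := ex₁ hf hc
          exact ⟨w, hw, ((second hf hwD hwk hwp x).1).2 (Or.inr ⟨hx1, hx2.trans e⟩)⟩
        · have hf' : ¬ IsVar i (f - 2) := by rwa [isVar_sub_two_iff]
          obtain ⟨w, hw, hwD, hwk, hwp⟩ := ex₀ hf' hc'
          refine ⟨w, hw, ((first hf' hc' hwD hwk hwp x).1).2 (Or.inr ⟨by omega, ?_⟩)⟩
          rw [sub_add_cancel]
          exact hx2.trans e.symm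
    · rcases ((second hf hzD hk hp x).2).1 hx with hx | ⟨hx1, hx2⟩
      · exact ⟨z, hz, ((second hf hzD hk hp x).1).2 (Or.inl hx)⟩
      · rcases hc.right h₀ h₁ hd with e | ⟨hc', -, e⟩
        · obtain ⟨w, hw, hwD, hwk, hwp⟩ := ex₀ hf hc
          exact ⟨w, hw, ((first hf hc hwD hwk hwp x).1).2 (Or.inr ⟨hx1, hx2.trans e.symm⟩)⟩
        · have hf' : ¬ IsVar i (f + 2) := by rwa [isVar_add_two_iff]
          obtain ⟨w, hw, hwD, hwk, hwp⟩ := ex₁ hf' hc'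
          exact ⟨w, hw, ((second hf' hwD hwk hwp x).1).2 (Or.inr ⟨by omega, hx2.trans e⟩)⟩
  · rintro ⟨z, hz, hx⟩
    have hz' := hz
    rw [hZ, Finset.mem_filter] at hz'
    obtain ⟨hzD, f, hf, hc, ⟨hk, hp⟩ | ⟨hk, hp⟩⟩ := hz'
    · rcases ((first hf hc hzD hk hp x).1).1 hx with hx | ⟨hx1, hx2⟩
      · exact ⟨z, hz, ((first hf hc hzD hk hp x).2).2 (Or.inl hx)⟩
      · rcases hc.right h₀ h₁ hd with e | ⟨hc', e, -⟩
        · obtain ⟨w, hw, hwD, hwk, hwp⟩ := ex₁ hf hc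
          exact ⟨w, hw, ((second hf hwD hwk hwp x).2).2 (Or.inr ⟨hx1, hx2.trans e⟩)⟩
        · have hf' : ¬ IsVar i (f + 2) := by rwa [isVar_add_two_iff]
          obtain ⟨w, hw, hwD, hwk, hwp⟩ := ex₀ hf' hc'
          exact ⟨w, hw, ((first hf' hc' hwD hwk hwp x).2).2 (Or.inr ⟨by omega, hx2.trans e⟩)⟩
    · rcases ((second hf hzD hk hp x).1).1 hx with hx | ⟨hx1, hx2⟩
      · exact ⟨z, hz, ((second hf hzD hk hp x).2).2 (Or.inl hx)⟩
      · rcases hc.left h₀ h₁ hd with e | ⟨hc', -, e⟩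
        · obtain ⟨w, hw, hwD, hwk, hwp⟩ := ex₀ hf hc
          exact ⟨w, hw, ((first hf hc hwD hwk hwp x).2).2 (Or.inr ⟨hx1, hx2.trans e.symm⟩)⟩
        · have hf' : ¬ IsVar i (f - 2) := by rwa [isVar_sub_two_iff]
          obtain ⟨w, hw, hwD, hwk, hwp⟩ := ex₁ hf' hc'
          refine ⟨w, hw, ((second hf' hwD hwk hwp x).2).2 (Or.inr ⟨by omega, ?_⟩)⟩
          rw [sub_add_cancel]
          exact hx2.trans e.symm

/-- Moving a domino does not change the fixed diagonal `f` that it meets, and its position is `f` or `f + 1`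
both before and after. So the number of positions from a fixed diagonal onwards is invariant. -/
theorem tail_posSet_moveOpen (h : IsSSDT D.shape D) (k : ℕ) {f : ℤ} (hf : ¬ IsVar i f) :
    tail (posSet (DominoLR.moveOpen i D) k) f = tail (posSet D k) f := by
  unfold tail
  rw [← h.card_entry_filter k (fun p => f ≤ p),
    ← (h.moveOpen_self i).card_entry_filter k (fun p => f ≤ p)]
  have hle : ∀ d ∈ D.dominoes, (f ≤ pos (newDom i D d).1 ↔ f ≤ pos d.1) := by
    intro d hd
    rw [(h.isDomino_newDom i hd).2]
    have h1 := pos_cases i (pos d.1)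
    have h2 := pos_cases i (newPos i D d)
    rw [fixedDiag_newPos] at h2
    have h3 : f ≠ fixedDiag i (pos d.1) + 1 := by
      rintro rfl
      rw [isVar_succ_iff] at hf
      exact hf (not_isVar_fixedDiag _ _)
    omega
  congr 1
  symm
  refine Finset.card_nbij (newDom i D) (fun d hd => ?_) (fun d hd e he hde => ?_) (fun d' hd' => ?_)
  · rw [Finset.mem_coe, Finset.mem_filter] at hd ⊢
    exact ⟨mem_moveOpen.2 ⟨d, hd.1, rfl⟩, by rw [newDom_snd]; exact hd.2.1, (hle d hd.1).2 hd.2.2⟩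
  · rw [Finset.mem_coe, Finset.mem_filter] at hd he
    exact h.newDom_injOn hd.1 he.1 hde
  · rw [Finset.mem_coe, Finset.mem_filter] at hd'
    obtain ⟨d, hd, rfl⟩ := mem_moveOpen.1 hd'.1
    refine ⟨d, ?_, rfl⟩
    rw [Finset.mem_coe, Finset.mem_filter]
    exact ⟨hd, by rw [← newDom_snd i D d]; exact hd'.2.1, (hle d hd).1 hd'.2.2⟩

/-- The numbers of positions are invariant at fixed diagonals, so the condition is in danger only where
dominoes of the two strips that meet the same fixed diagonal `f` get into the wrong order. Configurations
where this might happen are either excluded by the condition itself or crossings. -/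
theorem dominates_moveOpen (h : IsSSDT D.shape D) (i : Fin 2) {k : ℕ}
    (hd : Dominates (posSet D k) (posSet D (k + 1))) :
    Dominates (posSet (DominoLR.moveOpen i D) k) (posSet (DominoLR.moveOpen i D) (k + 1)) := by
  have h₀ := h.dominoStrip k
  have h₁ := h.dominoStrip (k + 1)
  have key : ∀ f, ¬ IsVar i f →
      tail (posSet (DominoLR.moveOpen i D) (k + 1)) f ≤ tail (posSet (DominoLR.moveOpen i D) k) (f + 1) ∧
      tail (posSet (DominoLR.moveOpen i D) (k + 1)) (f + 1) ≤
        tail (posSet (DominoLR.moveOpen i D) k) (f + 1 + 1) := by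
    intro f hf
    obtain ⟨X₀', hX₀'⟩ : ∃ X, X = posSet (DominoLR.moveOpen i D) k := ⟨_, rfl⟩
    obtain ⟨X₁', hX₁'⟩ : ∃ X, X = posSet (DominoLR.moveOpen i D) (k + 1) := ⟨_, rfl⟩
    have hf2 : ¬ IsVar i (f + 2) := by rwa [isVar_add_two_iff]
    have a1 := h.tail_posSet_moveOpen k hf
    have a2 := h.tail_posSet_moveOpen k hf2
    have a3 := h.tail_posSet_moveOpen (k + 1) hf
    have a4 := h.tail_posSet_moveOpen (k + 1) hf2
    have hcr : IsCrossing (posSet D k) (posSet D (k + 1)) f →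
        ind X₀' (f + 1) = 1 ∧ ind X₁' f = 1 := by
      intro hc
      obtain ⟨d, hdD, hdk, hdp⟩ := mem_posSet.1 (mem_iff_ind.2 hc.2.1)
      obtain ⟨e, heD, hek, hep⟩ := mem_posSet.1 (mem_iff_ind.2 hc.2.2.1)
      have n1 := h.not_isOpenChain_of_isCrossing hd hf hc hdD (Or.inl ⟨hdk, hdp⟩)
      have n2 := h.not_isOpenChain_of_isCrossing hd hf hc heD (Or.inr ⟨hek, hep⟩)
      rw [hX₀', hX₁', ← mem_iff_ind, ← mem_iff_ind, mem_posSet, mem_posSet]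
      exact ⟨⟨d, mem_moveOpen.2 ⟨d, hdD, newDom_of_not_open n1⟩, hdk, hdp⟩,
        ⟨e, mem_moveOpen.2 ⟨e, heD, newDom_of_not_open n2⟩, hek, hep⟩⟩
    rw [← hX₀'] at a1 a2 ⊢
    rw [← hX₁'] at a3 a4 ⊢
    clear hX₀' hX₁'
    have t0 := tail_eq_two X₀' f
    have t1 := tail_eq_two X₁' f
    have t2 := tail_eq_two (posSet D k) f
    have t3 := tail_eq_two (posSet D (k + 1)) f
    have t4 := tail_eq X₀' f
    have t5 := tail_eq X₁' (f + 1)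
    have t6 := tail_eq (posSet D k) f
    have t7 := tail_eq (posSet D (k + 1)) (f + 1)
    have d0 := hd f
    have d1 := hd (f + 1)
    have d2 := hd.tail_le f
    have d3 := hd.tail_le (f + 2)
    have n12 := hd.not_one_two h₀ h₁ (f := f)
    have n21 := hd.not_two_one h₀ h₁ (f := f)
    unfold IsCrossing at hcr
    have e : f + 1 + 1 = f + 2 := by ring
    rw [e] at d1 t5 t7 ⊢
    have i1 := ind_nonneg X₀' f
    have i2 := ind_nonneg X₀' (f + 1)
    have i3 := ind_nonneg X₁' f
    have i4 := ind_nonneg X₁' (f + 1)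
    have i1' := ind_le_one X₀' f
    have i2' := ind_le_one X₀' (f + 1)
    have i3' := ind_le_one X₁' f
    have i4' := ind_le_one X₁' (f + 1)
    have j1 := ind_nonneg (posSet D k) f
    have j2 := ind_nonneg (posSet D k) (f + 1)
    have j3 := ind_nonneg (posSet D (k + 1)) f
    have j4 := ind_nonneg (posSet D (k + 1)) (f + 1)
    have j1' := ind_le_one (posSet D k) f
    have j2' := ind_le_one (posSet D k) (f + 1)
    have j3' := ind_le_one (posSet D (k + 1)) f
    have j4' := ind_le_one (posSet D (k + 1)) (f + 1)
    constructor
    · by_contra hlt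
      rcases (show ind (posSet D (k + 1)) f + ind (posSet D (k + 1)) (f + 1) ≤ 1 ∨
        (ind (posSet D (k + 1)) f = 1 ∧ ind (posSet D (k + 1)) (f + 1) = 1) by omega) with hn | ⟨hn, hn'⟩
      · have := hcr ⟨by omega, by omega, by omega, by omega, by omega⟩
        omega
      · exact n12 (by omega) (by omega) hn hn'
    · by_contra hlt
      rcases (show ind (posSet D k) f = 0 ∨ ind (posSet D k) f = 1 by omega) with hn | hn
      · have := hcr ⟨by omega, by omega, by omega, by omega, by omega⟩
        omega
      · exact n21 (by omega) hn (by omega)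
  intro x
  by_cases hx : IsVar i x
  · have hx' : ¬ IsVar i (x - 1) := by rw [isVar_pred_iff]; exact not_not.2 hx
    have := (key (x - 1) hx').2
    rwa [sub_add_cancel] at this
  · exact (key x hx).1

theorem moveOpen_mem_yam2 (h : IsSSDT D.shape D) (i : Fin 2) (hY : D ∈ Yam2 D.shape) :
    DominoLR.moveOpen i D ∈ Yam2 (DominoLR.moveOpen i D).shape :=
  (h.moveOpen_self i).mem_yam2_iff.2 fun k => h.dominates_moveOpen i (h.mem_yam2_iff.1 hY k)

end IsSSDT

/-! ### Semistandard tableaux as sequences of horizontal strips -/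

/-- `ν'` is obtained from `ν` by adding a horizontal strip with one square on each diagonal in `Y`. -/
structure CellStrip (ν ν' : YoungDiagram) (Y : Finset ℤ) : Prop where
  prof_eq : ∀ c, prof ν' c = prof ν c + ind Y c
  hole : ∀ q ∈ Y, prof ν q = prof ν (q + 1)

/-- The diagonals of the squares with entry `k`. -/
def entrySet (χ : SkewShape) (T : Filling) (k : ℕ) : Finset ℤ :=
  (χ.cells.filter fun x => T x = k).image content

theorem mem_entrySet {χ : SkewShape} {T : Filling} {k : ℕ} {q : ℤ} :
    q ∈ entrySet χ T k ↔ ∃ x ∈ χ.cells, T x = k ∧ content x = q := by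
  simp [entrySet, and_assoc]

section Filling

variable {χ : SkewShape} {T : Filling}

theorem mem_fillingBelow (hT : T ∈ SST χ) (k : ℕ) (x : ℕ × ℕ) :
    x ∈ fillingBelow χ T k ↔ x ∈ χ.inner ∨ x ∈ χ.cells ∧ T x < k := by
  have hlow : IsLowerSet ((χ.inner.cells ∪ χ.cells.filter fun x => T x < k : Finset (ℕ × ℕ)) :
      Set (ℕ × ℕ)) := by
    refine isLowerSet_of_step (fun r c hx => ?_) (fun r c hx => ?_) <;>
      simp only [Finset.coe_union, Set.mem_union, Finset.mem_coe, Finset.mem_filter,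
        YoungDiagram.mem_cells] at hx ⊢ <;>
      rw [or_iff_not_imp_left] <;> intro hi
    · rcases hx with hx | ⟨hx, hlt⟩
      · exact absurd (χ.inner.up_left_mem (Nat.le_succ r) le_rfl hx) hi
      · have hm : (r, c) ∈ χ.cells := (SkewShape.mem_cells _ _).2
          ⟨χ.outer.up_left_mem (Nat.le_succ r) le_rfl ((SkewShape.mem_cells _ _).1 hx).1, hi⟩
        exact ⟨hm, (hT.2.1 _ _ _ (Nat.lt_succ_self r) hm hx).trans hlt⟩
    · rcases hx with hx | ⟨hx, hlt⟩
      · exact absurd (χ.inner.up_left_mem le_rfl (Nat.le_succ c) hx) hi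
      · have hm : (r, c) ∈ χ.cells := (SkewShape.mem_cells _ _).2
          ⟨χ.outer.up_left_mem le_rfl (Nat.le_succ c) ((SkewShape.mem_cells _ _).1 hx).1, hi⟩
        exact ⟨hm, (hT.1 _ _ _ (Nat.lt_succ_self c) hm hx).trans_lt hlt⟩
  rw [← YoungDiagram.mem_cells, fillingBelow, hull_cells hlow]
  simp

theorem fillingBelow_zero (χ : SkewShape) (T : Filling) : fillingBelow χ T 0 = χ.inner := by
  simp [fillingBelow, hull_self]

theorem exists_fillingBelow_eq (hχ : χ.inner ≤ χ.outer) (hT : T ∈ SST χ) :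
    ∃ K, ∀ k, K ≤ k → fillingBelow χ T k = χ.outer := by
  refine ⟨χ.cells.sup T + 1, fun k hk => ?_⟩
  ext x
  rw [YoungDiagram.mem_cells, mem_fillingBelow hT, YoungDiagram.mem_cells, SkewShape.mem_cells]
  constructor
  · rintro (h | h)
    · exact hχ h
    · exact h.1.1
  · intro h
    by_cases hi : x ∈ χ.inner
    · exact Or.inl hi
    · have := Finset.le_sup (f := T) ((SkewShape.mem_cells χ x).2 ⟨h, hi⟩)
      exact Or.inr ⟨⟨h, hi⟩, by omega⟩

/-- A semistandard tableau is determined by the partitions formed by its small entries. -/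
theorem filling_ext {T' : Filling} (hT : T ∈ SST χ) (hT' : T' ∈ SST χ)
    (h : ∀ k, fillingBelow χ T k = fillingBelow χ T' k) : T = T' := by
  funext x
  by_cases hx : x ∈ χ.cells
  · have hi := ((SkewShape.mem_cells _ _).1 hx).2
    have key : ∀ k, T x < k ↔ T' x < k := by
      intro k
      have h1 := mem_fillingBelow hT k x
      have h2 := mem_fillingBelow hT' k x
      rw [h k] at h1
      simp only [hi, hx, true_and, false_or] at h1 h2
      rw [← h1, h2]
    have h1 := key (T x)
    have h2 := key (T' x)
    omega
  · rw [hT.2.2 x hx, hT'.2.2 x hx]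

theorem content_injOn_entry (hT : T ∈ SST χ) {x y : ℕ × ℕ} (hx : x ∈ χ.cells) (hy : y ∈ χ.cells)
    (h : T x = T y) (hc : content x = content y) : x = y := by
  wlog hxy : x.1 ≤ y.1 generalizing x y
  · exact (this hy hx h.symm hc.symm (le_of_not_ge hxy)).symm
  rcases hxy.eq_or_lt with h1 | h1
  · exact eq_of_content_eq hc h1
  · exfalso
    have h2 : x.2 < y.2 := by simp only [content] at hc; omega
    have hz := SkewShape.between (z := (x.1, y.2)) hx hy ⟨le_rfl, h2.le⟩ ⟨h1.le, le_rfl⟩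
    have a1 := hT.1 x.1 _ _ h2 hx hz
    have a2 := hT.2.1 _ _ y.2 h1 hz hy
    simp only [Prod.mk.eta] at a1 a2
    omega

theorem card_filling_filter (hT : T ∈ SST χ) (k : ℕ) (P : ℤ → Prop) [DecidablePred P] :
    (χ.cells.filter fun x => P (content x) ∧ T x = k).card = ((entrySet χ T k).filter P).card := by
  refine Finset.card_nbij content (fun x hx => ?_) (fun x hx y hy hxy => ?_) (fun q hq => ?_)
  · rw [Finset.mem_coe, Finset.mem_filter] at hx ⊢
    exact ⟨mem_entrySet.2 ⟨x, hx.1, hx.2.2, rfl⟩, hx.2.1⟩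
  · rw [Finset.mem_coe, Finset.mem_filter] at hx hy
    exact content_injOn_entry hT hx.1 hy.1 (hx.2.2.trans hy.2.2.symm) hxy
  · rw [Finset.mem_coe, Finset.mem_filter] at hq
    obtain ⟨x, hx, hk, rfl⟩ := mem_entrySet.1 hq.1
    refine ⟨x, ?_, rfl⟩
    rw [Finset.mem_coe, Finset.mem_filter]
    exact ⟨hx, hq.2, hk⟩

theorem fillingWt_eq (hT : T ∈ SST χ) (k : ℕ) : fillingWt χ T k = (entrySet χ T k).card := by
  have := card_filling_filter hT k (fun _ => True)
  simpa [fillingWt] using this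

theorem prof_fillingBelow_succ (hT : T ∈ SST χ) (k : ℕ) (c : ℤ) :
    prof (fillingBelow χ T (k + 1)) c = prof (fillingBelow χ T k) c + ind (entrySet χ T k) c := by
  have hcells : (fillingBelow χ T (k + 1)).cells =
      (fillingBelow χ T k).cells ∪ χ.cells.filter fun x => T x = k := by
    ext x
    rw [Finset.mem_union, YoungDiagram.mem_cells, YoungDiagram.mem_cells, mem_fillingBelow hT,
      mem_fillingBelow hT, Finset.mem_filter, or_assoc, ← and_or_left, Nat.lt_succ_iff_lt_or_eq]
  have hdisj : Disjoint (fillingBelow χ T k).cells (χ.cells.filter fun x => T x = k) := by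
    rw [Finset.disjoint_left]
    intro x hx hx'
    rw [YoungDiagram.mem_cells, mem_fillingBelow hT] at hx
    rw [Finset.mem_filter] at hx'
    rcases hx with hx | hx
    · exact ((SkewShape.mem_cells _ _).1 hx'.1).2 hx
    · omega
  rw [prof_eq_card, prof_eq_card, hcells, Finset.filter_union,
    Finset.card_union_of_disjoint (Finset.disjoint_filter_filter hdisj), Finset.filter_filter]
  have h1 := card_filling_filter hT k (fun q => q = c)
  have h2 : (χ.cells.filter fun x => T x = k ∧ content x = c) =
      χ.cells.filter fun x => content x = c ∧ T x = k := Finset.filter_congr fun x _ => and_comm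
  rw [h2, h1, Finset.filter_eq']
  unfold ind
  split_ifs <;> simp [add_assoc]

theorem row_entry_eq (hT : T ∈ SST χ) {x : ℕ × ℕ} (hx : x ∈ χ.cells) :
    (x.1 : ℤ) = prof (fillingBelow χ T (T x)) (content x) := by
  have h1 : x ∉ fillingBelow χ T (T x) := by
    rw [mem_fillingBelow hT]
    rintro (h | h)
    · exact ((SkewShape.mem_cells _ _).1 hx).2 h
    · exact lt_irrefl _ h.2
  have h2 : x ∈ fillingBelow χ T (T x + 1) :=
    (mem_fillingBelow hT _ _).2 (Or.inr ⟨hx, Nat.lt_succ_self _⟩)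
  rw [mem_iff_lt_prof] at h1 h2
  rw [prof_fillingBelow_succ hT] at h2
  have := ind_le_one (entrySet χ T (T x)) (content x)
  omega

theorem cellStrip_filling (hT : T ∈ SST χ) (k : ℕ) :
    CellStrip (fillingBelow χ T k) (fillingBelow χ T (k + 1)) (entrySet χ T k) := by
  refine ⟨prof_fillingBelow_succ hT k, fun q hq => ?_⟩
  obtain ⟨x, hx, rfl, rfl⟩ := mem_entrySet.1 hq
  have h1 := row_entry_eq hT hx
  have h2 := prof_succ_le (fillingBelow χ T (T x)) (content x)
  by_contra hne
  obtain ⟨r, c⟩ := x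
  have h0 := prof_nonneg (fillingBelow χ T (T (r, c))) (content (r, c) + 1)
  obtain ⟨s, rfl⟩ : ∃ s, r = s + 1 := ⟨r - 1, by simp only at h1; omega⟩
  have hc : content (s, c) = content (s + 1, c) + 1 := by simp only [content]; push_cast; ring
  have hz : (s, c) ∉ fillingBelow χ T (T (s + 1, c)) := by
    rw [mem_iff_lt_prof, hc]
    push_cast at h1
    omega
  rw [mem_fillingBelow hT, not_or] at hz
  have hm : (s, c) ∈ χ.cells := (SkewShape.mem_cells _ _).2
    ⟨χ.outer.up_left_mem (Nat.le_succ s) le_rfl ((SkewShape.mem_cells _ _).1 hx).1, hz.1⟩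
  exact hz.2 ⟨hm, hT.2.1 _ _ _ (Nat.lt_succ_self s) hm hx⟩

end Filling

theorem le_of_step {U : ℕ → YoungDiagram} (h : ∀ k, U k ≤ U (k + 1)) {a b : ℕ} (hab : a ≤ b) :
    U a ≤ U b := monotone_nat_of_le_succ h hab

theorem CellStrip.le {ν ν' : YoungDiagram} {Y : Finset ℤ} (h : CellStrip ν ν' Y) : ν ≤ ν' := by
  rw [le_iff_prof]
  intro c
  rw [h.prof_eq]
  have := ind_nonneg Y c
  omega

/-- In a horizontal strip no square lies directly below another one. -/
theorem CellStrip.mem_above {ν ν' : YoungDiagram} {Y : Finset ℤ} (h : CellStrip ν ν' Y) {r c : ℕ}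
    (hx : (r + 1, c) ∈ ν') : (r, c) ∈ ν := by
  have hc : content (r, c) = content (r + 1, c) + 1 := by simp only [content]; push_cast; ring
  rw [mem_iff_lt_prof, h.prof_eq] at hx
  rw [mem_iff_lt_prof, hc]
  have h1 := prof_le_succ ν (content (r + 1, c))
  by_cases hq : content (r + 1, c) ∈ Y
  · rw [ind_of_mem hq] at hx
    have := h.hole _ hq
    push_cast at hx
    omega
  · rw [ind_of_not_mem hq] at hx
    push_cast at hx
    omega

/-- A sequence of horizontal strips comes from a semistandard tableau. -/
theorem exists_filling {χ : SkewShape} (U : ℕ → YoungDiagram) (Y : ℕ → Finset ℤ)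
    (hU : ∀ k, CellStrip (U k) (U (k + 1)) (Y k)) (h0 : U 0 = χ.inner)
    (hK : ∃ K, U K = χ.outer) (hle : ∀ k, U k ≤ χ.outer) :
    ∃ T ∈ SST χ, ∀ k, fillingBelow χ T k = U k := by
  classical
  obtain ⟨K, hK⟩ := hK
  have hex : ∀ x ∈ χ.cells, ∃ k, x ∈ U (k + 1) := fun x hx =>
    ⟨K, (hU K).le (hK ▸ ((SkewShape.mem_cells _ _).1 hx).1)⟩
  have hmono : ∀ {a b}, a ≤ b → U a ≤ U b := le_of_step fun k => (hU k).le
  let T : Filling := fun x => if hx : x ∈ χ.cells then Nat.find (hex x hx) else 0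
  have hlt : ∀ x ∈ χ.cells, ∀ k, T x < k ↔ x ∈ U k := by
    intro x hx k
    have hTx : T x = Nat.find (hex x hx) := dif_pos hx
    rw [hTx, Nat.find_lt_iff]
    constructor
    · rintro ⟨m, hm, hxm⟩
      exact hmono hm hxm
    · intro hxk
      cases k with
      | zero => exact absurd (h0 ▸ hxk) ((SkewShape.mem_cells _ _).1 hx).2
      | succ k => exact ⟨k, Nat.lt_succ_self k, hxk⟩
  have hT : T ∈ SST χ := by
    refine ⟨fun i j₁ j₂ hj h1 h2 => ?_, fun i₁ i₂ j hi h1 h2 => ?_, fun x hx => dif_neg hx⟩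
    · rw [← Nat.lt_succ_iff, hlt _ h1]
      exact (U _).up_left_mem le_rfl hj.le ((hlt _ h2 _).1 (Nat.lt_succ_self _))
    · rw [hlt _ h1]
      have h3 := (hlt _ h2 _).1 (Nat.lt_succ_self _)
      obtain ⟨r, rfl⟩ : ∃ r, i₂ = r + 1 := ⟨i₂ - 1, by omega⟩
      exact (U _).up_left_mem (by omega) le_rfl ((hU _).mem_above h3)
  refine ⟨T, hT, fun k => ?_⟩
  ext x
  rw [YoungDiagram.mem_cells, YoungDiagram.mem_cells, mem_fillingBelow hT]
  constructor
  · rintro (hx | ⟨hx, hk⟩)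
    · exact hmono (Nat.zero_le k) (h0 ▸ hx)
    · exact (hlt x hx k).1 hk
  · intro hx
    by_cases hi : x ∈ χ.inner
    · exact Or.inl hi
    · have hc := (SkewShape.mem_cells _ _).2 ⟨hle k hx, hi⟩
      exact Or.inr ⟨hc, (hlt x hc k).2 hx⟩

/-! ### The lattice condition for ordinary tableaux in terms of diagonals -/

/-- When a square with entry `k + 1` lies diagonally below one with entry `k`, its left neighbour has entry
`k + 1` as well. -/
theorem CellStrip.pred_mem {ν₀ ν₁ ν₂ : YoungDiagram} {Y₀ Y₁ : Finset ℤ} (h₀ : CellStrip ν₀ ν₁ Y₀)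
    (h₁ : CellStrip ν₁ ν₂ Y₁) {q : ℤ} (hq₀ : q ∈ Y₀) (hq₁ : q ∈ Y₁) : q - 1 ∈ Y₁ := by
  by_contra hn
  have a0 := h₀.prof_eq q
  have a1 := h₁.prof_eq q
  have b0 := h₀.prof_eq (q - 1)
  have b1 := h₁.prof_eq (q - 1)
  have s2 := prof_succ_le ν₂ (q - 1)
  have s0 := prof_le_succ ν₀ (q - 1)
  rw [sub_add_cancel] at s2 s0
  rw [ind_of_mem hq₀] at a0
  rw [ind_of_mem hq₁] at a1
  rw [ind_of_not_mem hn] at b1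
  have i0 := ind_le_one Y₀ (q - 1)
  by_cases hm : q - 1 ∈ Y₀
  · have := h₀.hole _ hm
    rw [sub_add_cancel] at this
    omega
  · rw [ind_of_not_mem hm] at b0
    omega

section Lattice

variable {χ : SkewShape} {T : Filling}

/-- The row reading order on squares, in terms of profiles. -/
theorem readUpTo_eq (hT : T ∈ SST χ) (s : ℕ × ℕ) (k : ℕ) :
    readUpTo χ T s k = ((entrySet χ T k).filter fun p =>
      prof (fillingBelow χ T k) p < s.1 ∨
        prof (fillingBelow χ T k) p = s.1 ∧ content s ≤ p).card := by
  rw [← card_filling_filter hT]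
  unfold readUpTo
  congr 1
  refine Finset.filter_congr fun x hx => and_congr_left ?_
  rintro rfl
  rw [← row_entry_eq hT hx]
  simp only [content]
  omega

/-- The lattice condition for the entries `k` and `k + 1` of a tableau that is read after a word with
`off` more entries `k` than `k + 1`. The reading order allows some more entries `k` to be counted than
those on diagonals to the right, but at the leftmost entry `k + 1` of a row the two counts agree, and
from there the inequality on diagonals propagates to the right. -/
theorem readUpTo_le_iff (hT : T ∈ SST χ) (k : ℕ) {off : ℤ} (hoff : 0 ≤ off) :
    (∀ s ∈ χ.cells, (readUpTo χ T s (k + 1) : ℤ) ≤ readUpTo χ T s k + off) ↔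
      ∀ x, tail (entrySet χ T (k + 1)) x ≤ tail (entrySet χ T k) (x + 1) + off := by
  have h₀ := cellStrip_filling hT k
  have h₁ := cellStrip_filling hT (k + 1)
  have min_tail : ∀ {x q}, (∀ p ∈ entrySet χ T (k + 1), x ≤ p → q ≤ p) → x ≤ q →
      tail (entrySet χ T (k + 1)) x = tail (entrySet χ T (k + 1)) q := by
    intro x q hmin hxq
    unfold tail
    congr 2
    exact Finset.filter_congr fun p hp => ⟨hmin p hp, fun h => hxq.trans h⟩
  constructor
  · intro hR
    -- At a square of entry `k + 1` on a diagonal that has no entry `k` the two counts agree.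
    have base : ∀ q ∈ entrySet χ T (k + 1), q ∉ entrySet χ T k →
        tail (entrySet χ T (k + 1)) q ≤ tail (entrySet χ T k) (q + 1) + off := by
      intro q hq hq0
      obtain ⟨s, hs, hsk, rfl⟩ := mem_entrySet.1 hq
      have hrow := row_entry_eq hT hs
      rw [hsk] at hrow
      have e0 := h₀.prof_eq (content s)
      rw [ind_of_not_mem hq0] at e0
      have h2 := hR s hs
      rw [readUpTo_eq hT, readUpTo_eq hT] at h2
      refine le_trans (Nat.cast_le.2 (Finset.card_le_card fun p hp => ?_)) (h2.trans ?_)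
      · rw [Finset.mem_filter] at hp ⊢
        have := prof_antitone (fillingBelow χ T (k + 1)) hp.2
        exact ⟨hp.1, by omega⟩
      · refine add_le_add_left (Nat.cast_le.2 (Finset.card_le_card fun p hp => ?_)) off
        rw [Finset.mem_filter] at hp ⊢
        refine ⟨hp.1, ?_⟩
        by_contra hlt
        have h3 : p ≠ content s := fun h => hq0 (h ▸ hp.1)
        have := prof_antitone (fillingBelow χ T k) (show p ≤ content s by omega)
        omega
    have main : ∀ q ∈ entrySet χ T (k + 1),
        tail (entrySet χ T (k + 1)) q ≤ tail (entrySet χ T k) (q + 1) + off := by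
      obtain ⟨N, hN⟩ := (entrySet χ T (k + 1)).bddBelow
      intro q hq
      obtain ⟨n, hn⟩ := Int.le.dest (hN (Finset.mem_coe.2 hq))
      induction n generalizing q with
      | zero =>
        refine base q hq fun hq0 => ?_
        have := hN (Finset.mem_coe.2 (h₀.pred_mem h₁ hq0 hq))
        push_cast at hn
        omega
      | succ n ih =>
        by_cases hq0 : q ∈ entrySet χ T k
        · have hp := h₀.pred_mem h₁ hq0 hq
          have h2 := ih _ hp (by push_cast at hn; omega)
          have h3 := tail_eq (entrySet χ T (k + 1)) (q - 1)
          have h4 := tail_eq (entrySet χ T k) q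
          rw [sub_add_cancel] at h2 h3
          rw [ind_of_mem hp] at h3
          rw [ind_of_mem hq0] at h4
          omega
        · exact base q hq hq0
    intro x
    rcases Finset.eq_empty_or_nonempty ((entrySet χ T (k + 1)).filter fun p => x ≤ p) with hne | hne
    · have h2 : tail (entrySet χ T (k + 1)) x = 0 := by simp [tail, hne]
      have h3 := tail_nonneg (entrySet χ T k) (x + 1)
      omega
    · have hq := Finset.min'_mem _ hne
      obtain ⟨q, hq0⟩ : ∃ q, q = Finset.min' _ hne := ⟨_, rfl⟩
      rw [← hq0, Finset.mem_filter] at hq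
      rw [min_tail (fun p hp hxp => hq0 ▸ Finset.min'_le _ _ (Finset.mem_filter.2 ⟨hp, hxp⟩)) hq.2]
      have h2 := main q hq.1
      have h3 := tail_antitone (entrySet χ T k) (show x + 1 ≤ q + 1 by omega)
      omega
  · intro hH s hs
    rw [readUpTo_eq hT, readUpTo_eq hT]
    rcases Finset.eq_empty_or_nonempty ((entrySet χ T (k + 1)).filter fun p =>
      prof (fillingBelow χ T (k + 1)) p < s.1 ∨
        prof (fillingBelow χ T (k + 1)) p = s.1 ∧ content s ≤ p) with hne | hne
    · rw [hne]
      simp only [Finset.card_empty, Nat.cast_zero]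
      omega
    · -- The last square with entry `k + 1` that is read.
      have hq := Finset.min'_mem _ hne
      obtain ⟨q, hq0⟩ : ∃ q, q = Finset.min' _ hne := ⟨_, rfl⟩
      rw [← hq0, Finset.mem_filter] at hq
      obtain ⟨hq1, hq2⟩ := hq
      refine le_trans (Nat.cast_le.2 (Finset.card_le_card (t := (entrySet χ T (k + 1)).filter
        fun p => q ≤ p) fun p hp => ?_)) ((hH q).trans (add_le_add_left
        (Nat.cast_le.2 (Finset.card_le_card fun p hp => ?_)) off))
      · exact Finset.mem_filter.2 ⟨(Finset.mem_filter.1 hp).1, hq0 ▸ Finset.min'_le _ _ hp⟩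
      · rw [Finset.mem_filter] at hp ⊢
        refine ⟨hp.1, ?_⟩
        have h2 := prof_antitone (fillingBelow χ T k) (show q ≤ p by omega)
        have h3 := h₀.prof_eq q
        have h4 := ind_nonneg (entrySet χ T k) q
        omega

end Lattice

/-- The Littlewood-Richardson condition in terms of diagonals. -/
theorem mem_LR_iff {χ χ' : SkewShape} {T : Filling × Filling} (hT : T ∈ SSTStar χ χ') :
    T ∈ LR χ χ' ↔ ∀ k, Dominates (entrySet χ' T.2 k) (entrySet χ' T.2 (k + 1)) ∧
      ∀ x, ((entrySet χ' T.2 (k + 1)).card : ℤ) + tail (entrySet χ T.1 (k + 1)) x ≤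
        (entrySet χ' T.2 k).card + tail (entrySet χ T.1 k) (x + 1) := by
  have key1 : (∀ s ∈ χ'.cells, ∀ k, readUpTo χ' T.2 s (k + 1) ≤ readUpTo χ' T.2 s k) ↔
      ∀ k, Dominates (entrySet χ' T.2 k) (entrySet χ' T.2 (k + 1)) := by
    have h1 := fun k => readUpTo_le_iff hT.2 k (off := 0) le_rfl
    simp only [add_zero, Nat.cast_le] at h1
    exact ⟨fun h k => (h1 k).1 fun s hs => h s hs k, fun h s hs k => (h1 k).2 (h k) s hs⟩
  have key2 : (∀ k, Dominates (entrySet χ' T.2 k) (entrySet χ' T.2 (k + 1))) →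
      ∀ k, ((∀ s ∈ χ.cells, fillingWt χ' T.2 (k + 1) + readUpTo χ T.1 s (k + 1) ≤
        fillingWt χ' T.2 k + readUpTo χ T.1 s k) ↔
        ∀ x, ((entrySet χ' T.2 (k + 1)).card : ℤ) + tail (entrySet χ T.1 (k + 1)) x ≤
        (entrySet χ' T.2 k).card + tail (entrySet χ T.1 k) (x + 1)) := by
    intro hd k
    have hoff : (0 : ℤ) ≤ (entrySet χ' T.2 k).card - (entrySet χ' T.2 (k + 1)).card := by
      obtain ⟨N, hN⟩ := (entrySet χ' T.2 (k + 1)).bddBelow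
      have h1 := hd k N
      have h2 : tail (entrySet χ' T.2 (k + 1)) N = (entrySet χ' T.2 (k + 1)).card := by
        unfold tail
        rw [Finset.filter_true_of_mem fun p hp => hN (Finset.mem_coe.2 hp)]
      have h3 : tail (entrySet χ' T.2 k) (N + 1) ≤ (entrySet χ' T.2 k).card :=
        Nat.cast_le.2 (Finset.card_filter_le _ _)
      omega
    have h1 := readUpTo_le_iff hT.1 k hoff
    rw [fillingWt_eq hT.2, fillingWt_eq hT.2]
    constructor
    · intro h x
      have := h1.1 (fun s hs => by have := h s hs; omega) x
      omega
    · intro h s hs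
      have := h1.2 (fun x => by have := h x; omega) s hs
      omega
  constructor
  · rintro ⟨-, h1, h2⟩ k
    have hd := key1.1 h1
    exact ⟨hd k, (key2 hd k).1 fun s hs => h2 s hs k⟩
  · intro h
    have hd := fun k => (h k).1
    exact ⟨hT, key1.2 hd, fun s hs k => (key2 hd k).2 (h k).2 s hs⟩

/-! ### Domino tableaux as sequences of strips -/

theorem DominoStrip.le {ν ν' : YoungDiagram} {X : Finset ℤ} (h : DominoStrip ν ν' X) : ν ≤ ν' := by
  rw [le_iff_prof]
  intro c
  rw [h.prof_eq]
  have := ind_nonneg X c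
  have := ind_nonneg X (c + 1)
  omega

/-- The positions of the dominoes of a strip are determined by the two partitions, starting from the
largest position. -/
theorem DominoStrip.unique {ν ν' : YoungDiagram} {X X' : Finset ℤ} (h : DominoStrip ν ν' X)
    (h' : DominoStrip ν ν' X') : X = X' := by
  obtain ⟨N, hN⟩ := exists_upper_bound (X ∪ X')
  have key : ∀ c, ind X c = ind X' c := by
    intro c
    rcases le_or_gt N c with hc | hc
    · rw [ind_of_not_mem fun hm => absurd (hN c (Finset.mem_union_left _ hm)) (by omega),
        ind_of_not_mem fun hm => absurd (hN c (Finset.mem_union_right _ hm)) (by omega)]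
    · obtain ⟨n, hn⟩ := Int.le.dest hc.le
      induction n generalizing c with
      | zero => omega
      | succ n ih =>
        have h1 := h.prof_eq c
        have h2 := h'.prof_eq c
        have h3 : ind X (c + 1) = ind X' (c + 1) := by
          by_cases hc1 : c + 1 < N
          · exact ih (c + 1) hc1 (by push_cast at hn; omega)
          · rw [ind_of_not_mem fun hm => absurd (hN _ (Finset.mem_union_left _ hm)) hc1,
              ind_of_not_mem fun hm => absurd (hN _ (Finset.mem_union_right _ hm)) hc1]
        omega
  ext c
  rw [mem_iff_ind, mem_iff_ind, key]

/-- The domino in position `p` of the strip with positions `X` that is added to `ν`. -/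
def stripDomino (ν : YoungDiagram) (X : Finset ℤ) (p : ℤ) : Finset (ℕ × ℕ) :=
  {sq p (prof ν p), sq (p - 1) (prof ν (p - 1) + ind X (p - 1))}

theorem mem_stripDomino (ν : YoungDiagram) (X : Finset ℤ) (p : ℤ) (x : ℕ × ℕ) :
    x ∈ stripDomino ν X p ↔ (content x = p ∧ (x.1 : ℤ) = prof ν p) ∨
      (content x = p - 1 ∧ (x.1 : ℤ) = prof ν (p - 1) + ind X (p - 1)) := by
  have h1 := prof_nonneg ν p
  have h2 := neg_le_prof ν p
  have h3 := prof_nonneg ν (p - 1)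
  have h4 := neg_le_prof ν (p - 1)
  have h5 := ind_nonneg X (p - 1)
  rw [stripDomino, Finset.mem_insert, Finset.mem_singleton, eq_sq_iff h1 h2,
    eq_sq_iff (by omega) (by omega)]

namespace DominoStrip

variable {ν ν' : YoungDiagram} {X : Finset ℤ}

theorem isDomino (h : DominoStrip ν ν' X) (p : ℤ) : IsDomino (stripDomino ν X p) := by
  have h1 := prof_nonneg ν p
  have h2 := neg_le_prof ν p
  have h3 := prof_nonneg ν (p - 1)
  have h4 := neg_le_prof ν (p - 1)
  have h5 := ind_nonneg X (p - 1)
  have s1 := prof_succ_le ν (p - 1)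
  have s2 := prof_le_succ ν (p - 1)
  rw [sub_add_cancel] at s1 s2
  have e1 := sq_fst (c := p) h1
  have e2 := sq_fst (c := p - 1) (show 0 ≤ prof ν (p - 1) + ind X (p - 1) by omega)
  refine (isDomino_pair ?_ ?_).1
  · rw [content_sq h1 h2, content_sq (by omega) (by omega)]
  · by_cases hp1 : p - 1 ∈ X
    · have := h.hole _ hp1
      rw [sub_add_cancel] at this
      have := ind_of_mem hp1
      omega
    · have := ind_of_not_mem hp1
      omega

theorem exists_mem_iff (h : DominoStrip ν ν' X) (x : ℕ × ℕ) :
    (∃ p ∈ X, x ∈ stripDomino ν X p) ↔ x ∈ ν' ∧ x ∉ ν := by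
  rw [mem_iff_lt_prof, mem_iff_lt_prof, h.prof_eq]
  constructor
  · rintro ⟨p, hp, hx⟩
    have i1 := ind_of_mem hp
    rw [mem_stripDomino] at hx
    rcases hx with ⟨rfl, hx⟩ | ⟨hc, hx⟩
    · have i2 := ind_nonneg X (content x + 1)
      omega
    · have i2 := ind_nonneg X (p - 1)
      rw [hc, sub_add_cancel]
      omega
  · rintro ⟨h1, h2⟩
    by_cases hc : content x ∈ X ∧ (x.1 : ℤ) = prof ν (content x)
    · exact ⟨_, hc.1, (mem_stripDomino _ _ _ _).2 (Or.inl ⟨rfl, hc.2⟩)⟩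
    · have i1 := ind_le_one X (content x + 1)
      have i3 := ind_le_one X (content x)
      have i2 := mem_iff_ind (X := X) (p := content x)
      rw [i2] at hc
      refine ⟨content x + 1, mem_iff_ind.2 (by omega), (mem_stripDomino _ _ _ _).2 (Or.inr ⟨by ring, ?_⟩)⟩
      rw [add_sub_cancel_right]
      omega

theorem eq_of_mem {x : ℕ × ℕ} {p q : ℤ} (hp : p ∈ X) (hq : q ∈ X) (hx : x ∈ stripDomino ν X p)
    (hx' : x ∈ stripDomino ν X q) : p = q := by
  rw [mem_stripDomino] at hx hx'
  rcases hx with ⟨h1, h2⟩ | ⟨h1, h2⟩ <;> rcases hx' with ⟨h3, h4⟩ | ⟨h3, h4⟩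
  · omega
  · rw [show q - 1 = p by omega, ind_of_mem hp] at h4
    omega
  · rw [show p - 1 = q by omega, ind_of_mem hq] at h2
    omega
  · omega

/-- Vertically adjacent squares of a strip belong to the same domino. -/
theorem mem_of_adjacent (h : DominoStrip ν ν' X) {r c : ℕ} (h1 : (r, c) ∈ ν' ∧ (r, c) ∉ ν)
    (h2 : (r + 1, c) ∈ ν' ∧ (r + 1, c) ∉ ν) : content (r, c) ∈ X ∧
      (r, c) ∈ stripDomino ν X (content (r, c)) ∧ (r + 1, c) ∈ stripDomino ν X (content (r, c)) := by
  have hc : content (r + 1, c) = content (r, c) - 1 := by simp only [content]; push_cast; ring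
  obtain ⟨a, ha⟩ : ∃ a, a = content (r, c) := ⟨_, rfl⟩
  have s1 := prof_le_succ ν (a - 1)
  have s2 := prof_succ_le ν (a - 1)
  rw [sub_add_cancel] at s1 s2
  have i1 := ind_le_one X (a - 1)
  have hh : ind X (a - 1) = 1 → prof ν (a - 1) = prof ν a := by
    intro hi
    have := h.hole _ (mem_iff_ind.2 hi)
    rwa [sub_add_cancel] at this
  obtain ⟨p, hp, hxp⟩ := (h.exists_mem_iff _).2 h1
  obtain ⟨q, hq, hxq⟩ := (h.exists_mem_iff _).2 h2
  rw [mem_stripDomino, ← ha] at hxp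
  rw [mem_stripDomino, hc, ← ha] at hxq
  simp only [mem_stripDomino, hc, ← ha]
  push_cast at hxq ⊢
  have hxq' : q = a ∧ (r : ℤ) + 1 = prof ν (a - 1) + ind X (a - 1) := by
    rcases hxq with ⟨rfl, h5⟩ | ⟨h4, h5⟩
    · have h6 := hh (ind_of_mem hq)
      rcases hxp with ⟨rfl, h8⟩ | ⟨h7, h8⟩
      · omega
      · rw [← h7] at h8
        have := ind_nonneg X a
        omega
    · have : q = a := by omega
      subst this
      exact ⟨rfl, h5⟩
  obtain ⟨rfl, h5⟩ := hxq'
  refine ⟨hq, ?_, Or.inr ⟨trivial, h5⟩⟩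
  rcases hxp with ⟨rfl, h8⟩ | ⟨h7, h8⟩
  · exact Or.inl ⟨trivial, h8⟩
  · exfalso
    rw [← h7, ind_of_mem hq] at h8
    have := ind_nonneg X (q - 1)
    have h9 : ind X (q - 1) ≠ 1 := fun hi => by
      have := hh hi
      omega
    omega

/-- Squares of a strip in the same column belong to the same domino. -/
theorem eq_of_same_column (h : DominoStrip ν ν' X) {p q : ℤ} (hp : p ∈ X) (hq : q ∈ X)
    {i₁ i₂ j : ℕ} (h1 : (i₁, j) ∈ stripDomino ν X p) (h2 : (i₂, j) ∈ stripDomino ν X q)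
    (hi : i₁ < i₂) : p = q := by
  have m1 := (h.exists_mem_iff _).1 ⟨p, hp, h1⟩
  have m2 := (h.exists_mem_iff _).1 ⟨q, hq, h2⟩
  have hb : ∀ i, i₁ ≤ i → i ≤ i₂ → (i, j) ∈ ν' ∧ (i, j) ∉ ν := fun i hi1 hi2 =>
    ⟨ν'.up_left_mem hi2 le_rfl m2.1, fun hm => m1.2 (ν.up_left_mem hi1 le_rfl hm)⟩
  obtain ⟨hc, a1, a2⟩ := h.mem_of_adjacent (hb i₁ le_rfl hi.le) (hb (i₁ + 1) (by omega) hi)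
  have e1 := eq_of_mem hp hc h1 a1
  by_cases hi2 : i₂ = i₁ + 1
  · subst hi2
    exact e1.trans (eq_of_mem hq hc h2 a2).symm
  · obtain ⟨hc', b1, -⟩ := h.mem_of_adjacent (hb (i₁ + 1) (by omega) hi)
      (hb (i₁ + 1 + 1) (by omega) (by omega))
    have := eq_of_mem hc hc' a2 b1
    simp only [content] at this
    omega

end DominoStrip

theorem IsSSDT.dominoBelow_zero (D : DominoTableau) : dominoBelow D 0 = D.shape.inner := by
  rw [dominoBelow_eq_fill]
  simp [fill_empty]

theorem IsSSDT.exists_dominoBelow_eq {D : DominoTableau} (h : IsSSDT D.shape D) :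
    ∃ K, ∀ k, K ≤ k → dominoBelow D k = D.shape.outer := by
  refine ⟨D.dominoes.sup Prod.snd + 1, fun k hk => ?_⟩
  rw [dominoBelow_eq_fill, Finset.filter_true_of_mem, h.fill_self]
  intro d hd
  have := Finset.le_sup (f := Prod.snd) hd
  omega

theorem IsSSDT.mem_dominoBelow {D : DominoTableau} (h : IsSSDT D.shape D) (k : ℕ) (x : ℕ × ℕ) :
    x ∈ dominoBelow D k ↔ x ∈ D.shape.inner ∨ ∃ d ∈ D.dominoes, d.2 < k ∧ x ∈ d.1 := by
  rw [dominoBelow_eq_fill, h.mem_fill (isInitial_below D k)]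
  simp [and_assoc]

/-- A semistandard domino tableau is determined by the partitions formed by its small entries. -/
theorem IsSSDT.ext {D D' : DominoTableau} (h : IsSSDT D.shape D) (h' : IsSSDT D'.shape D')
    (hs : D.shape = D'.shape) (hb : ∀ k, dominoBelow D k = dominoBelow D' k) : D = D' := by
  have hX : ∀ k, posSet D k = posSet D' k := by
    intro k
    have h1 := h.dominoStrip k
    rw [hb, hb] at h1
    exact h1.unique (h'.dominoStrip k)
  have key : ∀ {D D' : DominoTableau}, IsSSDT D.shape D → IsSSDT D'.shape D' →
      (∀ k, dominoBelow D k = dominoBelow D' k) → (∀ k, posSet D k = posSet D' k) →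
      D.dominoes ⊆ D'.dominoes := by
    intro D D' h h' hb hX d hd
    obtain ⟨e, he, h2, hp⟩ := mem_posSet.1 (hX d.2 ▸ mem_posSet.2 ⟨d, hd, rfl, rfl⟩)
    have h3 : ∀ c, prof (stdShape D d) c = prof (stdShape D' e) c := by
      intro c
      rw [h.prof_stdShape_eq, h'.prof_stdShape_eq, h2, hb, hX, hp]
    have : d = e := by
      refine Prod.ext ?_ h2.symm
      ext x
      rw [h.mem_domino_iff hd, h'.mem_domino_iff he, h3, hp]
    exact this ▸ he
  obtain ⟨ψ, A⟩ := D
  obtain ⟨ψ', A'⟩ := D'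
  obtain rfl : ψ = ψ' := hs
  congr 1
  exact (key h h' hb hX).antisymm (key h' h (fun k => (hb k).symm) fun k => (hX k).symm)

/-- A sequence of domino strips comes from a semistandard domino tableau. -/
theorem exists_ssdt {ψ : SkewShape} (ν : ℕ → YoungDiagram) (X : ℕ → Finset ℤ)
    (h : ∀ k, DominoStrip (ν k) (ν (k + 1)) (X k)) (h0 : ν 0 = ψ.inner) {K : ℕ}
    (hK : ∀ k, K ≤ k → ν k = ψ.outer) : ∃ D, IsSSDT ψ D ∧ ∀ k, dominoBelow D k = ν k := by
  classical
  have hmono : ∀ {a b}, a ≤ b → ν a ≤ ν b := le_of_step fun k => (h k).le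
  let A : Finset (Finset (ℕ × ℕ) × ℕ) :=
    (Finset.range K).biUnion fun k => (X k).image fun p => (stripDomino (ν k) (X k) p, k)
  have hA : ∀ d, d ∈ A ↔ d.2 < K ∧ ∃ p ∈ X d.2, d.1 = stripDomino (ν d.2) (X d.2) p := by
    rintro ⟨s, k⟩
    simp only [A, Finset.mem_biUnion, Finset.mem_range, Finset.mem_image, Prod.mk.injEq]
    constructor
    · rintro ⟨l, hl, p, hp, rfl, rfl⟩
      exact ⟨hl, p, hp, rfl⟩
    · rintro ⟨hk, p, hp, rfl⟩
      exact ⟨k, hk, p, hp, rfl, rfl⟩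
  have hmem : ∀ {d x}, d ∈ A → x ∈ d.1 → x ∈ ν (d.2 + 1) ∧ x ∉ ν d.2 := by
    intro d x hd hx
    obtain ⟨-, p, hp, hdp⟩ := (hA d).1 hd
    exact ((h d.2).exists_mem_iff x).1 ⟨p, hp, hdp ▸ hx⟩
  have hle : ∀ {d e x y}, d ∈ A → e ∈ A → x ∈ d.1 → y ∈ e.1 → x ≤ y → d.2 ≤ e.2 := by
    intro d e x y hd he hx hy hxy
    by_contra hlt
    exact (hmem hd hx).2 (hmono (by omega) ((ν _).isLowerSet hxy (hmem he hy).1))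
  have hex : ∀ x k, x ∈ ν k → x ∉ ν 0 → ∃ d ∈ A, d.2 < k ∧ x ∈ d.1 := by
    intro x k hx hx0
    have hf := Nat.find_spec (⟨k, hx⟩ : ∃ k, x ∈ ν k)
    obtain ⟨l, hl⟩ : ∃ l, Nat.find (⟨k, hx⟩ : ∃ k, x ∈ ν k) = l + 1 :=
      Nat.exists_eq_succ_of_ne_zero fun h0 => hx0 (h0 ▸ hf)
    have hl1 : x ∉ ν l := Nat.find_min (⟨k, hx⟩ : ∃ k, x ∈ ν k) (by omega)
    have hlk : l + 1 ≤ k := hl ▸ Nat.find_min' _ hx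
    rw [hl] at hf
    obtain ⟨p, hp, hxp⟩ := ((h l).exists_mem_iff x).2 ⟨hf, hl1⟩
    refine ⟨(stripDomino (ν l) (X l) p, l), (hA _).2 ⟨?_, p, hp, rfl⟩, by simpa using hlk, hxp⟩
    by_contra hn
    refine hl1 ?_
    rw [hK l (by simpa using hn), ← hK (l + 1) (by simp only at hn; omega)]
    exact hf
  have hD : IsSSDT ψ ⟨ψ, A⟩ := by
    refine ⟨rfl, ?_, ?_, ?_, ?_, ?_, ?_⟩
    · rw [← h0, ← hK K le_rfl]
      exact hmono (Nat.zero_le _)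
    · intro d hd
      obtain ⟨-, p, hp, hdp⟩ := (hA d).1 hd
      exact hdp ▸ (h d.2).isDomino p
    · intro d hd e he hne
      rw [Finset.disjoint_left]
      intro x hx hx'
      have h2 : d.2 = e.2 := (hle hd he hx hx' le_rfl).antisymm (hle he hd hx' hx le_rfl)
      obtain ⟨-, p, hp, hdp⟩ := (hA d).1 hd
      obtain ⟨-, q, hq, heq⟩ := (hA e).1 he
      rw [← h2] at hq heq
      have hpq := DominoStrip.eq_of_mem hp hq (hdp ▸ hx) (heq ▸ hx')
      exact hne (Prod.ext (by rw [hdp, heq, hpq]) h2)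
    · ext x
      rw [Finset.mem_biUnion, SkewShape.mem_cells, ← hK K le_rfl, ← h0]
      constructor
      · rintro ⟨d, hd, hx⟩
        have := hmem hd hx
        exact ⟨hmono ((hA d).1 hd).1 this.1, fun hx0 => this.2 (hmono (Nat.zero_le _) hx0)⟩
      · rintro ⟨hx, hx0⟩
        obtain ⟨d, hd, -, hxd⟩ := hex x K hx hx0
        exact ⟨d, hd, hxd⟩
    · intro d hd e he i j₁ j₂ h1 h2 hj
      exact hle hd he h1 h2 ⟨le_rfl, hj.le⟩
    · intro d hd e he hne i₁ i₂ j h1 h2 hi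
      refine (hle hd he h1 h2 ⟨hi.le, le_rfl⟩).lt_of_ne fun h2' => hne ?_
      obtain ⟨-, p, hp, hdp⟩ := (hA d).1 hd
      obtain ⟨-, q, hq, heq⟩ := (hA e).1 he
      rw [← h2'] at hq heq
      have hpq := (h d.2).eq_of_same_column hp hq (hdp ▸ h1) (heq ▸ h2) hi
      exact Prod.ext (by rw [hdp, heq, hpq]) h2'
  refine ⟨⟨ψ, A⟩, hD, fun k => ?_⟩
  ext x
  rw [YoungDiagram.mem_cells, YoungDiagram.mem_cells, IsSSDT.mem_dominoBelow (D := ⟨ψ, A⟩) hD]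
  constructor
  · rintro (hx | ⟨d, hd, hk, hx⟩)
    · exact hmono (Nat.zero_le k) (h0 ▸ hx)
    · exact hmono hk (hmem hd hx).1
  · intro hx
    by_cases hx0 : x ∈ ψ.inner
    · exact Or.inl hx0
    · exact Or.inr (hex x k hx (h0 ▸ hx0))

/-! ### Domino strips of partitions with a given `2`-quotient -/

/-- The positions of the dominoes of a strip that is added to `node m U V` by adding squares to `U` on the
diagonals in `Y₀`, and squares to `V` on those in `Y₁`. -/
def nodeSet (m : ℤ) (Y₀ Y₁ : Finset ℤ) : Finset ℤ :=
  Y₀.image (fun q => 2 * q + m) ∪ Y₁.image fun q => 2 * q + 1 - m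

theorem mem_nodeSet {m : ℤ} {Y₀ Y₁ : Finset ℤ} {p : ℤ} :
    p ∈ nodeSet m Y₀ Y₁ ↔ (∃ q ∈ Y₀, 2 * q + m = p) ∨ ∃ q ∈ Y₁, 2 * q + 1 - m = p := by
  simp [nodeSet]

theorem left_mem_nodeSet {m : ℤ} {Y₀ Y₁ : Finset ℤ} {q : ℤ} :
    2 * q + m ∈ nodeSet m Y₀ Y₁ ↔ q ∈ Y₀ := by
  rw [mem_nodeSet]
  constructor
  · rintro (⟨r, hr, h⟩ | ⟨r, hr, h⟩)
    · rwa [← show r = q by omega]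
    · omega
  · exact fun hq => Or.inl ⟨q, hq, rfl⟩

theorem right_mem_nodeSet {m : ℤ} {Y₀ Y₁ : Finset ℤ} {q : ℤ} :
    2 * q + 1 - m ∈ nodeSet m Y₀ Y₁ ↔ q ∈ Y₁ := by
  rw [mem_nodeSet]
  constructor
  · rintro (⟨r, hr, h⟩ | ⟨r, hr, h⟩)
    · omega
    · rwa [← show r = q by omega]
  · exact fun hq => Or.inr ⟨q, hq, rfl⟩

theorem left_or_right (m p : ℤ) : (∃ q, p = 2 * q + m) ∨ ∃ q, p = 2 * q + 1 - m := by
  rcases Int.even_or_odd' (p - m) with ⟨q, hq | hq⟩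
  · exact Or.inl ⟨q, by omega⟩
  · exact Or.inr ⟨q + m, by omega⟩

theorem ind_left {m : ℤ} {Y₀ Y₁ X : Finset ℤ} (h₀ : ∀ q, q ∈ Y₀ ↔ 2 * q + m ∈ X)
    (h₁ : ∀ q, q ∈ Y₁ ↔ 2 * q + 1 - m ∈ X) (q : ℤ) :
    ind X (2 * q + m) = ind Y₀ q ∧ ind X (2 * q + m + 1) = ind Y₁ (q + m) := by
  refine ⟨by simp only [ind, h₀], ?_⟩
  rw [show 2 * q + m + 1 = 2 * (q + m) + 1 - m by ring]
  simp only [ind, h₁]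

theorem ind_right {m : ℤ} {Y₀ Y₁ X : Finset ℤ} (h₀ : ∀ q, q ∈ Y₀ ↔ 2 * q + m ∈ X)
    (h₁ : ∀ q, q ∈ Y₁ ↔ 2 * q + 1 - m ∈ X) (q : ℤ) :
    ind X (2 * q + 1 - m) = ind Y₁ q ∧ ind X (2 * q + 1 - m + 1) = ind Y₀ (q - m + 1) := by
  refine ⟨by simp only [ind, h₁], ?_⟩
  rw [show 2 * q + 1 - m + 1 = 2 * (q - m + 1) + m by ring]
  simp only [ind, h₀]

theorem dominoStrip_node (m : ℤ) {U U' V V' : YoungDiagram} {Y₀ Y₁ : Finset ℤ}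
    (h₀ : CellStrip U U' Y₀) (h₁ : CellStrip V V' Y₁) :
    DominoStrip (node m U V) (node m U' V') (nodeSet m Y₀ Y₁) := by
  refine ⟨fun c => ?_, fun p hp => ?_⟩
  · rcases left_or_right m c with ⟨q, rfl⟩ | ⟨q, rfl⟩
    · obtain ⟨e1, e2⟩ := ind_left (m := m) (fun q => left_mem_nodeSet.symm)
        (fun q => right_mem_nodeSet (Y₀ := Y₀) (Y₁ := Y₁).symm) q
      rw [e1, e2, prof_node_left, prof_node_left, h₀.prof_eq, h₁.prof_eq]
      ring
    · obtain ⟨e1, e2⟩ := ind_right (m := m) (fun q => left_mem_nodeSet.symm)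
        (fun q => right_mem_nodeSet (Y₀ := Y₀) (Y₁ := Y₁).symm) q
      rw [e1, e2, prof_node_right, prof_node_right, h₀.prof_eq, h₁.prof_eq]
      ring
  · rcases mem_nodeSet.1 hp with ⟨q, hq, rfl⟩ | ⟨q, hq, rfl⟩
    · rw [prof_node_left, prof_node_left_succ, h₀.hole q hq]
    · rw [prof_node_right, prof_node_right_succ, h₁.hole q hq]

/-- A diagram obtained by adding one square on each of the diagonals in a finite set. -/
theorem exists_prof_add_ind (U : YoungDiagram) (Y : Finset ℤ)
    (h : ∀ q, 0 ≤ prof U q + ind Y q - (prof U (q + 1) + ind Y (q + 1)) ∧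
      prof U q + ind Y q - (prof U (q + 1) + ind Y (q + 1)) ≤ 1) :
    ∃ U' : YoungDiagram, ∀ q, prof U' q = prof U q + ind Y q := by
  obtain ⟨N, hN⟩ := Y.bddAbove
  obtain ⟨N', hN'⟩ := Y.bddBelow
  refine exists_prof_eq _ (fun c => ?_) (fun c => ?_)
    (U.rowLen 0 + U.colLen 0 + N.natAbs + N'.natAbs + 1) (fun c hc => ?_) (fun c hc => ?_)
  · have := h c
    omega
  · have := h c
    omega
  · rw [prof_eq_zero U (by omega), ind_of_not_mem, add_zero]
    intro hm
    have := hN (Finset.mem_coe.2 hm)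
    omega
  · rw [prof_eq_neg U (by omega), ind_of_not_mem, add_zero]
    intro hm
    have := hN' (Finset.mem_coe.2 hm)
    omega

/-- Adding a strip of dominoes amounts to adding horizontal strips to the components of the
`2`-quotient. -/
theorem DominoStrip.exists_cellStrip {m : ℤ} {U V ν' : YoungDiagram} {X : Finset ℤ}
    (h : DominoStrip (node m U V) ν' X) : ∃ U' V' Y₀ Y₁, CellStrip U U' Y₀ ∧ CellStrip V V' Y₁ ∧
      ν' = node m U' V' := by
  obtain ⟨Y₀, h₀⟩ : ∃ Y₀ : Finset ℤ, ∀ q, q ∈ Y₀ ↔ 2 * q + m ∈ X := by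
    refine ⟨(X.image fun p => (p - m) / 2).filter fun q => 2 * q + m ∈ X, fun q => ?_⟩
    rw [Finset.mem_filter, and_iff_right_iff_imp]
    exact fun hq => Finset.mem_image.2 ⟨_, hq, by omega⟩
  obtain ⟨Y₁, h₁⟩ : ∃ Y₁ : Finset ℤ, ∀ q, q ∈ Y₁ ↔ 2 * q + 1 - m ∈ X := by
    refine ⟨(X.image fun p => (p - 1 + m) / 2).filter fun q => 2 * q + 1 - m ∈ X, fun q => ?_⟩
    rw [Finset.mem_filter, and_iff_right_iff_imp]
    exact fun hq => Finset.mem_image.2 ⟨_, hq, by omega⟩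
  obtain ⟨U', hU'⟩ := exists_prof_add_ind U Y₀ fun q => by
    have e1 := h.prof_eq (2 * q + m)
    have e2 := h.prof_eq (2 * q + m + 1)
    have s1 := prof_succ_le ν' (2 * q + m)
    have s2 := prof_le_succ ν' (2 * q + m)
    have i1 := ind_left h₀ h₁ q
    have i2 := (ind_left h₀ h₁ (q + 1)).1
    rw [show 2 * (q + 1) + m = 2 * q + m + 1 + 1 by ring] at i2
    rw [prof_node_left] at e1
    rw [prof_node_left_succ] at e2
    omega
  obtain ⟨V', hV'⟩ := exists_prof_add_ind V Y₁ fun q => by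
    have e1 := h.prof_eq (2 * q + 1 - m)
    have e2 := h.prof_eq (2 * q + 1 - m + 1)
    have s1 := prof_succ_le ν' (2 * q + 1 - m)
    have s2 := prof_le_succ ν' (2 * q + 1 - m)
    have i1 := ind_right h₀ h₁ q
    have i2 := (ind_right h₀ h₁ (q + 1)).1
    rw [show 2 * (q + 1) + 1 - m = 2 * q + 1 - m + 1 + 1 by ring] at i2
    rw [prof_node_right] at e1
    rw [prof_node_right_succ] at e2
    omega
  refine ⟨U', V', Y₀, Y₁, ⟨hU', fun q hq => ?_⟩, ⟨hV', fun q hq => ?_⟩, ext_prof fun c => ?_⟩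
  · have := h.hole _ ((h₀ q).1 hq)
    rw [prof_node_left, prof_node_left_succ] at this
    omega
  · have := h.hole _ ((h₁ q).1 hq)
    rw [prof_node_right, prof_node_right_succ] at this
    omega
  · rw [h.prof_eq]
    rcases left_or_right m c with ⟨q, rfl⟩ | ⟨q, rfl⟩
    · obtain ⟨e1, e2⟩ := ind_left h₀ h₁ q
      rw [e1, e2, prof_node_left, prof_node_left, hU', hV']
      ring
    · obtain ⟨e1, e2⟩ := ind_right h₀ h₁ q
      rw [e1, e2, prof_node_right, prof_node_right, hU', hV']
      ring

/-! ### Domino tableaux with a given `2`-quotient -/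

/-- The skew shape whose two partitions have `2`-quotients given by `χ` and `χ'`, with the numbering of
`2`-cores that is used for `node`. -/
noncomputable def nodeShape (m : ℤ) (χ χ' : SkewShape) : SkewShape :=
  ⟨node m χ.outer χ'.outer, node m χ.inner χ'.inner⟩

/-- `D` is the domino tableau that corresponds to the pair `T` of tableaux under the `2`-quotient map,
for the numbering of `2`-cores by `m` that is used for `node`. -/
def IsNode (m : ℤ) (χ χ' : SkewShape) (T : Filling × Filling) (D : DominoTableau) : Prop :=
  IsSSDT (nodeShape m χ χ') D ∧
    ∀ k, dominoBelow D k = node m (fillingBelow χ T.1 k) (fillingBelow χ' T.2 k)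

theorem IsSSDT.self {ψ : SkewShape} {D : DominoTableau} (h : IsSSDT ψ D) : IsSSDT D.shape D := by
  rw [h.shape_eq]
  exact h

section Node

variable {m : ℤ} {χ χ' : SkewShape} {T T' : Filling × Filling} {D D' : DominoTableau}

theorem exists_isNode (m : ℤ) (hχ : χ.inner ≤ χ.outer) (hχ' : χ'.inner ≤ χ'.outer)
    (hT : T ∈ SSTStar χ χ') : ∃ D, IsNode m χ χ' T D := by
  obtain ⟨K, hK⟩ := exists_fillingBelow_eq hχ hT.1
  obtain ⟨K', hK'⟩ := exists_fillingBelow_eq hχ' hT.2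
  refine exists_ssdt (ψ := nodeShape m χ χ') _ _ (fun k => dominoStrip_node m
    (cellStrip_filling hT.1 k) (cellStrip_filling hT.2 k)) ?_ (K := max K K') (fun k hk => ?_)
  · rw [fillingBelow_zero, fillingBelow_zero]
    rfl
  · rw [hK k (by omega), hK' k (by omega)]
    rfl

theorem IsNode.unique (h : IsNode m χ χ' T D) (h' : IsNode m χ χ' T D') : D = D' :=
  h.1.self.ext h'.1.self (h.1.shape_eq.trans h'.1.shape_eq.symm) fun k => (h.2 k).trans (h'.2 k).symm

theorem IsNode.filling_unique (h : IsNode m χ χ' T D) (h' : IsNode m χ χ' T' D)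
    (hT : T ∈ SSTStar χ χ') (hT' : T' ∈ SSTStar χ χ') : T = T' := by
  have key := fun k => node_injective ((h.2 k).symm.trans (h'.2 k))
  exact Prod.ext (filling_ext hT.1 hT'.1 fun k => (key k).1) (filling_ext hT.2 hT'.2 fun k => (key k).2)

theorem exists_isNode_of_ssdt (hD : IsSSDT (nodeShape m χ χ') D) :
    ∃ T ∈ SSTStar χ χ', IsNode m χ χ' T D := by
  have h := hD.self
  have hex : ∀ k, ∃ U V, dominoBelow D k = node m U V := by
    intro k
    induction k with
    | zero => exact ⟨_, _, (IsSSDT.dominoBelow_zero D).trans (by rw [hD.shape_eq]; rfl)⟩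
    | succ k ih =>
      obtain ⟨U, V, hUV⟩ := ih
      have h1 := h.dominoStrip k
      rw [hUV] at h1
      obtain ⟨U', V', -, -, -, -, h2⟩ := h1.exists_cellStrip
      exact ⟨U', V', h2⟩
  choose U V hUV using hex
  have hstrip : ∀ k, ∃ Y₀ Y₁, CellStrip (U k) (U (k + 1)) Y₀ ∧ CellStrip (V k) (V (k + 1)) Y₁ := by
    intro k
    have h1 := h.dominoStrip k
    rw [hUV k] at h1
    obtain ⟨U', V', Y₀, Y₁, h2, h3, h4⟩ := h1.exists_cellStrip
    rw [hUV] at h4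
    obtain ⟨rfl, rfl⟩ := node_injective h4
    exact ⟨Y₀, Y₁, h2, h3⟩
  choose Y₀ Y₁ hY₀ hY₁ using hstrip
  obtain ⟨K, hK⟩ := h.exists_dominoBelow_eq
  have hlim : ∀ k, K ≤ k → U k = χ.outer ∧ V k = χ'.outer := by
    intro k hk
    have := hK k hk
    rw [hUV, hD.shape_eq] at this
    exact node_injective this
  have h0 : U 0 = χ.inner ∧ V 0 = χ'.inner := by
    have := IsSSDT.dominoBelow_zero D
    rw [hUV, hD.shape_eq] at this
    exact node_injective this
  obtain ⟨T₀, hT₀, e₀⟩ := exists_filling (χ := χ) U Y₀ hY₀ h0.1 ⟨K, (hlim K le_rfl).1⟩ fun k => by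
    rw [← (hlim (max k K) (le_max_right _ _)).1]
    exact le_of_step (fun k => (hY₀ k).le) (le_max_left _ _)
  obtain ⟨T₁, hT₁, e₁⟩ := exists_filling (χ := χ') V Y₁ hY₁ h0.2 ⟨K, (hlim K le_rfl).2⟩ fun k => by
    rw [← (hlim (max k K) (le_max_right _ _)).2]
    exact le_of_step (fun k => (hY₁ k).le) (le_max_left _ _)
  exact ⟨(T₀, T₁), ⟨hT₀, hT₁⟩, hD, fun k => by rw [hUV, e₀, e₁]⟩

theorem IsNode.posSet_eq (h : IsNode m χ χ' T D) (hT : T ∈ SSTStar χ χ') (k : ℕ) :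
    posSet D k = nodeSet m (entrySet χ T.1 k) (entrySet χ' T.2 k) := by
  have h1 := h.1.self.dominoStrip k
  rw [h.2, h.2] at h1
  exact h1.unique (dominoStrip_node m (cellStrip_filling hT.1 k) (cellStrip_filling hT.2 k))

theorem card_nodeSet (m : ℤ) (Y₀ Y₁ : Finset ℤ) : (nodeSet m Y₀ Y₁).card = Y₀.card + Y₁.card := by
  rw [nodeSet, Finset.card_union_of_disjoint, Finset.card_image_of_injective,
    Finset.card_image_of_injective]
  · intro a b h
    simp only at h
    omega
  · intro a b h
    simp only at h
    omega
  · rw [Finset.disjoint_left]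
    intro p h0 h1
    obtain ⟨a, -, ha⟩ := Finset.mem_image.1 h0
    obtain ⟨b, -, hb⟩ := Finset.mem_image.1 h1
    omega

theorem IsNode.dominoWt_eq (h : IsNode m χ χ' T D) (hT : T ∈ SSTStar χ χ') :
    dominoWt D = starWt χ χ' T := by
  funext k
  rw [h.1.self.dominoWt_eq, h.posSet_eq hT, card_nodeSet, starWt, fillingWt_eq hT.1, fillingWt_eq hT.2]

theorem isCqTableau_iff (c : ℤ) : IsCqTableau c χ χ' T.1 T.2 D ↔ IsNode (2 * c) χ χ' T D := by
  simp only [IsCqTableau, IsNode, cqShape, nodeShape, cq_eq_node]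

theorem isCqTableau_iff' (c : ℤ) : IsCqTableau c χ' χ T.2 T.1 D ↔ IsNode (1 - 2 * c) χ χ' T D := by
  simp only [IsCqTableau, IsNode, cqShape, nodeShape, cq_eq_node']

theorem mem_segregated_iff {S : DominoTableau} : S ∈ Segregated χ χ' T ↔
    ∃ m : ℤ, m ≤ 1 - ((χ.outer.rowLen 0 : ℤ) + χ'.outer.colLen 0) ∧ IsNode m χ χ' T S := by
  constructor
  · rintro ⟨k, ⟨hk, h⟩ | ⟨hk, h⟩⟩
    · exact ⟨2 * k, by omega, (isCqTableau_iff k).1 h⟩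
    · exact ⟨1 - 2 * k, by omega, (isCqTableau_iff' k).1 h⟩
  · rintro ⟨m, hm, h⟩
    rcases Int.even_or_odd' m with ⟨k, rfl | rfl⟩
    · exact ⟨k, Or.inl ⟨by omega, (isCqTableau_iff k).2 h⟩⟩
    · refine ⟨-k, Or.inr ⟨by omega, (isCqTableau_iff' _).2 ?_⟩⟩
      rwa [show 1 - 2 * -k = 2 * k + 1 by ring]

end Node

/-! ### Segregated tableaux -/

section Segregated

variable {m : ℤ} {χ χ' : SkewShape} {T T' : Filling × Filling} {D : DominoTableau}

theorem content_lt_of_mem_cells {x : ℕ × ℕ} (hx : x ∈ χ.cells) :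
    content x < χ.outer.rowLen 0 ∧ -(χ.outer.colLen 0 : ℤ) < content x := by
  have h := ((SkewShape.mem_cells _ _).1 hx).1
  have h1 : (0, x.2) ∈ χ.outer := χ.outer.up_left_mem (Nat.zero_le _) le_rfl h
  have h2 : (x.1, 0) ∈ χ.outer := χ.outer.up_left_mem le_rfl (Nat.zero_le _) h
  rw [YoungDiagram.mem_iff_lt_rowLen] at h1
  rw [YoungDiagram.mem_iff_lt_colLen] at h2
  unfold content
  omega

theorem content_lt_of_mem_entrySet {Z : Filling} {k : ℕ} {q : ℤ} (hq : q ∈ entrySet χ Z k) :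
    q < χ.outer.rowLen 0 ∧ -(χ.outer.colLen 0 : ℤ) < q := by
  obtain ⟨x, hx, -, rfl⟩ := mem_entrySet.1 hq
  exact content_lt_of_mem_cells hx

/-- Dominoes that come from `T.1` and from `T.2` have positions of different parity, with bounds that keep
them far apart when `m` is small. -/
theorem IsNode.pos_cases (h : IsNode m χ χ' T D) (hT : T ∈ SSTStar χ χ') {d} (hd : d ∈ D.dominoes) :
    (∃ q, pos d.1 = 2 * q + m ∧ q < χ.outer.rowLen 0) ∨
      ∃ q, pos d.1 = 2 * q + 1 - m ∧ -(χ'.outer.colLen 0 : ℤ) < q := by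
  have hp : pos d.1 ∈ posSet D d.2 := mem_posSet.2 ⟨d, hd, rfl, rfl⟩
  rw [h.posSet_eq hT, mem_nodeSet] at hp
  rcases hp with ⟨q, hq, hp⟩ | ⟨q, hq, hp⟩
  · exact Or.inl ⟨q, hp.symm, (content_lt_of_mem_entrySet hq).1⟩
  · exact Or.inr ⟨q, hp.symm, (content_lt_of_mem_entrySet hq).2⟩

/-- When passing from one segregated tableau to the next, all chains are open: the dominoes that come from
`T.1` all move to the right, and the last one of these in a chain moves to a diagonal that the chain did
not meet before; if a chain has no such dominoes, the same holds for its first domino, as those that come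
from `T.2` all move to the left. -/
theorem IsNode.isOpenChain (h : IsNode m χ χ' T D) (hT : T ∈ SSTStar χ χ')
    (hm : m + 1 ≤ 1 - ((χ.outer.rowLen 0 : ℤ) + χ'.outer.colLen 0)) {i : Fin 2} (hi : IsVar i (m + 1))
    {d} (hd : d ∈ D.dominoes) : IsOpenChain i D d := by
  classical
  by_contra hcl
  have hmoved : ∀ e ∈ D.dominoes, IsDomino (moved i D e) ∧ pos (moved i D e) = otherPos i (pos e.1) :=
    fun e he => isDomino_of_inPlace i (stdShape D e) _ _ (h.1.self.mem_moved_iff i he)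
  have hZ : ∀ e ∈ chain i D d, e ∈ D.dominoes := fun e he => (mem_chain.1 he).1
  have hclosed := exists_mem_chain_iff hcl
  have i2 := i.2
  have hpar : ∀ q : ℤ, ¬ IsVar i (2 * q + m) ∧ IsVar i (2 * q + 1 - m) := by
    intro q
    unfold IsVar at hi ⊢
    omega
  have hne : (chain i D d).Nonempty := ⟨d, self_mem_chain hd⟩
  -- A closed chain contains no domino that comes from `T.1`, as the last one would leave it.
  have case0 : ∀ z ∈ chain i D d, IsVar i (pos z.1) := by
    by_contra hex
    push Not at hex
    obtain ⟨z₀, hz₀, hv₀⟩ := hex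
    obtain ⟨z, hz, hmax⟩ := ((chain i D d).filter fun z => ¬ IsVar i (pos z.1)).exists_max_image
      (fun z => pos z.1) ⟨z₀, Finset.mem_filter.2 ⟨hz₀, hv₀⟩⟩
    rw [Finset.mem_filter] at hz
    obtain ⟨hm1, hm2⟩ := hmoved z (hZ z hz.1)
    rw [otherPos, if_neg hz.2] at hm2
    obtain ⟨x, hx, hxc⟩ := hm1.exists_content_eq (Or.inl hm2)
    obtain ⟨e, he, hxe⟩ := (hclosed x).1 ⟨z, hz.1, hx⟩
    have hce := (h.1.isDomino e (hZ e he)).content_mem hxe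
    rcases h.pos_cases hT (hZ z hz.1) with ⟨q, hq, hqb⟩ | ⟨q, hq, -⟩
    · rcases h.pos_cases hT (hZ e he) with ⟨r, hr, -⟩ | ⟨r, hr, hrb⟩
      · have := hmax e (Finset.mem_filter.2 ⟨he, hr ▸ (hpar r).1⟩)
        omega
      · omega
    · exact hz.2 (hq ▸ (hpar q).2)
  obtain ⟨z, hz, hmin⟩ := (chain i D d).exists_min_image (fun z => pos z.1) hne
  obtain ⟨hm1, hm2⟩ := hmoved z (hZ z hz)
  rw [otherPos, if_pos (case0 z hz)] at hm2
  obtain ⟨x, hx, hxc⟩ := hm1.exists_content_eq (c := pos z.1 - 2) (Or.inr (by omega))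
  obtain ⟨e, he, hxe⟩ := (hclosed x).1 ⟨z, hz, hx⟩
  have hce := (h.1.isDomino e (hZ e he)).content_mem hxe
  have := hmin e he
  omega

theorem reflect_nodeShape {i : Fin 2} (hi : IsVar i (m + 1)) :
    (⟨reflect i (nodeShape m χ χ').outer, reflect i (nodeShape m χ χ').inner⟩ : SkewShape) =
      nodeShape (m + 1) χ χ' := by
  simp only [nodeShape, reflect_node i m hi]

theorem IsSSDT.moveOpen_node (h : IsSSDT (nodeShape m χ χ') D) {i : Fin 2} (hi : IsVar i (m + 1)) :
    IsSSDT (nodeShape (m + 1) χ χ') (DominoLR.moveOpen i D) := by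
  have := h.self.moveOpen i
  rwa [h.shape_eq, reflect_nodeShape hi] at this

theorem IsNode.moveOpen_succ (h : IsNode m χ χ' T D) (hT : T ∈ SSTStar χ χ')
    (hm : m + 1 ≤ 1 - ((χ.outer.rowLen 0 : ℤ) + χ'.outer.colLen 0)) {i : Fin 2}
    (hi : IsVar i (m + 1)) : IsNode (m + 1) χ χ' T (moveOpen i D) := by
  refine ⟨h.1.moveOpen_node hi, fun k => ?_⟩
  rw [h.1.self.dominoBelow_moveOpen fun d hd => h.isOpenChain hT hm hi hd, h.2, reflect_node i m hi]

theorem tail_nodeSet (m : ℤ) (Y₀ Y₁ : Finset ℤ) (x : ℤ) :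
    tail (nodeSet m Y₀ Y₁) x = tail Y₀ ((x - m + 1) / 2) + tail Y₁ ((x + m) / 2) := by
  have h : (nodeSet m Y₀ Y₁).filter (fun p => x ≤ p) =
      nodeSet m (Y₀.filter fun q => (x - m + 1) / 2 ≤ q) (Y₁.filter fun q => (x + m) / 2 ≤ q) := by
    ext p
    simp only [Finset.mem_filter, mem_nodeSet]
    constructor
    · rintro ⟨⟨q, hq, rfl⟩ | ⟨q, hq, rfl⟩, hx⟩
      · exact Or.inl ⟨q, ⟨hq, by omega⟩, rfl⟩
      · exact Or.inr ⟨q, ⟨hq, by omega⟩, rfl⟩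
    · rintro (⟨q, ⟨hq, hx⟩, rfl⟩ | ⟨q, ⟨hq, hx⟩, rfl⟩)
      · exact ⟨Or.inl ⟨q, hq, rfl⟩, by omega⟩
      · exact ⟨Or.inr ⟨q, hq, rfl⟩, by omega⟩
  unfold tail
  rw [h, card_nodeSet]
  push_cast
  rfl

theorem tail_eq_zero {Y : Finset ℤ} {a x : ℤ} (h : ∀ q ∈ Y, q < a) (hx : a ≤ x) : tail Y x = 0 := by
  unfold tail
  rw [Nat.cast_eq_zero, Finset.card_eq_zero, Finset.filter_eq_empty_iff]
  intro q hq
  have := h q hq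
  omega

theorem tail_eq_card {Y : Finset ℤ} {a x : ℤ} (h : ∀ q ∈ Y, a < q) (hx : x ≤ a + 1) :
    tail Y x = Y.card := by
  unfold tail
  rw [Finset.filter_true_of_mem]
  intro q hq
  have := h q hq
  omega

/-- For strips whose two parts are far apart, the lattice condition splits into one for each part. -/
theorem dominates_nodeSet_iff {a b : ℤ} (hm : m ≤ 1 - (a + b)) {Y₀ Y₀' Y₁ Y₁' : Finset ℤ}
    (h₀ : ∀ q ∈ Y₀, q < a) (h₀' : ∀ q ∈ Y₀', q < a) (h₁ : ∀ q ∈ Y₁, -b < q) (h₁' : ∀ q ∈ Y₁', -b < q) :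
    Dominates (nodeSet m Y₀ Y₁) (nodeSet m Y₀' Y₁') ↔ Dominates Y₁ Y₁' ∧
      ∀ x, (Y₁'.card : ℤ) + tail Y₀' x ≤ Y₁.card + tail Y₀ (x + 1) := by
  have hleft : ∀ q, tail (nodeSet m Y₀' Y₁') (2 * q + m) = tail Y₀' q + tail Y₁' (q + m) ∧
      tail (nodeSet m Y₀ Y₁) (2 * q + m + 1) = tail Y₀ (q + 1) + tail Y₁ (q + m) := by
    intro q
    rw [tail_nodeSet, tail_nodeSet]
    constructor <;> congr 2 <;> omega
  have hright : ∀ q, tail (nodeSet m Y₀' Y₁') (2 * q + 1 - m) = tail Y₀' (q + 1 - m) + tail Y₁' q ∧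
      tail (nodeSet m Y₀ Y₁) (2 * q + 1 - m + 1) = tail Y₀ (q + 1 - m) + tail Y₁ (q + 1) := by
    intro q
    rw [tail_nodeSet, tail_nodeSet]
    constructor <;> congr 2 <;> omega
  constructor
  · intro hd
    have hA : ∀ q, -b ≤ q → tail Y₁' q ≤ tail Y₁ (q + 1) := by
      intro q hq
      have h2 := hd (2 * q + 1 - m)
      rw [(hright q).1, (hright q).2, tail_eq_zero h₀ (by omega), tail_eq_zero h₀' (by omega)] at h2
      omega
    have hcard : (Y₁'.card : ℤ) ≤ Y₁.card := by
      have h2 := hA (-b) le_rfl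
      rwa [tail_eq_card h₁ le_rfl, tail_eq_card h₁' (by omega)] at h2
    refine ⟨fun q => ?_, fun q => ?_⟩
    · rcases le_or_gt (-b) q with hq | hq
      · exact hA q hq
      · rwa [tail_eq_card h₁ (by omega), tail_eq_card h₁' (by omega)]
    · rcases le_or_gt a q with hq | hq
      · rwa [tail_eq_zero h₀ (by omega), tail_eq_zero h₀' hq, add_zero, add_zero]
      · have h2 := hd (2 * q + m)
        rw [(hleft q).1, (hleft q).2, tail_eq_card h₁ (by omega), tail_eq_card h₁' (by omega)] at h2
        omega
  · rintro ⟨hA, hB⟩ x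
    rcases left_or_right m x with ⟨q, rfl⟩ | ⟨q, rfl⟩
    · rw [(hleft q).1, (hleft q).2]
      rcases le_or_gt a q with hq | hq
      · rw [tail_eq_zero h₀ (by omega), tail_eq_zero h₀' hq, zero_add, zero_add]
        exact (hA _).trans (tail_antitone _ (by omega))
      · rw [tail_eq_card h₁ (by omega), tail_eq_card h₁' (by omega)]
        have := hB q
        omega
    · rw [(hright q).1, (hright q).2]
      rcases le_or_gt (-b) q with hq | hq
      · rw [tail_eq_zero h₀ (by omega), tail_eq_zero h₀' (by omega), zero_add, zero_add]
        exact hA q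
      · rw [tail_eq_card h₁ (by omega), tail_eq_card h₁' (by omega)]
        have h2 := hB (q + 1 - m)
        have h3 := tail_antitone Y₀ (show q + 1 - m ≤ q + 1 - m + 1 by omega)
        omega

theorem IsNode.mem_yam2_iff (h : IsNode m χ χ' T D) (hT : T ∈ SSTStar χ χ')
    (hm : m ≤ 1 - ((χ.outer.rowLen 0 : ℤ) + χ'.outer.colLen 0)) :
    D ∈ Yam2 D.shape ↔ T ∈ LR χ χ' := by
  rw [h.1.self.mem_yam2_iff, mem_LR_iff hT]
  refine forall_congr' fun k => ?_
  rw [h.posSet_eq hT, h.posSet_eq hT]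
  exact dominates_nodeSet_iff hm (fun q hq => (content_lt_of_mem_entrySet hq).1)
    (fun q hq => (content_lt_of_mem_entrySet hq).1) (fun q hq => (content_lt_of_mem_entrySet hq).2)
    (fun q hq => (content_lt_of_mem_entrySet hq).2)

end Segregated

/-! ### Orbits of segregated tableaux -/

theorem exists_isVar (c : ℤ) : ∃ i : Fin 2, IsVar i c := by
  rcases Int.emod_two_eq_zero_or_one c with h | h
  · exact ⟨0, h⟩
  · exact ⟨1, h⟩

/-- A parametrisation by the integers of the orbit of the segregated tableaux for `T`: neighbouring
tableaux are obtained from each other by moving open chains. -/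
structure IsFamily (χ χ' : SkewShape) (T : Filling × Filling) (F : ℤ → DominoTableau) : Prop where
  isNode : ∀ m ≤ 1 - ((χ.outer.rowLen 0 : ℤ) + χ'.outer.colLen 0), IsNode m χ χ' T (F m)
  step : ∀ m i, IsVar i (m + 1) → F (m + 1) = moveOpen i (F m)

theorem isVar_unique {i j : Fin 2} {c : ℤ} (hi : IsVar i c) (hj : IsVar j c) : i = j := by
  unfold IsVar at hi hj
  exact Fin.ext (by omega)

theorem exists_isFamily {χ χ' : SkewShape} (hχ : χ.inner ≤ χ.outer) (hχ' : χ'.inner ≤ χ'.outer)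
    {T : Filling × Filling} (hT : T ∈ SSTStar χ χ') : ∃ F, IsFamily χ χ' T F := by
  obtain ⟨M, hM⟩ : ∃ M, M = 1 - ((χ.outer.rowLen 0 : ℤ) + χ'.outer.colLen 0) := ⟨_, rfl⟩
  choose S hS using fun m : ℤ => exists_isNode m hχ hχ' hT
  choose par hpar using exists_isVar
  let G : ℕ → DominoTableau := fun n => n.rec (S M) fun n D => moveOpen (par (M + n + 1)) D
  have hG : ∀ n : ℕ, G (n + 1) = moveOpen (par (M + n + 1)) (G n) := fun n => rfl
  refine ⟨fun m => if m ≤ M then S m else G (m - M).toNat, fun m hm => ?_, fun m i hi => ?_⟩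
  · rw [if_pos (hM ▸ hm)]
    exact hS m
  · obtain rfl : i = par (m + 1) := isVar_unique hi (hpar _)
    rcases lt_trichotomy m M with h | rfl | h
    · rw [if_pos (by omega), if_pos h.le]
      exact (hS (m + 1)).unique ((hS m).moveOpen_succ hT (by omega) hi)
    · rw [if_neg (by omega), if_pos le_rfl, show (m + 1 - m).toNat = 0 + 1 by omega, hG]
      simp only [Nat.cast_zero, add_zero]
      rfl
    · rw [if_neg (by omega), if_neg (by omega),
        show (m + 1 - M).toNat = (m - M).toNat + 1 by omega, hG]
      rw [show M + ((m - M).toNat : ℤ) + 1 = m + 1 by omega]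

namespace IsFamily

variable {χ χ' : SkewShape} {T : Filling × Filling} {F : ℤ → DominoTableau}

theorem isSSDT (hF : IsFamily χ χ' T F) (m : ℤ) : IsSSDT (nodeShape m χ χ') (F m) := by
  rcases le_total m (1 - ((χ.outer.rowLen 0 : ℤ) + χ'.outer.colLen 0)) with h | h
  · exact (hF.isNode m h).1
  · induction m, h using Int.leInduction with
    | base => exact (hF.isNode _ le_rfl).1
    | succ m _ ih =>
      obtain ⟨i, hi⟩ := exists_isVar (m + 1)
      rw [hF.step m i hi]
      exact ih.moveOpen_node hi

theorem step_back (hF : IsFamily χ χ' T F) {m : ℤ} {i : Fin 2} (hi : IsVar i (m + 1)) :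
    F m = moveOpen i (F (m + 1)) := by
  rw [hF.step m i hi, (hF.isSSDT m).self.moveOpen_moveOpen]

/-- Properties that are preserved by moving open chains hold for all members of a family or for none. -/
theorem iff_of_moveOpen (hF : IsFamily χ χ' T F) {P : DominoTableau → Prop}
    (hP : ∀ D i, IsSSDT D.shape D → P D → P (moveOpen i D)) (m m' : ℤ) : P (F m) → P (F m') := by
  intro h
  induction m' using Int.inductionOn' (b := m) with
  | zero => exact h
  | succ k _ ih =>
    obtain ⟨i, hi⟩ := exists_isVar (k + 1)
    rw [hF.step k i hi]
    exact hP _ _ (hF.isSSDT k).self ih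
  | pred k _ ih =>
    obtain ⟨i, hi⟩ := exists_isVar (k - 1 + 1)
    rw [hF.step_back hi, sub_add_cancel]
    exact hP _ _ (hF.isSSDT k).self ih

theorem mem_openOrbit_iff (hF : IsFamily χ χ' T F) (m : ℤ) (D : DominoTableau) :
    D ∈ openOrbit (F m) ↔ ∃ m', D = F m' := by
  constructor
  · intro h
    induction (show Relation.ReflTransGen _ _ _ from h) with
    | refl => exact ⟨m, rfl⟩
    | tail _ hs ih =>
      obtain ⟨k, rfl⟩ := ih ‹_›
      obtain ⟨i, rfl⟩ := hs
      by_cases hi : IsVar i (k + 1)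
      · exact ⟨k + 1, (hF.step k i hi).symm⟩
      · refine ⟨k - 1, ?_⟩
        rw [isVar_succ_iff, not_not] at hi
        have := hF.step_back (m := k - 1) (i := i) (by rwa [sub_add_cancel])
        rw [this, sub_add_cancel]
  · rintro ⟨m', rfl⟩
    exact hF.iff_of_moveOpen (P := fun D => D ∈ openOrbit (F m))
      (fun D i _ h => Relation.ReflTransGen.tail h ⟨i, rfl⟩) m m' Relation.ReflTransGen.refl

/-- When the two skew shapes coincide, the shapes for `m` and `1 - m` do as well. In this case all
chains for `s_1` of the tableau for `m = 0` are closed, and the family is symmetric. -/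
theorem symm (hF : IsFamily χ χ T F) (m : ℤ) : F (1 - m) = F m := by
  have h1 : F 1 = F 0 := by
    have hi : IsVar 1 (0 + 1 : ℤ) := rfl
    have hr := fun U => (reflect_node 1 0 hi U U).trans ((node_comm 0 U U).trans (by simp)).symm
    rw [show (1 : ℤ) = 0 + 1 by ring, hF.step 0 1 hi]
    refine (hF.isSSDT 0).self.moveOpen_eq_self ?_ ?_ <;> rw [(hF.isSSDT 0).shape_eq] <;> exact hr _
  have key : ∀ n : ℕ, F (n + 1) = F (-n) := by
    intro n
    induction n with
    | zero => simpa using h1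
    | succ n ih =>
      obtain ⟨i, hi⟩ := exists_isVar ((n : ℤ) + 1 + 1)
      push_cast
      rw [hF.step _ i hi, ih, hF.step_back (m := -(n + 1 : ℤ)) (i := i)]
      · congr 2
        ring
      · unfold IsVar at hi ⊢
        omega
  rcases le_or_gt m 0 with h | h
  · have := key (-m).toNat
    rwa [show (((-m).toNat : ℕ) : ℤ) = -m by omega, neg_neg, neg_add_eq_sub] at this
  · have := key (m - 1).toNat
    rw [show (((m - 1).toNat : ℕ) : ℤ) = m - 1 by omega, sub_add_cancel, neg_sub] at this
    exact this.symm

/-- The members of a family are determined by their shapes. -/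
theorem eq_of_shape_eq (hF : IsFamily χ χ' T F) {m m' : ℤ} (h : (F m').shape = nodeShape m χ χ') :
    F m' = F m := by
  rw [(hF.isSSDT m').shape_eq] at h
  simp only [nodeShape, SkewShape.mk.injEq] at h
  obtain ⟨h1, h2⟩ := h
  rcases node_eq_iff.1 h1 with ⟨rfl, -⟩ | ⟨rfl, h3, -⟩
  · rfl
  · rcases node_eq_iff.1 h2 with ⟨h4, -⟩ | ⟨-, h4, -⟩
    · omega
    · obtain ⟨U, V⟩ := χ
      obtain ⟨U', V'⟩ := χ'
      obtain rfl : U = U' := h3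
      obtain rfl : V = V' := h4
      exact (hF.symm m').symm

theorem mem_openOrbit_and_shape_iff (hF : IsFamily χ χ' T F) {S : DominoTableau}
    (hS : S ∈ Segregated χ χ' T) (m : ℤ) (D : DominoTableau) :
    D ∈ openOrbit S ∧ D.shape = nodeShape m χ χ' ↔ D = F m := by
  obtain ⟨m₀, hm₀, h₀⟩ := mem_segregated_iff.1 hS
  rw [h₀.unique (hF.isNode m₀ hm₀), hF.mem_openOrbit_iff]
  constructor
  · rintro ⟨⟨m', rfl⟩, h⟩
    exact hF.eq_of_shape_eq h
  · rintro rfl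
    exact ⟨⟨m, rfl⟩, (hF.isSSDT m).shape_eq⟩

theorem segregated_nonempty (hF : IsFamily χ χ' T F) : (Segregated χ χ' T).Nonempty :=
  ⟨_, mem_segregated_iff.2 ⟨_, le_rfl, hF.isNode _ le_rfl⟩⟩

theorem orbitElement_eq (hF : IsFamily χ χ' T F) (m : ℤ) :
    orbitElement χ χ' (nodeShape m χ χ') T = F m := by
  obtain ⟨S, hS⟩ := hF.segregated_nonempty
  obtain ⟨S', hS', h⟩ := Classical.epsilon_spec
    (p := fun D => ∃ S ∈ Segregated χ χ' T, D ∈ openOrbit S ∧ D.shape = nodeShape m χ χ')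
    ⟨F m, S, hS, (hF.mem_openOrbit_and_shape_iff hS m _).2 rfl⟩
  exact (hF.mem_openOrbit_and_shape_iff hS' m _).1 h

theorem dominoWt_eq (hF : IsFamily χ χ' T F) (hT : T ∈ SSTStar χ χ') (m : ℤ) :
    dominoWt (F m) = starWt χ χ' T :=
  hF.iff_of_moveOpen (P := fun D => dominoWt D = starWt χ χ' T)
    (fun _ i hD h => (hD.dominoWt_moveOpen i).trans h) _ m ((hF.isNode _ le_rfl).dominoWt_eq hT)

theorem mem_yam2_iff (hF : IsFamily χ χ' T F) (hT : T ∈ SSTStar χ χ') (m : ℤ) :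
    F m ∈ Yam2 (nodeShape m χ χ') ↔ T ∈ LR χ χ' := by
  rw [← (hF.isSSDT m).shape_eq, ← (hF.isNode _ le_rfl).mem_yam2_iff hT le_rfl]
  have hP : ∀ (D : DominoTableau) (i : Fin 2), IsSSDT D.shape D → D ∈ Yam2 D.shape →
      moveOpen i D ∈ Yam2 (moveOpen i D).shape := fun D i hD h => hD.moveOpen_mem_yam2 i h
  exact ⟨hF.iff_of_moveOpen (P := fun D => D ∈ Yam2 D.shape) hP _ _,
    hF.iff_of_moveOpen (P := fun D => D ∈ Yam2 D.shape) hP _ _⟩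

/-- Families for different pairs of tableaux are disjoint. -/
theorem filling_unique {T' : Filling × Filling} {F' : ℤ → DominoTableau} (hF : IsFamily χ χ' T F)
    (hF' : IsFamily χ χ' T' F') (hT : T ∈ SSTStar χ χ') (hT' : T' ∈ SSTStar χ χ') {m : ℤ}
    (h : F m = F' m) : T = T' := by
  have key : ∀ n : ℕ, F (m - n) = F' (m - n) := by
    intro n
    induction n with
    | zero => simpa using h
    | succ n ih =>
      obtain ⟨i, hi⟩ := exists_isVar (m - (n + 1 : ℕ) + 1)
      rw [hF.step_back hi, hF'.step_back hi]
      rw [show m - (n + 1 : ℕ) + 1 = m - n by push_cast; ring, ih]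
  obtain ⟨n, hn⟩ : ∃ n : ℕ, m - n ≤ 1 - ((χ.outer.rowLen 0 : ℤ) + χ'.outer.colLen 0) :=
    ⟨m.toNat + χ.outer.rowLen 0 + χ'.outer.colLen 0, by push_cast; omega⟩
  have h1 := hF.isNode _ hn
  rw [key n] at h1
  exact h1.filling_unique (hF'.isNode _ hn) hT hT'

end IsFamily

/-- Every semistandard domino tableau belongs to a family: moving open chains leads to a segregated
tableau. -/
theorem exists_isFamily_of_ssdt {χ χ' : SkewShape} (hχ : χ.inner ≤ χ.outer)
    (hχ' : χ'.inner ≤ χ'.outer) {m : ℤ} {D : DominoTableau} (hD : IsSSDT (nodeShape m χ χ') D) :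
    ∃ T ∈ SSTStar χ χ', ∃ F, IsFamily χ χ' T F ∧ F m = D := by
  have key : ∀ (n : ℕ) (m : ℤ) (D : DominoTableau),
      m - n ≤ 1 - ((χ.outer.rowLen 0 : ℤ) + χ'.outer.colLen 0) → IsSSDT (nodeShape m χ χ') D →
      ∃ T ∈ SSTStar χ χ', ∃ F, IsFamily χ χ' T F ∧ F m = D := by
    intro n
    induction n with
    | zero =>
      intro m D hm hD
      obtain ⟨T, hT, hN⟩ := exists_isNode_of_ssdt hD
      obtain ⟨F, hF⟩ := exists_isFamily hχ hχ' hT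
      exact ⟨T, hT, F, hF, (hF.isNode m (by simpa using hm)).unique hN⟩
    | succ n ih =>
      intro m D hm hD
      obtain ⟨i, hi⟩ := exists_isVar (m - 1 + 1)
      have hmm : m - 1 + 1 = m := sub_add_cancel m 1
      have hr : IsSSDT (nodeShape (m - 1) χ χ') (moveOpen i D) := by
        have h1 := hD.self.moveOpen i
        have h2 := reflect_nodeShape (χ := χ) (χ' := χ') hi
        rw [hD.shape_eq, ← hmm, ← h2] at h1
        simpa only [reflect_reflect] using h1
      obtain ⟨T, hT, F, hF, hFD⟩ := ih (m - 1) _ (by push_cast at hm; omega) hr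
      refine ⟨T, hT, F, hF, ?_⟩
      have := hF.step (m - 1) i hi
      rw [hmm, hFD, hD.self.moveOpen_moveOpen] at this
      exact this
  exact key (m.toNat + χ.outer.rowLen 0 + χ'.outer.colLen 0) m D (by push_cast; omega) hD

theorem bijOn_orbitElement {χ χ' : SkewShape} (hχ : χ.inner ≤ χ.outer) (hχ' : χ'.inner ≤ χ'.outer)
    (m : ℤ) : Set.BijOn (orbitElement χ χ' (nodeShape m χ χ')) (LR χ χ')
      (Yam2 (nodeShape m χ χ')) := by
  refine ⟨fun T hT => ?_, fun T hT T' hT' h => ?_, fun D hD => ?_⟩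
  · obtain ⟨F, hF⟩ := exists_isFamily hχ hχ' hT.1
    rw [hF.orbitElement_eq]
    exact (hF.mem_yam2_iff hT.1 m).2 hT
  · obtain ⟨F, hF⟩ := exists_isFamily hχ hχ' hT.1
    obtain ⟨F', hF'⟩ := exists_isFamily hχ hχ' hT'.1
    rw [hF.orbitElement_eq, hF'.orbitElement_eq] at h
    exact hF.filling_unique hF' hT.1 hT'.1 h
  · obtain ⟨T, hT, F, hF, rfl⟩ := exists_isFamily_of_ssdt hχ hχ' hD.1
    exact ⟨T, (hF.mem_yam2_iff hT m).1 hD, hF.orbitElement_eq m⟩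

theorem cqShape_eq (c : ℤ) (χ χ' : SkewShape) : cqShape c χ χ' = nodeShape (2 * c) χ χ' := by
  simp only [cqShape, nodeShape, cq_eq_node]

theorem cqShape_eq' (c : ℤ) (χ χ' : SkewShape) : cqShape c χ' χ = nodeShape (1 - 2 * c) χ χ' := by
  simp only [cqShape, nodeShape, cq_eq_node']

end DominoLR

open DominoLR in
theorem mainTheorem2 (χ χ' : SkewShape) (hχ : χ.inner ≤ χ.outer) (hχ' : χ'.inner ≤ χ'.outer)
    (c : ℤ) :
    (∀ T ∈ SSTStar χ χ',
      (Segregated χ χ' T).Nonempty ∧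
      (∀ S ∈ Segregated χ χ' T, ∀ D,
        (D ∈ openOrbit S ∧ D.shape = cqShape c χ χ' ↔ D = Phi c χ χ' T) ∧
        (D ∈ openOrbit S ∧ D.shape = cqShape c χ' χ ↔ D = Phi' c χ χ' T)) ∧
      Phi c χ χ' T ∈ SSDT (cqShape c χ χ') ∧
      Phi' c χ χ' T ∈ SSDT (cqShape c χ' χ) ∧
      dominoWt (Phi c χ χ' T) = starWt χ χ' T ∧
      dominoWt (Phi' c χ χ' T) = starWt χ χ' T) ∧
    Set.BijOn (Phi c χ χ') (LR χ χ') (Yam2 (cqShape c χ χ')) ∧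
    Set.BijOn (Phi' c χ χ') (LR χ χ') (Yam2 (cqShape c χ' χ)) := by
  unfold Phi Phi'
  rw [cqShape_eq, cqShape_eq']
  refine ⟨fun T hT => ?_, bijOn_orbitElement hχ hχ' _, bijOn_orbitElement hχ hχ' _⟩
  obtain ⟨F, hF⟩ := exists_isFamily hχ hχ' hT
  rw [hF.orbitElement_eq, hF.orbitElement_eq]
  exact ⟨hF.segregated_nonempty, fun S hS D => ⟨hF.mem_openOrbit_and_shape_iff hS _ D,
    hF.mem_openOrbit_and_shape_iff hS _ D⟩, hF.isSSDT _, hF.isSSDT _, hF.dominoWt_eq hT _,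
    hF.dominoWt_eq hT _⟩
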